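/- **Notation.** For $\lambda>-1/2$, $\lambda\ne0$, let $C_n^\lambda(x)=\frac{(2\lambda)_n}{n!}\,{}_2F_1\!\left(-n,n+2\lambda;\lambda+\tfrac12;\tfrac{1-x}{2}\right)$ be the Gegenbauer polynomials, $\omega_\lambda(x)=(1-x^2)^{\lambda-1/2}$, and let $$S_n^\lambda f=\sum_{k=0}^n a_k^\lambda C_k^\lambda,\qquad a_k^\lambda=\frac{\int_{-1}^1\omega_\lambda f\,C_k^\lambda\,dx}{\int_{-1}^1\omega_\lambda (C_k^\lambda)^2\,dx}$$ be the Gegenbauer projection of degree $n$. Let $\|\cdot\|_\infty$ be the maximum norm on $[-1,1]$. For $\rho>1$ let $\mathcal E_\rho=\{\frac12(u+u^{-1}):|u|=\rho\}$ be the Bernstein ellipse, $L(\mathcal E_\rho)$ its length, and let $\mathcal A_\rho$ be the set of complex functions that are analytic in the open region bounded by $\mathcal E_\rho$ and continuous on its closure. For $f\in\mathcal A_\rho$ put $M=\max_{\mathcal E_\rho}|f|$ and $$D_\lambda(\rho)=\frac{M\,L(\mathcal E_\rho)}{\pi\rho}\cdot\begin{cases}\frac{|\Gamma(\lambda)|\Gamma(1+\lambda)\Gamma(1-2\lambda)}{\Gamma(1-\lambda)}(1-\rho^{-2})^{2\lambda-1},&-\tfrac12<\lambda<0,\\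 \frac1\lambda(1-\rho^{-2})^{\lambda-1},&0<\lambda\le1,\\ \Gamma(\lambda)(1+\rho^{-2})^{\lambda-1},&\lambda>1,\end{cases}$$ $$\mathcal K_c=c\,\frac{D_\lambda(\rho)}{\ln\rho}\cdot\begin{cases}1/\Gamma(2\lambda),&0<\lambda\le\tfrac12,\\2\lambda,&\lambda>\tfrac12.\end{cases}$$ **Theorem.** (i) There is an absolute constant $c>0$ such that for all $\lambda>0$, $\rho>1$, $f\in\mathcal A_\rho$ and all integers $n\ge1$ with $n\ge\lfloor\lambda/\ln\rho\rfloor$, $$\|f-S_n^\lambda f\|_\infty\le\mathcal K_c\,\frac{n^\lambda}{\rho^n}.$$ Moreover $c$ is asymptotically $1$: for all $\lambda>0$ and $\varepsilon>0$ there is $X=X(\lambda,\varepsilon)$ such that the bound holds with $c=1+\varepsilon$ for all $\rho>1$, $f\in\mathcal A_\rho$ and $n\ge\max(1,\lfloor\lambda/\ln\rho\rfloor)$ with $n\ln\rho\ge X$. (ii) Let $-1/2<\lambda<0$. There is a constant $C_\lambda>0$ with $|C_k^\lambda(x)|\le C_\lambda k^{\lambda-1}$ for all $|x|\le1$ and $k\ge1$.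 Whenever a constant $C_\lambda$ satisfies this inequality for all $|x|\le 1$ and all integers $k\ge \max(N,1)$, then for all $\rho>1$, $f\in\mathcal A_\rho$ and all integers $n\ge0$ with $n+1\ge N$, $$\|f-S_n^\lambda f\|_\infty\le\frac{D_\lambda(\rho)\,C_\lambda}{(\rho-1)\rho^n}.$$ (Optimality) Up to constant factors neither bound can be improved by a negative power of $n$. (a) For every $\lambda>0$ and $\rho>1$ there is $f\in\mathcal A_\rho$ such that for every $\gamma>0$ and every $c\in\mathbb R$, $\|f-S_n^\lambda f\|_\infty>c\,n^{\lambda-\gamma}\rho^{-n}$ for infinitely many $n$. For every $-1/2<\lambda<0$ and $\rho>1$ there is $f\in\mathcal A_\rho$ such that for every $\gamma>0$ and every $c\in\mathbb R$, $\|f-S_n^\lambda f\|_\infty>c\,n^{-\gamma}\rho^{-n}$ for infinitely many $n$. (b) Let $\omega>1$, $f(x)=1/(x-\omega)$ and $\rho_\omega=\omega+\sqrt{\omega^2-1}$ (so that $f$ is analytic inside $\mathcal E_{\rho_\omega}$, with a pole on $\mathcal E_{\rho_\omega}$). If $\lambda>0$, there is $c>0$ such that $|f(1)-S_n^\lambda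 f(1)|\ge c\,n^\lambda\rho_\omega^{-n}$ for all $n\ge1$. If $-1/2<\lambda<0$, there is $c>0$ such that $\|f-S_n^\lambda f\|_\infty\ge c\,\rho_\omega^{-n}$ for all $n\ge0$. -/

import Mathlib

open Set Filter Topology

noncomputable section

namespace Gegenbauer

/-! ### Gegenbauer polynomials and Gegenbauer projections -/

/-- The Gegenbauer polynomial of degree `n` with parameter `l`, as a function on `ℝ`:
`(2l)_n / n! * ₂F₁(-n, n + 2l; l + 1/2; (1 - x)/2)`. -/
def poly (l : ℝ) (n : ℕ) (x : ℝ) : ℝ :=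
  (ascPochhammer ℝ n).eval (2 * l) / (n.factorial : ℝ) *
    ordinaryHypergeometric (-(n : ℝ)) ((n : ℝ) + 2 * l) (l + 1 / 2) ((1 - x) / 2)

/-- The weight `(1 - x²)^(l - 1/2)`. -/
def weight (l : ℝ) (x : ℝ) : ℝ := (1 - x ^ 2) ^ (l - 1 / 2)

/-- The `k`-th Gegenbauer coefficient of `g`, that is, the inner product of `g` with the `k`-th
Gegenbauer polynomial in the weighted space on `[-1, 1]`, divided by the squared norm of the
`k`-th Gegenbauer polynomial. -/
def coeff (l : ℝ) (g : ℝ → ℂ) (k : ℕ) : ℂ :=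
  (∫ x in (-1 : ℝ)..1, ((weight l x * poly l k x : ℝ) : ℂ) * g x) /
    ((∫ x in (-1 : ℝ)..1, weight l x * poly l k x ^ 2 : ℝ) : ℂ)

/-- The Gegenbauer projection of degree `n` of `g`. -/
def proj (l : ℝ) (n : ℕ) (g : ℝ → ℂ) (x : ℝ) : ℂ :=
  ∑ k ∈ Finset.range (n + 1), coeff l g k * ((poly l k x : ℝ) : ℂ)

/-- The error at `x` of the Gegenbauer projection of degree `n` of the restriction of `f` to the
real line. -/
def err (l : ℝ) (n : ℕ) (f : ℂ → ℂ) (x : ℝ) : ℂ :=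
  f (x : ℂ) - proj l n (fun t : ℝ => f (t : ℂ)) x

/-- The maximum norm on `[-1, 1]`. -/
def supNorm (g : ℝ → ℂ) : ℝ := sSup ((fun x => ‖g x‖) '' Icc (-1 : ℝ) 1)

/-- The Gegenbauer polynomials with parameter `l` of all degrees `k ≥ N`, `k ≥ 1`, are bounded
by `C * k^(l-1)` on `[-1, 1]`. -/
def UniformBound (l C : ℝ) (N : ℕ) : Prop :=
  ∀ k : ℕ, 1 ≤ k → N ≤ k → ∀ x ∈ Icc (-1 : ℝ) 1, |poly l k x| ≤ C * (k : ℝ) ^ (l - 1)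

/-! ### Bernstein ellipses -/

/-- The Joukowski map. -/
def joukowski (u : ℂ) : ℂ := (u + u⁻¹) / 2

/-- The Bernstein ellipse with parameter `ρ` (the curve). -/
def ellipse (ρ : ℝ) : Set ℂ := {z | ∃ u : ℂ, ‖u‖ = ρ ∧ z = joukowski u}

/-- The open region bounded by the Bernstein ellipse with parameter `ρ`: the ellipse has foci
`1` and `-1` and its major axis has length `ρ + ρ⁻¹`. -/
def region (ρ : ℝ) : Set ℂ := {z | ‖z - 1‖ + ‖z + 1‖ < ρ + ρ⁻¹}

/-- The length of the Bernstein ellipse, as the arc length of `θ ↦ joukowski (ρ e^{iθ})`,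
`0 ≤ θ ≤ 2π`. -/
def ellipseLength (ρ : ℝ) : ℝ :=
  ∫ θ in (0 : ℝ)..(2 * Real.pi), ‖deriv (fun t : ℝ => joukowski (circleMap 0 ρ t)) θ‖

/-- The maximum of `|f|` on the Bernstein ellipse. -/
def maxOn (f : ℂ → ℂ) (ρ : ℝ) : ℝ := sSup ((fun z => ‖f z‖) '' ellipse ρ)

/-- The quantity `D_l(ρ)` (it depends on `f` through the maximum of `|f|` on the ellipse). -/
def D (l ρ : ℝ) (f : ℂ → ℂ) : ℝ :=
  maxOn f ρ * ellipseLength ρ / (Real.pi * ρ) *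
    (if l < 0 then
      |Real.Gamma l| * Real.Gamma (1 + l) * Real.Gamma (1 - 2 * l) / Real.Gamma (1 - l) *
        (1 - 1 / ρ ^ 2) ^ (2 * l - 1)
    else if l ≤ 1 then 1 / l * (1 - 1 / ρ ^ 2) ^ (l - 1)
    else Real.Gamma l * (1 + 1 / ρ ^ 2) ^ (l - 1))

/-- The quantity `K` with generic constant `c`. -/
def K (c l ρ : ℝ) (f : ℂ → ℂ) : ℝ :=
  c * (D l ρ f / Real.log ρ) * (if l ≤ 1 / 2 then 1 / Real.Gamma (2 * l) else 2 * l)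

/-- Consistency of `ellipse` and `region`: the ellipse is the locus where the sum of the
distances to the two foci is `ρ + ρ⁻¹`. -/
theorem ellipse_eq {ρ : ℝ} (hρ : 1 < ρ) :
    ellipse ρ = {z | ‖z - 1‖ + ‖z + 1‖ = ρ + ρ⁻¹} := by
  have key : ∀ u : ℂ, u ≠ 0 → ‖joukowski u - 1‖ + ‖joukowski u + 1‖ = ‖u‖ + ‖u‖⁻¹ := by
    intro u hu
    have hn : ‖u‖ ≠ 0 := norm_ne_zero_iff.mpr hu
    have e1 : joukowski u - 1 = (u - 1) ^ 2 / (2 * u) := by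
      unfold joukowski; field_simp; ring
    have e2 : joukowski u + 1 = (u + 1) ^ 2 / (2 * u) := by
      unfold joukowski; field_simp; ring
    have h := parallelogram_law_with_norm ℝ u 1
    simp only [norm_one] at h
    rw [e1, e2]
    simp only [norm_div, norm_pow, norm_mul, Complex.norm_ofNat]
    field_simp
    nlinarith [h]
  have hρ0 : (0 : ℝ) < ρ := by linarith
  ext z
  constructor
  · rintro ⟨u, hu, rfl⟩
    have hu0 : u ≠ 0 := by rw [← norm_pos_iff, hu]; exact hρ0
    have := key u hu0
    rw [hu] at this
    exact this
  · intro hz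
    obtain ⟨s, hs⟩ := IsSquare.exists_sq (z ^ 2 - 1) (IsAlgClosed.exists_pow_nat_eq (z ^ 2 - 1)
      (n := 2) (by norm_num) |>.elim fun s h => ⟨s, by rw [← h, sq]⟩)
    have hmul : (z + s) * (z - s) = 1 := by linear_combination hs
    have hu0 : z + s ≠ 0 := left_ne_zero_of_mul_eq_one hmul
    have hv0 : z - s ≠ 0 := right_ne_zero_of_mul_eq_one hmul
    have hinv : (z + s)⁻¹ = z - s := inv_eq_of_mul_eq_one_right hmul
    have hinv' : (z - s)⁻¹ = z + s := by rw [← hinv, inv_inv]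
    have hJ : joukowski (z + s) = z := by unfold joukowski; rw [hinv]; ring
    have hJ' : joukowski (z - s) = z := by unfold joukowski; rw [hinv']; ring
    have hk := key _ hu0
    rw [hJ, show ‖z - 1‖ + ‖z + 1‖ = ρ + ρ⁻¹ from hz] at hk
    have hn : 0 < ‖z + s‖ := norm_pos_iff.mpr hu0
    have hfac : (‖z + s‖ - ρ) * (‖z + s‖ * ρ - 1) = 0 := by
      field_simp at hk
      linear_combination -hk
    rcases mul_eq_zero.mp hfac with h | h
    · exact ⟨z + s, by linarith, hJ.symm⟩
    · refine ⟨z - s, ?_, hJ'.symm⟩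
      rw [← hinv, norm_inv]
      have h1 : ‖z + s‖ * ρ = 1 := by linarith
      exact inv_eq_of_mul_eq_one_right h1

end Gegenbauer

end

noncomputable section

/-! ### Gegenbauer polynomials in powers of (1 - x)/2: recurrence and differential equation -/

namespace Gegenbauer

/-! Write C_k for the Gegenbauer polynomials, U_m for the Chebyshev polynomials of the second kind,
and u = ρ e^{iθ} for the parameter of the ellipse z = (u + 1/u)/2. The Fourier series of θ ↦ f(cos
θ), together with Cauchy's theorem on the annulus 1 < |u| < ρ, gives f = ∑ β_m U_m on [-1, 1], where
β_m is the mean over θ of f(z) (1 - u⁻²) u⁻ᵐ (`hasSum_ucoef_U`, `ucoef_eq`). Each U_m is an explicit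
finite combination of the C_k with m = k + 2j (`U_eq_sum_econn`). The resulting double series
converges absolutely, so it may be regrouped by k, and orthogonality identifies the k-th Gegenbauer
coefficient as a_k = ∑_j β_{k+2j} `conn l k j` (`hasSum_pairs`, `coeff_eq_acoef`). Hence the error
of the projection is the tail of ∑ a_k C_k (`hasSum_err`).

Summing over j under the integral turns the connection coefficients into k!/(l)_k times ₂F₁(k+1,
1-l; k+l+1; u⁻²). Since |1 - u⁻²| is, up to the factor ρ/2, the arc length density of the ellipse,
|a_k| is at most M L/(πρ) · |k!/(l)_k| · sup |₂F₁| · ρ⁻ᵏ (`norm_acoef_le`). The cases of D come from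
different bounds of ₂F₁: a positive majorant series for l < 0 and for 0 < l ≤ 1, Euler's integral
for l > 1. The Gamma factors come from the monotonicity in n of (a)_n/n! · n^{1-a}, which starts at
a for n = 1 and tends to 1/Γ(a).

Upper bounds: for l > 0, |C_k| ≤ C_k(1) = (2l)_k/k!, so the tail is controlled by ∑ k^l ρ⁻ᵏ, which
is compared with a geometric series. For l < 0 the powers of k in the bounds of a_k and C_k cancel
and the tail is exactly geometric.

Lower bounds: for 1/(x - ω) the β_m are exactly geometric, so a_k is a multiple of one real value of
₂F₁. For l > 0 all terms of the tail have one sign at x = 1; for l < 0 the tail at x = 0 is an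
alternating series with decreasing terms. For optimality inside the class, f is a lacunary series in
U_m with coefficients qⁱ ρ^{-d_i}, where the degrees d_i grow so fast that qⁱ is negligible against
every positive power of d_i. One term a_d C_d is a difference of two consecutive errors, so one of
the two must be large. -/

open Polynomial in
/-- The rising factorial `(a)_n`. -/
def rising (a : ℝ) (n : ℕ) : ℝ := (ascPochhammer ℝ n).eval a

@[simp] theorem rising_zero (a : ℝ) : rising a 0 = 1 := by simp [rising]

theorem rising_succ (a : ℝ) (n : ℕ) : rising a (n + 1) = rising a n * (a + n) := by
  simp [rising, ascPochhammer_succ_eval]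

theorem rising_succ_left (a : ℝ) (n : ℕ) : rising a (n + 1) = a * rising (a + 1) n := by
  induction n with
  | zero => simp [rising_succ]
  | succ n ih =>
    rw [rising_succ, ih, rising_succ (a + 1) n]; push_cast; ring

theorem rising_pos {a : ℝ} (ha : 0 < a) (n : ℕ) : 0 < rising a n := ascPochhammer_pos n a ha

theorem rising_ne_zero {a : ℝ} (ha : -1 < a) (h0 : a ≠ 0) (n : ℕ) : rising a n ≠ 0 := by
  cases n with
  | zero => simp
  | succ n =>
    rw [rising_succ_left]
    exact mul_ne_zero h0 (rising_pos (by linarith) n).ne'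

theorem rising_neg_eq_zero {n i : ℕ} (h : n < i) : rising (-(n : ℝ)) i = 0 := by
  induction i, h using Nat.le_induction with
  | base => rw [rising_succ]; simp
  | succ i _ ih => rw [rising_succ, ih, zero_mul]

/-- The coefficient of `((1 - x) / 2) ^ i` in the Gegenbauer polynomial of degree `n`. -/
def pcoef (l : ℝ) (n i : ℕ) : ℝ :=
  rising (2 * l) n / n.factorial *
    ((i.factorial : ℝ)⁻¹ * rising (-(n : ℝ)) i * rising (n + 2 * l) i * (rising (l + 1 / 2) i)⁻¹)

theorem pcoef_eq_zero (l : ℝ) {n i : ℕ} (h : n < i) : pcoef l n i = 0 := by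
  simp [pcoef, rising_neg_eq_zero h]

theorem pcoef_zero (l : ℝ) (n : ℕ) : pcoef l n 0 = rising (2 * l) n / n.factorial := by
  simp [pcoef]

/-- The ratio of consecutive hypergeometric coefficients. Like `pcoef_succ_succ` and
`pcoef_succ_left`, it is stated multiplied out, so it needs no case distinction where coefficients
vanish (i > n). -/
theorem pcoef_step {l : ℝ} (hl : -1 / 2 < l) (n i : ℕ) :
    pcoef l n (i + 1) * ((i + 1) * (l + 1 / 2 + i)) =
      pcoef l n i * ((i - n) * (n + 2 * l + i)) := by
  have h1 : l + 1 / 2 + (i : ℝ) ≠ 0 := by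
    have : (0 : ℝ) ≤ i := Nat.cast_nonneg i
    linarith
  have h2 : rising (l + 1 / 2) i ≠ 0 := (rising_pos (by linarith) i).ne'
  have h3 : (i.factorial : ℝ) ≠ 0 := by positivity
  have h4 : ((n.factorial : ℕ) : ℝ) ≠ 0 := by positivity
  simp only [pcoef, rising_succ, Nat.factorial_succ]
  generalize l + 1 / 2 = c at h1 h2 ⊢
  push_cast
  field_simp
  ring

theorem pcoef_succ_succ {l : ℝ} (hl : -1 / 2 < l) (n i : ℕ) :
    pcoef l (n + 1) (i + 1) * ((i + 1) * (l + 1 / 2 + i)) =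
      -(pcoef l n i * ((n + 2 * l + i) * (n + 2 * l + i + 1))) := by
  have h1 : l + 1 / 2 + (i : ℝ) ≠ 0 := by
    have : (0 : ℝ) ≤ i := Nat.cast_nonneg i
    linarith
  have h2 : rising (l + 1 / 2) i ≠ 0 := (rising_pos (by linarith) i).ne'
  have h3 : (i.factorial : ℝ) ≠ 0 := by positivity
  have h4 : ((n.factorial : ℕ) : ℝ) ≠ 0 := by positivity
  have e1 : rising (-((n + 1 : ℕ) : ℝ)) (i + 1) = -((n : ℝ) + 1) * rising (-(n : ℝ)) i := by
    rw [rising_succ_left]; push_cast; congr 2; ring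
  have e2 : (2 * l + n) * rising ((n + 1 : ℕ) + 2 * l) (i + 1) =
      rising (n + 2 * l) i * ((n + 2 * l + i) * (n + 2 * l + i + 1)) := by
    have : rising (n + 2 * l) (i + 2) = (n + 2 * l) * rising ((n + 1 : ℕ) + 2 * l) (i + 1) := by
      rw [rising_succ_left]; push_cast; congr 2; ring
    rw [add_comm (2 * l), ← this, rising_succ, rising_succ]; push_cast; ring
  have e3 : rising (2 * l) (n + 1) * rising ((n + 1 : ℕ) + 2 * l) (i + 1) =
      rising (2 * l) n * (rising (n + 2 * l) i * ((n + 2 * l + i) * (n + 2 * l + i + 1))) := by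
    rw [rising_succ, mul_assoc, e2]
  simp only [pcoef]
  rw [e1, rising_succ (l + 1 / 2)]
  calc _ = rising (2 * l) (n + 1) * rising ((n + 1 : ℕ) + 2 * l) (i + 1) *
        (-((n : ℝ) + 1) * rising (-(n : ℝ)) i * ((i + 1) * (l + 1 / 2 + i)) /
          ((n + 1).factorial * (i + 1).factorial * (rising (l + 1 / 2) i * (l + 1 / 2 + i)))) := by
        field_simp
    _ = _ := by
        rw [e3, Nat.factorial_succ, Nat.factorial_succ]
        generalize l + 1 / 2 = c at h1 h2 ⊢
        push_cast
        field_simp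

theorem pcoef_succ_left {l : ℝ} (n i : ℕ) :
    pcoef l (n + 1) i * (n + 1 - i) = pcoef l n i * (n + 2 * l + i) := by
  have h4 : ((n.factorial : ℕ) : ℝ) ≠ 0 := by positivity
  have e1 : rising (-((n + 1 : ℕ) : ℝ)) i * (n + 1 - i) = ((n : ℝ) + 1) * rising (-(n : ℝ)) i := by
    have h := rising_succ_left (-((n + 1 : ℕ) : ℝ)) i
    rw [rising_succ, show -((n + 1 : ℕ) : ℝ) + 1 = -(n : ℝ) by push_cast; ring] at h
    push_cast at h ⊢
    linarith
  have e2 : rising (2 * l) (n + 1) * rising ((n + 1 : ℕ) + 2 * l) i =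
      rising (2 * l) n * (rising (n + 2 * l) i * (n + 2 * l + i)) := by
    rw [rising_succ, mul_assoc, ← rising_succ, rising_succ_left]
    push_cast
    rw [show (n : ℝ) + 1 + 2 * l = n + 2 * l + 1 by ring]
    ring
  simp only [pcoef]
  calc _ = (rising (2 * l) (n + 1) * rising ((n + 1 : ℕ) + 2 * l) i) *
        (rising (-((n + 1 : ℕ) : ℝ)) i * (n + 1 - i)) / (n + 1).factorial *
          ((i.factorial : ℝ)⁻¹ * (rising (l + 1 / 2) i)⁻¹) := by ring
    _ = _ := by
        rw [e1, e2, Nat.factorial_succ]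
        push_cast
        field_simp

open Polynomial in
/-- The Gegenbauer polynomial of degree `n` as a polynomial in `(1 - x) / 2`. -/
def ypoly (l : ℝ) (n : ℕ) : ℝ[X] := ∑ i ∈ Finset.range (n + 1), monomial i (pcoef l n i)

theorem coeff_ypoly (l : ℝ) (n i : ℕ) : (ypoly l n).coeff i = pcoef l n i := by
  simp only [ypoly, Polynomial.finsetSum_coeff, Polynomial.coeff_monomial]
  rw [Finset.sum_ite_eq' (Finset.range (n + 1)) i]
  split_ifs with h
  · rfl
  · rw [pcoef_eq_zero]; simpa using h

theorem poly_eq_eval (l : ℝ) (n : ℕ) (x : ℝ) : poly l n x = (ypoly l n).eval ((1 - x) / 2) := by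
  have h0 : ∀ i ∉ Finset.range (n + 1), ((i.factorial : ℝ)⁻¹ *
      (ascPochhammer ℝ i).eval (-(n : ℝ)) * (ascPochhammer ℝ i).eval (n + 2 * l) *
        ((ascPochhammer ℝ i).eval (l + 1 / 2))⁻¹) • ((1 - x) / 2) ^ i = 0 := by
    intro i hi
    have := rising_neg_eq_zero (n := n) (i := i) (by simpa using hi)
    rw [rising] at this
    simp [this]
  rw [poly, ordinaryHypergeometric_eq_tsum]
  simp only
  rw [tsum_eq_sum h0, ypoly, Polynomial.eval_finsetSum, Finset.mul_sum]
  refine Finset.sum_congr rfl fun i _ => ?_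
  rw [Polynomial.eval_monomial, pcoef, smul_eq_mul]
  simp only [rising]
  ring

theorem continuous_poly (l : ℝ) (n : ℕ) : Continuous (poly l n) := by
  have : poly l n = fun x => (ypoly l n).eval ((1 - x) / 2) := funext (poly_eq_eval l n)
  rw [this]
  exact (ypoly l n).continuous.comp (by fun_prop)

open Polynomial in
theorem ypoly_recurrence {l : ℝ} (hl : -1 / 2 < l) (n : ℕ) :
    C ((n : ℝ) + 2) * ypoly l (n + 2) =
      C (2 * (n + 1 + l)) * (ypoly l (n + 1) - C 2 * (X * ypoly l (n + 1))) -
        C (n + 2 * l) * ypoly l n := by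
  ext i
  simp only [coeff_C_mul, coeff_sub]
  cases i with
  | zero =>
    simp only [mul_coeff_zero, coeff_X_zero, zero_mul, coeff_ypoly, pcoef_zero, rising_succ,
      Nat.factorial_succ]
    have h4 : ((n.factorial : ℕ) : ℝ) ≠ 0 := by positivity
    push_cast
    field_simp
    ring
  | succ i =>
    simp only [coeff_X_mul, coeff_ypoly]
    have hi : (0 : ℝ) ≤ i := Nat.cast_nonneg i
    have h1 : ((i : ℝ) + 1) * (l + 1 / 2 + i) ≠ 0 := by
      have : 0 < l + 1 / 2 + (i : ℝ) := by linarith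
      positivity
    have r1 := pcoef_succ_succ hl (n + 1) i
    have r2 := pcoef_step hl (n + 1) i
    have r3 := pcoef_step hl n i
    have r4 := pcoef_succ_left (l := l) n i
    -- The relations r1, r2, r3 lower the index i + 1 to i, leaving only the coefficients of degrees
    -- n and n + 1 at i, which r4 links.
    push_cast at r1 r2
    apply mul_right_cancel₀ h1
    linear_combination (n + 2) * r1 - 2 * (n + 1 + l) * r2 + (n + 2 * l) * r3
      - (n + 2 * l) * (i - n) * r4

theorem poly_recurrence {l : ℝ} (hl : -1 / 2 < l) (n : ℕ) (x : ℝ) :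
    (n + 2) * poly l (n + 2) x =
      2 * (n + 1 + l) * x * poly l (n + 1) x - (n + 2 * l) * poly l n x := by
  have h := congrArg (Polynomial.eval ((1 - x) / 2)) (ypoly_recurrence hl n)
  simp only [Polynomial.eval_mul, Polynomial.eval_sub, Polynomial.eval_C, Polynomial.eval_X] at h
  simp only [poly_eq_eval]
  linear_combination h

theorem poly_zero (l x : ℝ) : poly l 0 x = 1 := by
  simp [poly_eq_eval, ypoly, pcoef]

theorem poly_one {l : ℝ} (hl : -1 / 2 < l) (x : ℝ) : poly l 1 x = 2 * l * x := by
  have h : l + 1 / 2 ≠ 0 := by linarith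
  have e : -(2 * l) + -1 = -2 * (l + 1 / 2) := by ring
  simp [poly_eq_eval, ypoly, pcoef, Finset.sum_range_succ, rising_succ, -one_div]
  rw [e, mul_inv_cancel_right₀ h]
  ring

theorem poly_at_one (l : ℝ) (n : ℕ) : poly l n 1 = rising (2 * l) n / n.factorial := by
  rw [poly_eq_eval, sub_self, zero_div, ← Polynomial.coeff_zero_eq_eval_zero, coeff_ypoly,
    pcoef_zero]

open Polynomial in
-- Gauss's hypergeometric equation in the variable (1 - x)/2; coefficientwise it is `pcoef_step`.
theorem ypoly_ode {l : ℝ} (hl : -1 / 2 < l) (n : ℕ) :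
    X * (1 - X) * derivative (derivative (ypoly l n)) +
      (C (l + 1 / 2) - C (2 * l + 1) * X) * derivative (ypoly l n) +
        C (n * (n + 2 * l)) * ypoly l n = 0 := by
  have e : X * (1 - X) * derivative (derivative (ypoly l n)) +
      (C (l + 1 / 2) - C (2 * l + 1) * X) * derivative (ypoly l n) +
        C (n * (n + 2 * l)) * ypoly l n =
      X * derivative (derivative (ypoly l n)) - X * (X * derivative (derivative (ypoly l n)))
        + C (l + 1 / 2) * derivative (ypoly l n) - C (2 * l + 1) * (X * derivative (ypoly l n)) +
        C (n * (n + 2 * l)) * ypoly l n := by ring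
  rw [e]
  ext i
  have r0 := pcoef_step hl n i
  rcases i with _ | _ | i
  · simp [coeff_derivative, coeff_ypoly, -map_add, -map_mul] at r0 ⊢
    linear_combination r0
  · simp only [coeff_add, coeff_sub, coeff_C_mul, coeff_X_mul, coeff_derivative, coeff_ypoly,
      coeff_zero, mul_coeff_zero, coeff_X_zero]
    push_cast at r0 ⊢
    linear_combination r0
  · simp only [coeff_add, coeff_sub, coeff_C_mul, coeff_X_mul, coeff_derivative, coeff_ypoly,
      coeff_zero]
    push_cast at r0 ⊢
    linear_combination r0

end Gegenbauer

namespace Gegenbauer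

/-! ### Orthogonality -/

/-- The exponent l - 1/2 exceeds -1. Splitting at 0 leaves one singular factor (1 ± x)^(l - 1/2) on
each half, the other being continuous there. -/
theorem intervalIntegrable_weight {l : ℝ} (hl : -1 / 2 < l) :
    IntervalIntegrable (weight l) MeasureTheory.volume (-1) 1 := by
  have key : ∀ x ∈ Icc (-1 : ℝ) 1, weight l x = (1 - x) ^ (l - 1 / 2) * (1 + x) ^ (l - 1 / 2) := by
    intro x hx
    rw [weight, ← Real.mul_rpow (by linarith [hx.2]) (by linarith [hx.1])]
    congr 1; ring
  have hx1 : ∀ a b : ℝ, IntervalIntegrable (fun x : ℝ => (1 - x) ^ (l - 1 / 2))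
      MeasureTheory.volume a b := by
    intro a b
    have := (intervalIntegral.intervalIntegrable_rpow' (a := 1 - a) (b := 1 - b)
      (r := l - 1 / 2) (by linarith)).comp_sub_left 1
    simpa using this
  have hx2 : ∀ a b : ℝ, IntervalIntegrable (fun x : ℝ => (1 + x) ^ (l - 1 / 2))
      MeasureTheory.volume a b := by
    intro a b
    have := (intervalIntegral.intervalIntegrable_rpow' (a := 1 + a) (b := 1 + b)
      (r := l - 1 / 2) (by linarith)).comp_add_left 1
    simpa using this
  refine IntervalIntegrable.trans (b := 0) ?_ ?_
  · have h := (hx2 (-1) 0).continuousOn_mul (f := fun x : ℝ => (1 + x) ^ (l - 1 / 2))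
      (g := fun x : ℝ => (1 - x) ^ (l - 1 / 2)) (by
        rw [uIcc_of_le (by norm_num)]
        intro x hx
        exact ((continuous_const.sub continuous_id).continuousAt.rpow_const
          (Or.inl (by simp; linarith [hx.2]))).continuousWithinAt)
    refine h.congr fun x hx => ?_
    rw [uIoc_of_le (by norm_num)] at hx
    exact (key x ⟨hx.1.le, by linarith [hx.2]⟩).symm
  · have h := (hx1 0 1).mul_continuousOn (f := fun x : ℝ => (1 - x) ^ (l - 1 / 2))
      (g := fun x : ℝ => (1 + x) ^ (l - 1 / 2)) (by
        rw [uIcc_of_le (by norm_num)]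
        intro x hx
        exact ((continuous_const.add continuous_id).continuousAt.rpow_const
          (Or.inl (by simp; linarith [hx.1]))).continuousWithinAt)
    refine h.congr fun x hx => ?_
    rw [uIoc_of_le (by norm_num)] at hx
    exact (key x ⟨by linarith [hx.1], hx.2⟩).symm

/-- The Sturm–Liouville flux `(1 - x²)^(l + 1/2) * C_n'(x)`. -/
theorem hasDerivAt_flux {l : ℝ} (hl : -1 / 2 < l) (n : ℕ) {x : ℝ} (hx : x ∈ Ioo (-1 : ℝ) 1) :
    HasDerivAt (fun x => (1 - x ^ 2) ^ (l + 1 / 2) *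
      (-(1 / 2) * (ypoly l n).derivative.eval ((1 - x) / 2)))
      (-(n * (n + 2 * l)) * (weight l x * poly l n x)) x := by
  have hpos : 0 < 1 - x ^ 2 := by nlinarith [hx.1, hx.2]
  have hy : HasDerivAt (fun x : ℝ => (1 - x) / 2) (-1 / 2) x := by
    simpa using ((hasDerivAt_id x).const_sub 1).div_const 2
  have hq : HasDerivAt (fun x : ℝ => 1 - x ^ 2) (-(2 * x)) x := by
    simpa using (hasDerivAt_pow 2 x).const_sub 1
  have h1 := hq.rpow_const (p := l + 1 / 2) (Or.inl hpos.ne')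
  have h2 := (((ypoly l n).derivative.hasDerivAt ((1 - x) / 2)).comp x hy).const_mul (-(1 / 2 : ℝ))
  have h3 := h1.mul h2
  refine h3.congr_deriv ?_
  have ode := congrArg (Polynomial.eval ((1 - x) / 2)) (ypoly_ode hl n)
  simp only [Polynomial.eval_add, Polynomial.eval_mul, Polynomial.eval_sub, Polynomial.eval_C,
    Polynomial.eval_X, Polynomial.eval_one, Polynomial.eval_zero] at ode
  have e : (1 - x ^ 2) ^ (l + 1 / 2) = (1 - x ^ 2) ^ (l - 1 / 2) * (1 - x ^ 2) := by
    rw [← Real.rpow_add_one hpos.ne']; congr 1; ring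
  rw [weight, poly_eq_eval, show l + 1 / 2 - 1 = l - 1 / 2 by ring, e]
  simp only [Function.comp]
  linear_combination (1 - x ^ 2) ^ (l - 1 / 2) * ode

theorem hasDerivAt_poly (l : ℝ) (n : ℕ) (x : ℝ) :
    HasDerivAt (poly l n) (-(1 / 2) * (ypoly l n).derivative.eval ((1 - x) / 2)) x := by
  have hy : HasDerivAt (fun x : ℝ => (1 - x) / 2) (-1 / 2) x := by
    simpa using ((hasDerivAt_id x).const_sub 1).div_const 2
  have : poly l n = fun x => (ypoly l n).eval ((1 - x) / 2) := funext (poly_eq_eval l n)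
  rw [this]
  have h := ((ypoly l n).hasDerivAt ((1 - x) / 2)).comp x hy
  exact h.congr_deriv (by ring)

/-- Lagrange's identity: the weighted Wronskian G has the integrand times the difference of the
eigenvalues as derivative, and it vanishes at ±1 because l + 1/2 > 0. The eigenvalues differ by (m -
n)(m + n + 2l), where m + n ≥ 1 and 2l > -1. -/
theorem integral_weight_poly_mul_poly {l : ℝ} (hl : -1 / 2 < l) {n m : ℕ} (h : n ≠ m) :
    ∫ x in (-1 : ℝ)..1, weight l x * poly l n x * poly l m x = 0 := by
  set Q : ℕ → ℝ → ℝ := fun n x => -(1 / 2) * (ypoly l n).derivative.eval ((1 - x) / 2)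
  have hQ : ∀ n, Continuous (Q n) := fun n =>
    continuous_const.mul ((ypoly l n).derivative.continuous.comp (by fun_prop))
  set G : ℝ → ℝ := fun x => (1 - x ^ 2) ^ (l + 1 / 2) * (Q n x) * poly l m x -
    (1 - x ^ 2) ^ (l + 1 / 2) * Q m x * poly l n x
  have hr : Continuous fun x : ℝ => (1 - x ^ 2) ^ (l + 1 / 2) :=
    (by fun_prop : Continuous fun x : ℝ => 1 - x ^ 2).rpow_const fun x => Or.inr (by linarith)
  have hGc : Continuous G := ((hr.mul (hQ n)).mul (continuous_poly l m)).sub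
    ((hr.mul (hQ m)).mul (continuous_poly l n))
  have hd : ∀ x ∈ Ioo (-1 : ℝ) 1, HasDerivAt G
      ((m * (m + 2 * l) - n * (n + 2 * l)) * (weight l x * poly l n x * poly l m x)) x := by
    intro x hx
    have h1 := (hasDerivAt_flux hl n hx).mul (hasDerivAt_poly l m x)
    have h2 := (hasDerivAt_flux hl m hx).mul (hasDerivAt_poly l n x)
    exact (h1.sub h2).congr_deriv (by ring)
  have hint : IntervalIntegrable
      (fun x => (m * (m + 2 * l) - n * (n + 2 * l)) * (weight l x * poly l n x * poly l m x))
      MeasureTheory.volume (-1) 1 :=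
    (((intervalIntegrable_weight hl).mul_continuousOn (continuous_poly l n).continuousOn).mul_continuousOn
      (continuous_poly l m).continuousOn).const_mul _
  have hI := intervalIntegral.integral_eq_sub_of_hasDerivAt_of_le (by norm_num) hGc.continuousOn
    hd hint
  have hz : (0 : ℝ) ^ (l + 1 / 2) = 0 := Real.zero_rpow (by linarith)
  have hG : G 1 - G (-1) = 0 := by simp [G, -one_div, hz]
  rw [hG, intervalIntegral.integral_const_mul] at hI
  refine (mul_eq_zero.mp hI).resolve_left ?_
  have e : (m * (m + 2 * l) - n * (n + 2 * l) : ℝ) = (m - n) * (m + n + 2 * l) := by ring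
  rw [e]
  refine mul_ne_zero (sub_ne_zero.mpr fun h' => h (by exact_mod_cast h'.symm)) ?_
  have : (1 : ℝ) ≤ m + n := by
    have : 1 ≤ m + n := by omega
    exact_mod_cast this
  have : 0 < (m + n + 2 * l : ℝ) := by linarith
  exact this.ne'

theorem integral_weight_poly_sq_pos {l : ℝ} (hl : -1 / 2 < l) (hl0 : l ≠ 0) (n : ℕ) :
    0 < ∫ x in (-1 : ℝ)..1, weight l x * poly l n x ^ 2 := by
  have hint : IntervalIntegrable (fun x => weight l x * poly l n x ^ 2)
      MeasureTheory.volume (-1) 1 :=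
    (intervalIntegrable_weight hl).mul_continuousOn ((continuous_poly l n).pow 2).continuousOn
  have hw : ∀ x ∈ Ioo (-1 : ℝ) 1, 0 < weight l x := fun x hx =>
    Real.rpow_pos_of_pos (by nlinarith [hx.1, hx.2]) _
  -- Here l ≠ 0 enters: C_n(1) = (2l)_n/n! is nonzero, so the integrand is positive on an interval
  -- to the left of 1.
  have h1 : poly l n 1 ≠ 0 := by
    rw [poly_at_one]
    exact div_ne_zero (rising_ne_zero (by linarith) (by simpa using hl0) n) (by positivity)
  have hev : ∀ᶠ x in 𝓝 (1 : ℝ), poly l n x ≠ 0 :=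
    (continuous_poly l n).continuousAt.eventually_ne h1
  obtain ⟨d, hd, hd'⟩ := Metric.eventually_nhds_iff.mp hev
  rw [intervalIntegral.integral_pos_iff_support_of_nonneg_ae' ?_ hint]
  · refine ⟨by norm_num, ?_⟩
    refine lt_of_lt_of_le ?_ (MeasureTheory.measure_mono
      (s := Ioo (max (1 - d) (-1)) 1) fun x hx => ?_)
    · rw [Real.volume_Ioo]; simp; linarith
    · have hx0 : -1 < x := lt_of_le_of_lt (le_max_right _ _) hx.1
      have hx1 : 1 - d < x := lt_of_le_of_lt (le_max_left _ _) hx.1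
      refine ⟨?_, hx0, hx.2.le⟩
      have := hd' (y := x) (by rw [Real.dist_eq, abs_lt]; constructor <;> linarith [hx.2])
      exact mul_ne_zero (hw x ⟨hx0, hx.2⟩).ne' (pow_ne_zero 2 this)
  · rw [uIoc_of_le (by norm_num)]
    refine (MeasureTheory.ae_restrict_iff' measurableSet_Ioc).mpr (.of_forall fun x hx => ?_)
    refine mul_nonneg (Real.rpow_nonneg (by nlinarith [hx.1, hx.2]) _) (sq_nonneg _)

theorem coeff_poly {l : ℝ} (hl : -1 / 2 < l) (hl0 : l ≠ 0) (n k : ℕ) :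
    coeff l (fun x => ((poly l n x : ℝ) : ℂ)) k = if n = k then 1 else 0 := by
  have hh : ((∫ x in (-1 : ℝ)..1, weight l x * poly l k x ^ 2 : ℝ) : ℂ) ≠ 0 :=
    Complex.ofReal_ne_zero.mpr (integral_weight_poly_sq_pos hl hl0 k).ne'
  have e : ∫ x in (-1 : ℝ)..1, ((weight l x * poly l k x : ℝ) : ℂ) * ((poly l n x : ℝ) : ℂ) =
      ((∫ x in (-1 : ℝ)..1, weight l x * poly l k x * poly l n x : ℝ) : ℂ) := by
    rw [← intervalIntegral.integral_ofReal]
    simp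
  unfold coeff
  rw [e]
  split_ifs with h
  · subst h
    rw [div_eq_one_iff_eq hh]
    congr 2
    ext x; ring
  · rw [integral_weight_poly_mul_poly hl (Ne.symm h)]
    simp

/-- The coefficient functional is additive and continuous along uniformly summable series of
continuous functions. -/
theorem coeff_hasSum {ι : Type*} [Countable ι] {l : ℝ} (hl : -1 / 2 < l) (k : ℕ)
    {F : ι → ℝ → ℂ} {b : ι → ℝ} {g : ℝ → ℂ} (hF : ∀ i, Continuous (F i)) (hb : Summable b)
    (hFb : ∀ i, ∀ x ∈ Icc (-1 : ℝ) 1, ‖F i x‖ ≤ b i)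
    (hg : ∀ x ∈ Icc (-1 : ℝ) 1, HasSum (fun i => F i x) (g x)) :
    HasSum (fun i => coeff l (F i) k) (coeff l g k) := by
  unfold coeff
  refine HasSum.div_const ?_ _
  have hwp : IntervalIntegrable (fun x => weight l x * poly l k x) MeasureTheory.volume (-1) 1 :=
    (intervalIntegrable_weight hl).mul_continuousOn (continuous_poly l k).continuousOn
  have hm : MeasureTheory.AEStronglyMeasurable (fun x => ((weight l x * poly l k x : ℝ) : ℂ))
      (MeasureTheory.volume.restrict (uIoc (-1 : ℝ) 1)) := by
    refine Complex.continuous_ofReal.comp_aestronglyMeasurable ?_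
    exact hwp.def'.aestronglyMeasurable
  refine intervalIntegral.hasSum_integral_of_dominated_convergence
    (fun i x => |weight l x * poly l k x| * b i) (fun i => hm.mul (hF i).aestronglyMeasurable)
    (fun i => .of_forall fun x hx => ?_) (.of_forall fun x _ => hb.mul_left _) ?_
    (.of_forall fun x hx => ?_)
  · rw [uIoc_of_le (by norm_num)] at hx
    rw [norm_mul, Complex.norm_real, Real.norm_eq_abs]
    exact mul_le_mul_of_nonneg_left (hFb i x ⟨hx.1.le, hx.2⟩) (abs_nonneg _)
  · simp only [tsum_mul_left]
    exact hwp.abs.mul_const _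
  · rw [uIoc_of_le (by norm_num)] at hx
    exact (hg x ⟨hx.1.le, hx.2⟩).mul_left _

end Gegenbauer

namespace Gegenbauer

/-! ### Binomial series -/

/-- The coefficient `(a)_n / n!` of the binomial series of `(1 - w)^(-a)`. -/
def al (a : ℝ) (n : ℕ) : ℝ := rising a n / n.factorial

@[simp] theorem al_zero (a : ℝ) : al a 0 = 1 := by simp [al]

theorem al_succ (a : ℝ) (n : ℕ) : al a (n + 1) * (n + 1) = al a n * (a + n) := by
  have h4 : ((n.factorial : ℕ) : ℝ) ≠ 0 := by positivity
  simp only [al, rising_succ, Nat.factorial_succ]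
  push_cast
  field_simp

theorem al_succ' (a : ℝ) (n : ℕ) : al a (n + 1) = al a n * ((a + n) / (n + 1)) := by
  have : (n : ℝ) + 1 ≠ 0 := by positivity
  rw [← mul_div_assoc, eq_div_iff this, al_succ]

theorem al_pos {a : ℝ} (ha : 0 < a) (n : ℕ) : 0 < al a n :=
  div_pos (rising_pos ha n) (by positivity)

theorem abs_al_le (a : ℝ) (n : ℕ) : |al a n| ≤ al |a| n := by
  induction n with
  | zero => simp
  | succ n ih =>
    rw [al_succ', al_succ', abs_mul, abs_div, abs_of_pos (by positivity : (0 : ℝ) < n + 1)]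
    have : |a + n| ≤ |a| + n := (abs_add_le _ _).trans (by simp)
    gcongr
    exact (abs_nonneg _).trans ih

theorem ofReal_choose_eq_al (a : ℝ) (n : ℕ) : Ring.choose ((a : ℂ) + n - 1) n = (al a n : ℂ) := by
  have h4 : ((n.factorial : ℕ) : ℂ) ≠ 0 := by exact_mod_cast n.factorial_ne_zero
  have h := Ring.factorial_nsmul_multichoose_eq_ascPochhammer (a : ℂ) n
  rw [Polynomial.ascPochhammer_smeval_eq_eval, nsmul_eq_mul, Ring.multichoose_eq] at h
  have e : (ascPochhammer ℂ n).eval (a : ℂ) = ((rising a n : ℝ) : ℂ) := by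
    clear h h4
    induction n with
    | zero => simp
    | succ n ih => rw [ascPochhammer_succ_eval, ih, rising_succ]; push_cast; ring
  rw [e] at h
  rw [al]
  push_cast
  rw [eq_div_iff h4, mul_comm, h]

theorem hasSum_al (a : ℝ) {w : ℂ} (hw : ‖w‖ < 1) :
    HasSum (fun n => (al a n : ℂ) * w ^ n) ((1 - w) ^ (-a : ℂ)) := by
  have h := (Complex.one_div_one_sub_cpow_hasFPowerSeriesOnBall_zero (a : ℂ)).hasSum (y := w)
    (by simpa [enorm_eq_nnnorm, ← NNReal.coe_lt_coe] using hw)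
  simpa [FormalMultilinearSeries.ofScalars_apply_eq, ofReal_choose_eq_al, Complex.cpow_neg, mul_comm] using h

theorem hasSum_al_real (a : ℝ) {w : ℝ} (hw : |w| < 1) :
    HasSum (fun n => al a n * w ^ n) ((1 - w) ^ (-a)) := by
  have h := hasSum_al a (w := (w : ℂ)) (by simpa using hw)
  have hw1 : 0 ≤ 1 - w := by linarith [le_abs_self w]
  have e : ((1 : ℂ) - w) ^ (-a : ℂ) = (((1 - w) ^ (-a) : ℝ) : ℂ) := by
    rw [Complex.ofReal_cpow hw1]; push_cast; rfl
  rw [e] at h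
  exact_mod_cast h

theorem summable_abs_al (a : ℝ) {w : ℝ} (h0 : 0 ≤ w) (hw : w < 1) :
    Summable fun n => |al a n| * w ^ n := by
  refine Summable.of_nonneg_of_le (fun n => by positivity)
    (fun n => mul_le_mul_of_nonneg_right (abs_al_le a n) (pow_nonneg h0 n))
    (hasSum_al_real |a| (w := w) (by rwa [abs_of_nonneg h0])).summable

/-! ### The trigonometric representation -/

open PowerSeries in
/-- The power series `(1 - z t)^(-l)` in `t`. -/
def binomSeries (l : ℝ) (z : ℂ) : PowerSeries ℂ := PowerSeries.mk fun n => (al l n : ℂ) * z ^ n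

open PowerSeries in
-- The first-order equation of (1 - zt)^(-l), from which the equation of a product of two such
-- series follows by the Leibniz rule.
theorem binomSeries_ode (l : ℝ) (z : ℂ) :
    (1 - C z * X) * d⁄dX ℂ (binomSeries l z) = C ((l : ℂ) * z) * binomSeries l z := by
  rw [sub_mul, one_mul, mul_assoc]
  ext n
  rw [map_sub, coeff_C_mul, coeff_C_mul]
  cases n with
  | zero =>
    simp [coeff_derivative, binomSeries, al_succ', coeff_zero_X_mul]
  | succ n =>
    rw [coeff_succ_X_mul, coeff_derivative, coeff_derivative]
    simp only [binomSeries, coeff_mk]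
    have h : (al l (n + 1 + 1) : ℂ) * ((n + 1 : ℕ) + 1) = al l (n + 1) * (l + (n + 1 : ℕ)) := by
      exact_mod_cast al_succ l (n + 1)
    push_cast at h ⊢
    linear_combination z ^ (n + 2) * h

open PowerSeries in
-- The product is the generating function (1 - 2xt + t²)^(-l). Its equation (1 - 2xt + t²) G' = 2l
-- (x - t) G, read coefficientwise, is the three-term recurrence of the Gegenbauer polynomials.
theorem coeff_binomSeries_mul_recurrence (l : ℝ) {a b x : ℂ} (hab : a * b = 1)
    (hx : a + b = 2 * x) (n : ℕ) :
    (n + 2) * PowerSeries.coeff (n + 2) (binomSeries l a * binomSeries l b) =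
      2 * (n + 1 + l) * x * PowerSeries.coeff (n + 1) (binomSeries l a * binomSeries l b) -
        (n + 2 * l) * PowerSeries.coeff n (binomSeries l a * binomSeries l b) := by
  set G := binomSeries l a * binomSeries l b with hG
  have h : d⁄dX ℂ G = C (2 * x) * (X * d⁄dX ℂ G) - X * (X * d⁄dX ℂ G) +
      C (2 * l * x) * G - C (2 * l : ℂ) * (X * G) := by
    have ha := binomSeries_ode l a
    have hb := binomSeries_ode l b
    have hab' : (C a * C b : PowerSeries ℂ) = 1 := by rw [← map_mul, hab, map_one]
    have hx' : (C a + C b : PowerSeries ℂ) = C (2 * x) := by rw [← map_add, hx]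
    have e1 : (C (2 * l * x) : PowerSeries ℂ) = C (l : ℂ) * (C a + C b) := by
      rw [hx', ← map_mul]; congr 1; ring
    have e2 : (C (2 * l : ℂ) : PowerSeries ℂ) = 2 * C (l : ℂ) := by
      rw [map_mul]; congr 1
    rw [← hx', e1, e2]
    have hd : d⁄dX ℂ G = binomSeries l a * d⁄dX ℂ (binomSeries l b) +
        d⁄dX ℂ (binomSeries l a) * binomSeries l b := by
      rw [hG, Derivation.leibniz]; simp only [smul_eq_mul]; ring
    rw [map_mul] at ha hb
    rw [hd, hG]
    linear_combination (1 - C b * X) * binomSeries l b * ha + (1 - C a * X) * binomSeries l a * hb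
      - (X ^ 2 * (binomSeries l a * d⁄dX ℂ (binomSeries l b) +
        d⁄dX ℂ (binomSeries l a) * binomSeries l b) +
          2 * C (l : ℂ) * X * binomSeries l a * binomSeries l b) * hab'
  have hn := congrArg (PowerSeries.coeff (n + 1)) h
  simp only [map_add, map_sub, coeff_C_mul, coeff_succ_X_mul, coeff_derivative] at hn
  cases n with
  | zero =>
    simp only [coeff_zero_X_mul] at hn
    push_cast at hn ⊢
    linear_combination hn
  | succ n =>
    simp only [coeff_succ_X_mul, coeff_derivative] at hn
    push_cast at hn ⊢
    linear_combination hn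

open PowerSeries in
/-- Gegenbauer's trigonometric formula, with `a = e^{iθ}`, `b = e^{-iθ}`, `x = cos θ`. -/
theorem poly_eq_sum {l : ℝ} (hl : -1 / 2 < l) {a b : ℂ} {x : ℝ} (hab : a * b = 1)
    (hx : a + b = 2 * x) (n : ℕ) :
    (poly l n x : ℂ) = ∑ p ∈ Finset.HasAntidiagonal.antidiagonal n,
      ((al l p.1 : ℂ) * a ^ p.1) * ((al l p.2 : ℂ) * b ^ p.2) := by
  have key : ∀ n, (poly l n x : ℂ) = PowerSeries.coeff n (binomSeries l a * binomSeries l b) ∧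
      (poly l (n + 1) x : ℂ) = PowerSeries.coeff (n + 1) (binomSeries l a * binomSeries l b) := by
    intro n
    induction n with
    | zero =>
      constructor
      · simp [poly_zero, binomSeries]
      · simp [poly_one hl, coeff_mul, Finset.Nat.antidiagonal_succ, binomSeries, al_succ']
        linear_combination -(l : ℂ) * hx
    | succ n ih =>
      refine ⟨ih.2, ?_⟩
      have h1 := coeff_binomSeries_mul_recurrence l hab hx n
      have h2 : ((n : ℂ) + 2) * poly l (n + 2) x =
          2 * (n + 1 + l) * x * poly l (n + 1) x - (n + 2 * l) * poly l n x := by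
        exact_mod_cast poly_recurrence hl n x
      rw [← ih.1, ← ih.2, ← h2] at h1
      have h0 : (n : ℂ) + 2 ≠ 0 := by exact_mod_cast (by omega : n + 2 ≠ 0)
      exact (mul_left_cancel₀ h0 h1).symm
  rw [(key n).1, coeff_mul]
  simp [binomSeries]

/-- The sum of the absolute values of the coefficients in the trigonometric representation. -/
def absSum (l : ℝ) (n : ℕ) : ℝ := ∑ p ∈ Finset.HasAntidiagonal.antidiagonal n, |al l p.1| * |al l p.2|

theorem absSum_nonneg (l : ℝ) (n : ℕ) : 0 ≤ absSum l n :=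
  Finset.sum_nonneg fun _ _ => by positivity

theorem abs_poly_le_absSum {l : ℝ} (hl : -1 / 2 < l) (n : ℕ) {x : ℝ} (hx : x ∈ Icc (-1 : ℝ) 1) :
    |poly l n x| ≤ absSum l n := by
  set a : ℂ := Complex.exp (Real.arccos x * Complex.I)
  set b : ℂ := Complex.exp (-(Real.arccos x * Complex.I))
  have hab : a * b = 1 := by rw [← Complex.exp_add]; simp
  have hx' : a + b = 2 * x := by
    have h1 := Complex.two_cos (Real.arccos x : ℂ)
    rw [← Complex.ofReal_cos, Real.cos_arccos hx.1 hx.2] at h1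
    rw [h1, neg_mul]
  have ha : ‖a‖ = 1 := Complex.norm_exp_ofReal_mul_I _
  have hb : ‖b‖ = 1 := by
    have := congrArg norm hab
    rwa [norm_mul, ha, one_mul, norm_one] at this
  have h := congrArg norm (poly_eq_sum hl hab hx' n)
  rw [Complex.norm_real, Real.norm_eq_abs] at h
  rw [h, absSum]
  refine (norm_sum_le _ _).trans (Finset.sum_le_sum fun p _ => ?_)
  simp [ha, hb]

theorem poly_at_one' {l : ℝ} (n : ℕ) : poly l n 1 = al (2 * l) n := poly_at_one l n

/-- For l > 0 the coefficients of the trigonometric formula are positive, so the sum of their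
absolute values is the value at x = 1. Thus |C_n| is largest there. -/
theorem absSum_eq {l : ℝ} (hl : 0 < l) (n : ℕ) : absSum l n = al (2 * l) n := by
  have h := poly_eq_sum (l := l) (by linarith) (a := 1) (b := 1) (x := 1) (by simp)
    (by norm_num) n
  rw [poly_at_one'] at h
  simp only [one_pow, mul_one] at h
  rw [absSum]
  have h' : al (2 * l) n = ∑ p ∈ Finset.HasAntidiagonal.antidiagonal n, al l p.1 * al l p.2 := by
    exact_mod_cast h
  rw [h']
  simp [abs_of_pos (al_pos hl _)]

theorem abs_poly_le {l : ℝ} (hl : 0 < l) (n : ℕ) {x : ℝ} (hx : x ∈ Icc (-1 : ℝ) 1) :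
    |poly l n x| ≤ al (2 * l) n :=
  (absSum_eq hl n) ▸ abs_poly_le_absSum (by linarith) n hx

theorem summable_absSum (l : ℝ) {w : ℝ} (h0 : 0 ≤ w) (hw : w < 1) :
    Summable fun n => absSum l n * w ^ n := by
  have h := summable_abs_al l h0 hw
  have h2 := summable_norm_sum_mul_antidiagonal_of_summable_norm h.norm h.norm
  refine h2.congr fun n => ?_
  rw [Real.norm_of_nonneg (Finset.sum_nonneg fun _ _ => by positivity), absSum, Finset.sum_mul]
  refine Finset.sum_congr rfl fun p hp => ?_
  rw [← Finset.HasAntidiagonal.mem_antidiagonal.mp hp, pow_add]; ring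

theorem poly_even_at_zero {l : ℝ} (hl : -1 / 2 < l) (i : ℕ) :
    poly l (2 * i) 0 = (-1) ^ i * al l i := by
  induction i with
  | zero => simp [poly_zero]
  | succ i ih =>
    have h := poly_recurrence hl (2 * i) 0
    rw [ih] at h
    have h2 := al_succ l i
    have h0 : (2 * (i : ℝ) + 2) ≠ 0 := by positivity
    rw [show 2 * (i + 1) = 2 * i + 2 by ring]
    push_cast at h
    apply mul_left_cancel₀ h0
    rw [pow_succ]
    linear_combination h + 2 * (-1) ^ i * h2

/-! ### Connection coefficients -/

/-- The coefficient of the Gegenbauer polynomial of degree `k` in the Chebyshev polynomial of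
the second kind of degree `k + 2 * j`. -/
def conn (l : ℝ) (k j : ℕ) : ℝ :=
  (k + j).factorial * rising (1 - l) j * (k + l) / (rising l (k + j + 1) * j.factorial)

/-- Gegenbauer polynomials with integer index, vanishing for negative index. -/
def zpoly (l : ℝ) (k : ℤ) (x : ℝ) : ℝ := if 0 ≤ k then poly l k.toNat x else 0

theorem zpoly_natCast (l : ℝ) (k : ℕ) (x : ℝ) : zpoly l k x = poly l k x := by simp [zpoly]

theorem zpoly_of_neg (l : ℝ) {k : ℤ} (hk : k < 0) (x : ℝ) : zpoly l k x = 0 := by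
  simp [zpoly, hk]

/-- Extension by zero respects the recurrence for every integer k: at k = -1 the coefficient k + 1
of C_0 vanishes. -/
theorem zpoly_recurrence {l : ℝ} (hl : -1 / 2 < l) (k : ℤ) (x : ℝ) :
    2 * x * ((k + l) * zpoly l k x) =
      (k + 1) * zpoly l (k + 1) x + (k + 2 * l - 1) * zpoly l (k - 1) x := by
  rcases lt_or_ge k (-1) with h | h
  · rw [zpoly_of_neg l (by omega : k < 0), zpoly_of_neg l (by omega : k + 1 < 0),
      zpoly_of_neg l (by omega : k - 1 < 0)]
    ring
  rcases h.eq_or_lt with rfl | h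
  · rw [zpoly_of_neg l (by omega), zpoly_of_neg l (by omega : (-1 : ℤ) - 1 < 0)]
    simp
  obtain ⟨n, rfl⟩ := Int.eq_ofNat_of_zero_le (by omega : 0 ≤ k)
  rcases n with _ | n
  · have h1 : zpoly l ((0 : ℕ) + 1 : ℤ) x = poly l 1 x := zpoly_natCast l 1 x
    rw [h1, zpoly_natCast, zpoly_of_neg l (by simp), poly_zero, poly_one hl]
    simp; ring
  · have h1 : zpoly l ((n + 1 : ℕ) + 1 : ℤ) x = poly l (n + 2) x := zpoly_natCast l (n + 2) x
    have h2 : zpoly l ((n + 1 : ℕ) - 1 : ℤ) x = poly l n x := by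
      rw [← zpoly_natCast]; congr 1; simp
    rw [h1, h2, zpoly_natCast]
    have := poly_recurrence hl n x
    push_cast
    linear_combination -this

/-- Auxiliary form of the connection coefficients, as a function of the two degrees. -/
def econn (l : ℝ) (m j : ℕ) : ℝ :=
  (m - j).factorial * rising (1 - l) j / (rising l (m - j + 1) * j.factorial)

theorem econn_add (l : ℝ) (j r : ℕ) : econn l (j + r) j =
    r.factorial * rising (1 - l) j / (rising l (r + 1) * j.factorial) := by
  simp [econn]

theorem econn_succ {l : ℝ} (hl : -1 < l) (h0 : l ≠ 0) {m j : ℕ} (h : j ≤ m) :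
    econn l (m + 1) j * (l + (m - j + 1)) = econn l m j * (m - j + 1) := by
  obtain ⟨r, rfl⟩ := Nat.exists_eq_add_of_le h
  rw [add_assoc, econn_add, econn_add, rising_succ l (r + 1), Nat.factorial_succ]
  have h1 := rising_ne_zero hl h0 (r + 1)
  have h2 : l + ((r + 1 : ℕ) : ℝ) ≠ 0 := by
    push_cast
    have : (0 : ℝ) ≤ r := r.cast_nonneg
    linarith
  have h4 : ((j.factorial : ℕ) : ℝ) ≠ 0 := by positivity
  push_cast at h2 ⊢
  field_simp
  ring

/-- What U_{m+2} = 2x U_{m+1} - U_m demands of the coefficients once each x C_k has been replaced by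
its two neighbours. The leading coefficient, which has no left neighbour, is treated by
`econn_succ`. -/
theorem econn_diag {l : ℝ} (hl : -1 < l) (h0 : l ≠ 0) {m j : ℕ} (h : j ≤ m) :
    econn l (m + 2) (j + 1) * (m - 2 * j + l) =
      econn l (m + 1) (j + 1) * (m - 2 * j) + econn l (m + 1) j * (m - 2 * j + 2 * l) -
        econn l m j * (m - 2 * j + l) := by
  obtain ⟨r, rfl⟩ := Nat.exists_eq_add_of_le h
  rw [show j + r + 2 = (j + 1) + (r + 1) by ring, econn_add,
    show j + r + 1 = (j + 1) + r by ring, econn_add, show j + 1 + r = j + (r + 1) by ring,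
    econn_add, econn_add, rising_succ l (r + 1), rising_succ (1 - l), Nat.factorial_succ,
    Nat.factorial_succ]
  have h1 := rising_ne_zero hl h0 (r + 1)
  have h2 : l + ((r + 1 : ℕ) : ℝ) ≠ 0 := by
    push_cast
    have : (0 : ℝ) ≤ r := r.cast_nonneg
    linarith
  have h4 : ((j.factorial : ℕ) : ℝ) ≠ 0 := by positivity
  push_cast at h2 ⊢
  field_simp
  ring

open Polynomial Chebyshev in
-- Letting j run up to m rather than m/2 avoids a parity split in the induction: the surplus terms
-- carry a negative index and vanish through `zpoly`.
theorem U_eq_sum_econn {l : ℝ} (hl : -1 / 2 < l) (h0 : l ≠ 0) (m : ℕ) (x : ℝ) :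
    (U ℝ m).eval x = ∑ j ∈ Finset.range (m + 1),
      econn l m j * ((m - 2 * j + l) * zpoly l (m - 2 * j) x) := by
  have hl' : -1 < l := by linarith
  induction m using Nat.twoStepInduction with
  | zero =>
    simp [zpoly, poly_zero, econn, rising_succ, h0]
  | one =>
    have h1 : l + 1 ≠ 0 := by linarith
    have h2 : zpoly l 1 x = poly l 1 x := zpoly_natCast l 1 x
    simp [Finset.sum_range_succ, econn, rising_succ]
    rw [h2, poly_one hl, zpoly_of_neg l (by norm_num)]
    field_simp
    ring
  | more m ih0 ih1 =>
    have hU := congrArg (eval x) (U_add_two ℝ (m : ℤ))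
    simp only [eval_sub, eval_mul, eval_X, eval_ofNat] at hU
    have hU' : eval x (U ℝ ((m + 2 : ℕ) : ℤ)) =
        2 * x * eval x (U ℝ ((m + 1 : ℕ) : ℤ)) - eval x (U ℝ (m : ℤ)) := by
      push_cast; exact hU
    rw [hU', ih0, ih1, Finset.mul_sum, Finset.sum_range_succ _ (m + 2)]
    have hlast : zpoly l (((m + 2 : ℕ) : ℤ) - 2 * ((m + 2 : ℕ) : ℤ)) x = 0 :=
      zpoly_of_neg l (by push_cast; omega) x
    rw [hlast, mul_zero, mul_zero, add_zero]
    set Z : ℕ → ℝ := fun j => zpoly l ((m : ℤ) + 2 - 2 * j) x with hZ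
    have hZ1 : ∀ j : ℕ, zpoly l ((m : ℤ) - 2 * j) x = Z (j + 1) := by
      intro j; simp only [hZ]; congr 1; push_cast; ring
    have e1 : ∑ j ∈ Finset.range (m + 1 + 1), 2 * x * (econn l (m + 1) j *
          ((((m + 1 : ℕ) : ℝ) - 2 * j + l) * zpoly l (((m + 1 : ℕ) : ℤ) - 2 * j) x)) =
        ∑ j ∈ Finset.range (m + 1 + 1), econn l (m + 1) j * ((m + 2 - 2 * j) * Z j) +
        ∑ j ∈ Finset.range (m + 1 + 1), econn l (m + 1) j * ((m - 2 * j + 2 * l) * Z (j + 1)) := by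
      rw [← Finset.sum_add_distrib]
      refine Finset.sum_congr rfl fun j _ => ?_
      have h := zpoly_recurrence hl (((m + 1 : ℕ) : ℤ) - 2 * j) x
      have a1 : zpoly l (((m + 1 : ℕ) : ℤ) - 2 * j + 1) x = Z j := by
        simp only [hZ]; congr 1; push_cast; ring
      have a2 : zpoly l (((m + 1 : ℕ) : ℤ) - 2 * j - 1) x = Z (j + 1) := by
        simp only [hZ]; congr 1; push_cast; ring
      rw [a1, a2] at h
      push_cast at h ⊢
      linear_combination econn l (m + 1) j * h
    have hZlast : Z (m + 1 + 1) = 0 := zpoly_of_neg l (by push_cast; omega) x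
    have e2 : ∑ j ∈ Finset.range (m + 1), econn l m j *
          ((m - 2 * j + l) * zpoly l (m - 2 * j) x) =
        ∑ j ∈ Finset.range (m + 1), econn l m j * ((m - 2 * j + l) * Z (j + 1)) :=
      Finset.sum_congr rfl fun j _ => by rw [hZ1]
    have e3 : ∑ j ∈ Finset.range (m + 2), econn l (m + 2) j *
          ((((m + 2 : ℕ) : ℝ) - 2 * j + l) * zpoly l (((m + 2 : ℕ) : ℤ) - 2 * j) x) =
        ∑ j ∈ Finset.range (m + 1 + 1), econn l (m + 2) j * ((m + 2 - 2 * j + l) * Z j) :=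
      Finset.sum_congr rfl fun j _ => by simp only [hZ]; push_cast; ring
    rw [e1, e2, e3, Finset.sum_range_succ' _ (m + 1), Finset.sum_range_succ _ (m + 1), hZlast,
      mul_zero, mul_zero, add_zero, Finset.sum_range_succ' _ (m + 1)]
    have e4 : econn l (m + 2) 0 * (m + 2 + l) = econn l (m + 1) 0 * (m + 2) := by
      have := econn_succ hl' h0 (Nat.zero_le (m + 1))
      push_cast at this
      linear_combination this
    have e5 : ∑ j ∈ Finset.range (m + 1), (econn l (m + 2) (j + 1) *
          ((m + 2 - 2 * ((j + 1 : ℕ) : ℝ) + l) * Z (j + 1)) -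
        econn l (m + 1) (j + 1) * ((m + 2 - 2 * ((j + 1 : ℕ) : ℝ)) * Z (j + 1)) -
        econn l (m + 1) j * ((m - 2 * j + 2 * l) * Z (j + 1)) +
        econn l m j * ((m - 2 * j + l) * Z (j + 1))) = 0 := by
      refine Finset.sum_eq_zero fun j hj => ?_
      have := econn_diag hl' h0 (Nat.lt_succ_iff.mp (Finset.mem_range.mp hj))
      push_cast
      linear_combination Z (j + 1) * this
    rw [Finset.sum_add_distrib, Finset.sum_sub_distrib, Finset.sum_sub_distrib] at e5
    push_cast at e5 ⊢
    linear_combination -e5 - Z 0 * e4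

theorem econn_eq_conn (l : ℝ) (k j : ℕ) : econn l (k + 2 * j) j * (k + l) = conn l k j := by
  rw [show k + 2 * j = j + (k + j) by ring, econn_add, conn]
  ring

end Gegenbauer

namespace Gegenbauer

/-! ### Size of the binomial coefficients -/

/-- The normalised binomial coefficient, which tends to `1 / Γ(a)`. -/
def rat (a : ℝ) (n : ℕ) : ℝ := al a n * (n : ℝ) ^ (1 - a)

theorem rat_one (a : ℝ) : rat a 1 = a := by simp [rat, al_succ']

theorem al_eq_rat (a : ℝ) {n : ℕ} (hn : 1 ≤ n) : al a n = rat a n * (n : ℝ) ^ (a - 1) := by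
  have : (0 : ℝ) < n := by exact_mod_cast hn
  rw [rat, mul_assoc, ← Real.rpow_add this]; simp

/-- With y = -1/(n+1) the quotient of consecutive values is (1 + y(1-a)) / (1+y)^(1-a), so
monotonicity is Bernoulli's inequality: one direction for exponents in [0, 1], the other for
exponents at least 1. -/
theorem rat_succ (a : ℝ) {n : ℕ} (hn : 1 ≤ n) : rat a (n + 1) =
    rat a n * ((1 + -(1 / (n + 1)) * (1 - a)) * (1 + -(1 / (n + 1))) ^ (-(1 - a) : ℝ)) := by
  have h0 : (0 : ℝ) < n := by exact_mod_cast hn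
  have e : (1 + -(1 / (n + 1)) : ℝ) = n / (n + 1) := by field_simp; ring
  rw [rat, rat, al_succ', e, Real.rpow_neg (by positivity), Real.div_rpow (by positivity) (by positivity)]
  push_cast
  have : (n : ℝ) ^ (1 - a) ≠ 0 := (Real.rpow_pos_of_pos h0 _).ne'
  have : ((n : ℝ) + 1) ^ (1 - a) ≠ 0 := (Real.rpow_pos_of_pos (by positivity) _).ne'
  field_simp
  ring

theorem rat_step_bounds {n : ℕ} (hn : 1 ≤ n) :
    (-1 : ℝ) ≤ -(1 / (n + 1)) ∧ 0 < 1 + -(1 / ((n : ℝ) + 1)) := by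
  have h0 : (0 : ℝ) < n := by exact_mod_cast hn
  have e : (1 + -(1 / (n + 1)) : ℝ) = n / (n + 1) := by field_simp; ring
  have : (0 : ℝ) < n / (n + 1) := by positivity
  exact ⟨by linarith, by linarith⟩

theorem rat_pos {a : ℝ} (ha : 0 < a) {n : ℕ} (hn : 1 ≤ n) : 0 < rat a n :=
  mul_pos (al_pos ha n) (Real.rpow_pos_of_pos (by exact_mod_cast hn) _)

theorem rat_succ_le {a : ℝ} (ha : 1 ≤ a) {n : ℕ} (hn : 1 ≤ n) : rat a (n + 1) ≤ rat a n := by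
  rw [rat_succ a hn]
  refine mul_le_of_le_one_right (rat_pos (by linarith) hn).le ?_
  obtain ⟨-, h1⟩ := rat_step_bounds hn
  set y : ℝ := 1 / ((n : ℝ) + 1)
  have e1 : 1 + -y * (1 - a) ≤ Real.exp (y * (a - 1)) := by
    have := Real.add_one_le_exp (y * (a - 1)); linarith
  have e2 : (1 + -y) ^ (-(1 - a)) ≤ Real.exp (-y * (a - 1)) := by
    rw [Real.exp_mul, neg_sub]
    refine Real.rpow_le_rpow h1.le ?_ (by linarith)
    have := Real.add_one_le_exp (-y); linarith
  calc _ ≤ Real.exp (y * (a - 1)) * Real.exp (-y * (a - 1)) := by gcongr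
    _ = 1 := by rw [← Real.exp_add]; simp

theorem le_rat_succ {a : ℝ} (ha : 0 < a) (ha1 : a ≤ 1) {n : ℕ} (hn : 1 ≤ n) :
    rat a n ≤ rat a (n + 1) := by
  rw [rat_succ a hn]
  refine le_mul_of_one_le_right (rat_pos ha hn).le ?_
  obtain ⟨h0, h1⟩ := rat_step_bounds hn
  have hb := _root_.rpow_one_add_le_one_add_mul_self h0 (p := 1 - a) (by linarith) (by linarith)
  have hp := Real.rpow_pos_of_pos h1 (1 - a)
  rw [Real.rpow_neg h1.le, ← div_eq_mul_inv, one_le_div hp, mul_comm]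
  rw [mul_comm]
  linarith

theorem abs_rat_succ_le {a : ℝ} (ha : -1 / 2 < a) (ha1 : a < 0) {n : ℕ} (hn : 1 ≤ n) :
    |rat a (n + 1)| ≤ |rat a n| := by
  rw [rat_succ a hn, abs_mul]
  refine mul_le_of_le_one_right (abs_nonneg _) ?_
  obtain ⟨h0, h1⟩ := rat_step_bounds hn
  have hb := one_add_mul_self_le_rpow_one_add h0 (p := 1 - a) (by linarith)
  have hp := Real.rpow_pos_of_pos h1 (1 - a)
  have hn1 : (1 : ℝ) ≤ n := by exact_mod_cast hn
  -- As 1/(n+1) ≤ 1/2 and 1 - a < 3/2, the factor exceeds 1/4, so its absolute value can be dropped.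
  have h2 : 0 ≤ 1 + -(1 / ((n : ℝ) + 1)) * (1 - a) := by
    have : 1 / ((n : ℝ) + 1) ≤ 1 / 2 := by gcongr; linarith
    nlinarith
  rw [Real.rpow_neg h1.le, ← div_eq_mul_inv, abs_of_nonneg (div_nonneg h2 hp.le), div_le_one hp]
  linarith

/-- Up to the factor n/(a + n) this is the reciprocal of Euler's product for Γ(a). -/
theorem tendsto_rat {a : ℝ} (ha : -1 < a) (h0 : a ≠ 0) :
    Tendsto (rat a) atTop (𝓝 (Real.Gamma a)⁻¹) := by
  have hG : Real.Gamma a ≠ 0 := by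
    refine Real.Gamma_ne_zero fun m hm => ?_
    rcases m with _ | m
    · simp at hm; exact h0 hm
    · push_cast at hm
      have : (0 : ℝ) ≤ m := m.cast_nonneg
      linarith
  have h1 : Tendsto (fun n : ℕ => (n : ℝ) / (a + n)) atTop (𝓝 1) := by
    have := tendsto_natCast_div_add_atTop (𝕜 := ℝ) a
    simpa [add_comm] using this
  have h2 : Tendsto (fun n : ℕ => (n : ℝ) / (a + n) * (Real.GammaSeq a n)⁻¹) atTop
      (𝓝 (1 * (Real.Gamma a)⁻¹)) :=
    h1.mul ((Real.GammaSeq_tendsto_Gamma a).inv₀ hG)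
  rw [one_mul] at h2
  refine h2.congr' ?_
  filter_upwards [eventually_ge_atTop 1] with n hn
  have hp : ∏ j ∈ Finset.range (n + 1), (a + j) = rising a (n + 1) := by
    induction n + 1 with
    | zero => simp
    | succ m ih => rw [Finset.prod_range_succ, ih, rising_succ]
  have hn0 : (0 : ℝ) < n := by exact_mod_cast hn
  have h3 : a + n ≠ 0 := by
    have : (1 : ℝ) ≤ n := by exact_mod_cast hn
    linarith
  rw [Real.GammaSeq, hp, rising_succ, rat, al, Real.rpow_sub hn0, Real.rpow_one]
  have := (Real.rpow_pos_of_pos hn0 a).ne'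
  have := rising_ne_zero ha h0 n
  field_simp

section

variable {a : ℝ} {n : ℕ}

theorem inv_Gamma_le_rat (ha : 1 ≤ a) (hn : 1 ≤ n) : (Real.Gamma a)⁻¹ ≤ rat a n := by
  have h := tendsto_rat (by linarith : -1 < a) (by linarith)
  refine le_of_tendsto h ?_
  filter_upwards [eventually_ge_atTop n] with m hm
  induction m, hm using Nat.le_induction with
  | base => rfl
  | succ m hm ih => exact (rat_succ_le ha (hn.trans hm)).trans ih

theorem rat_le_of_le (ha : 1 ≤ a) {m : ℕ} (hm : 1 ≤ m) (hn : m ≤ n) : rat a n ≤ rat a m := by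
  induction n, hn using Nat.le_induction with
  | base => rfl
  | succ m' hm' ih => exact (rat_succ_le ha (hm.trans hm')).trans ih

theorem rat_le_inv_Gamma (ha : 0 < a) (ha1 : a ≤ 1) (hn : 1 ≤ n) :
    rat a n ≤ (Real.Gamma a)⁻¹ := by
  have h := tendsto_rat (by linarith : -1 < a) (by linarith)
  refine ge_of_tendsto h ?_
  filter_upwards [eventually_ge_atTop n] with m hm
  induction m, hm using Nat.le_induction with
  | base => rfl
  | succ m hm ih => exact ih.trans (le_rat_succ ha ha1 (hn.trans hm))

theorem le_rat (ha : 0 < a) (ha1 : a ≤ 1) (hn : 1 ≤ n) : a ≤ rat a n := by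
  induction n, hn using Nat.le_induction with
  | base => rw [rat_one]
  | succ m hm ih => exact ih.trans (le_rat_succ ha ha1 hm)

theorem inv_Gamma_le_abs_rat (ha : -1 / 2 < a) (ha1 : a < 0) (hn : 1 ≤ n) :
    |Real.Gamma a|⁻¹ ≤ |rat a n| := by
  have h := (tendsto_rat (by linarith : -1 < a) (by linarith)).abs
  rw [abs_inv] at h
  refine le_of_tendsto h ?_
  filter_upwards [eventually_ge_atTop n] with m hm
  induction m, hm using Nat.le_induction with
  | base => rfl
  | succ m hm ih => exact (abs_rat_succ_le ha ha1 (hn.trans hm)).trans ih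

theorem abs_rat_le (ha : -1 / 2 < a) (ha1 : a < 0) (hn : 1 ≤ n) : |rat a n| ≤ |a| := by
  induction n, hn using Nat.le_induction with
  | base => rw [rat_one]
  | succ m hm ih => exact (abs_rat_succ_le ha ha1 hm).trans ih

end

theorem abs_al_eq (a : ℝ) {n : ℕ} (hn : 1 ≤ n) : |al a n| = |rat a n| * (n : ℝ) ^ (a - 1) := by
  rw [al_eq_rat a hn, abs_mul, abs_of_nonneg (Real.rpow_nonneg (Nat.cast_nonneg n) _)]

theorem exists_abs_al_bounds {a : ℝ} (ha : -1 / 2 < a) (h0 : a ≠ 0) :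
    ∃ m M : ℝ, 0 < m ∧ 0 < M ∧ ∀ n : ℕ, 1 ≤ n →
      m * (n : ℝ) ^ (a - 1) ≤ |al a n| ∧ |al a n| ≤ M * (n : ℝ) ^ (a - 1) := by
  suffices H : ∃ m M : ℝ, 0 < m ∧ 0 < M ∧ ∀ n : ℕ, 1 ≤ n → m ≤ |rat a n| ∧ |rat a n| ≤ M by
    obtain ⟨m, M, hm, hM, h⟩ := H
    refine ⟨m, M, hm, hM, fun n hn => ?_⟩
    have hp : 0 ≤ (n : ℝ) ^ (a - 1) := Real.rpow_nonneg (Nat.cast_nonneg n) _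
    rw [abs_al_eq a hn]
    exact ⟨mul_le_mul_of_nonneg_right (h n hn).1 hp, mul_le_mul_of_nonneg_right (h n hn).2 hp⟩
  rcases lt_or_gt_of_ne h0 with h | h
  · have hG : Real.Gamma a ≠ 0 := by
      refine Real.Gamma_ne_zero fun m hm => ?_
      rcases m with _ | m
      · simp at hm; exact h0 hm
      · push_cast at hm
        have : (0 : ℝ) ≤ m := m.cast_nonneg
        linarith
    exact ⟨|Real.Gamma a|⁻¹, |a|, by positivity, by positivity, fun n hn =>
      ⟨inv_Gamma_le_abs_rat ha h hn, abs_rat_le ha h hn⟩⟩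
  · have hG := Real.Gamma_pos_of_pos h
    rcases le_total a 1 with h1 | h1
    · refine ⟨a, (Real.Gamma a)⁻¹, h, by positivity, fun n hn => ?_⟩
      rw [abs_of_pos (rat_pos h hn)]
      exact ⟨le_rat h h1 hn, rat_le_inv_Gamma h h1 hn⟩
    · refine ⟨(Real.Gamma a)⁻¹, a, by positivity, h, fun n hn => ?_⟩
      rw [abs_of_pos (rat_pos h hn)]
      exact ⟨inv_Gamma_le_rat h1 hn, (rat_le_of_le h1 le_rfl hn).trans_eq (rat_one a)⟩

/-! ### The factors of the connection coefficients -/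

/-- The ratio `(k + 1)_j / (k + l + 1)_j`. -/
def rr (l : ℝ) (k j : ℕ) : ℝ := rising (k + 1) j / rising (k + l + 1) j

/-- Separates the size k!/(l)_k, independent of j, from the j-th Taylor coefficient of ₂F₁(k+1, 1-l;
k+l+1; ·). -/
theorem conn_eq {l : ℝ} (hl : -1 < l) (h0 : l ≠ 0) (k j : ℕ) :
    conn l k j = (al l k)⁻¹ * (rr l k j * al (1 - l) j) := by
  have e1 : ((k + j).factorial : ℝ) = k.factorial * rising (k + 1) j := by
    induction j with
    | zero => simp
    | succ j ih =>
      rw [← add_assoc, Nat.factorial_succ, rising_succ, Nat.cast_mul, ih]; push_cast; ring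
  have e2 : rising l (k + j + 1) = rising l k * (l + k) * rising (k + l + 1) j := by
    clear e1
    induction j with
    | zero => simp [rising_succ]
    | succ j ih =>
      rw [← add_assoc, rising_succ, ih, rising_succ]; push_cast; ring
  have h1 := rising_ne_zero hl h0 k
  have h2 : k + l ≠ 0 := by
    rcases k with _ | k
    · simpa using h0
    · push_cast
      have : (0 : ℝ) ≤ k := k.cast_nonneg
      linarith
  have h2' : l + k ≠ 0 := by rwa [add_comm]
  have h3 : rising (k + l + 1) j ≠ 0 := by
    refine (rising_pos ?_ j).ne'
    have : (0 : ℝ) ≤ k := k.cast_nonneg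
    linarith
  rw [conn, e1, e2, al, al, rr]
  field_simp
  ring

@[simp] theorem rr_zero (l : ℝ) (k : ℕ) : rr l k 0 = 1 := by simp [rr]

theorem rr_pos {l : ℝ} (hl : -1 < l) (k j : ℕ) : 0 < rr l k j := by
  have : (0 : ℝ) ≤ k := k.cast_nonneg
  exact div_pos (rising_pos (by linarith) j) (rising_pos (by linarith) j)

theorem rr_succ (l : ℝ) (k j : ℕ) :
    rr l k (j + 1) = rr l k j * ((k + 1 + j) / (k + l + 1 + j)) := by
  rw [rr, rr, rising_succ, rising_succ, mul_div_mul_comm]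

theorem rr_le_one {l : ℝ} (hl : 0 < l) (k j : ℕ) : rr l k j ≤ 1 := by
  induction j with
  | zero => simp
  | succ j ih =>
    rw [rr_succ]
    refine mul_le_one₀ ih (by positivity) ?_
    rw [div_le_one (by positivity)]
    linarith

theorem rr_antitone {l : ℝ} (hl : -1 < l) (h0 : l < 0) (j : ℕ) : Antitone fun k => rr l k j := by
  refine antitone_nat_of_succ_le fun k => ?_
  induction j with
  | zero => simp
  | succ j ih =>
    rw [rr_succ, rr_succ]
    have hk : (0 : ℝ) ≤ k := k.cast_nonneg
    have hj : (0 : ℝ) ≤ j := j.cast_nonneg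
    refine mul_le_mul ih ?_ (div_nonneg (by positivity) (by push_cast; linarith))
      (rr_pos hl k j).le
    rw [div_le_div_iff₀ (by push_cast; linarith) (by linarith)]
    push_cast
    nlinarith

/-- The constant in the bound of the connection coefficients for negative parameter. -/
def gammaConst (l : ℝ) : ℝ := Real.Gamma (1 + l) * Real.Gamma (1 - 2 * l) / Real.Gamma (1 - l)

theorem gammaConst_pos {l : ℝ} (hl : -1 < l) (h0 : l < 0) : 0 < gammaConst l :=
  div_pos (mul_pos (Real.Gamma_pos_of_pos (by linarith)) (Real.Gamma_pos_of_pos (by linarith)))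
    (Real.Gamma_pos_of_pos (by linarith))

/-- For l < 0 the ratio `rr` is largest at k = 0, where it equals 1/`al (1 + l) j`. The quotient q
of the two sides at k = 0, without the constant, increases with j. The powers of j cancel in the
limit, which is therefore a quotient of Gamma values, `gammaConst l`. -/
theorem rr_mul_al_le {l : ℝ} (hl : -1 / 2 < l) (h0 : l < 0) (k j : ℕ) :
    rr l k j * al (1 - l) j ≤ gammaConst l * al (1 - 2 * l) j := by
  have hl' : -1 < l := by linarith
  have p1 : ∀ j, 0 < al (1 - l) j := al_pos (by linarith)
  have p2 : ∀ j, 0 < al (1 - 2 * l) j := al_pos (by linarith)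
  have p3 : ∀ j, 0 < al (1 + l) j := al_pos (by linarith)
  set q : ℕ → ℝ := fun j => al (1 - l) j / (al (1 + l) j * al (1 - 2 * l) j) with hq
  have hrr : ∀ j, rr l 0 j = (al (1 + l) j)⁻¹ := by
    intro j
    rw [rr, al]
    simp only [Nat.cast_zero, zero_add, inv_div]
    congr 1
    · rw [rising, ascPochhammer_eval_one]
    · rw [add_comm]
  have hmono : Monotone q := by
    refine monotone_nat_of_le_succ fun j => ?_
    have hj : (0 : ℝ) ≤ j := j.cast_nonneg
    have e : q (j + 1) = q j * ((1 - l + j) * (j + 1) / ((1 + l + j) * (1 - 2 * l + j))) := by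
      simp only [hq, al_succ']
      have a1 := (p1 j).ne'
      have a2 := (p2 j).ne'
      have a3 := (p3 j).ne'
      have a4 : 1 + l + (j : ℝ) ≠ 0 := by linarith
      have a5 : 1 - 2 * l + (j : ℝ) ≠ 0 := by linarith
      field_simp
    rw [e]
    refine le_mul_of_one_le_right (div_nonneg (p1 j).le (mul_pos (p3 j) (p2 j)).le) ?_
    rw [one_le_div (mul_pos (by linarith) (by linarith))]
    -- With s = j + 1, the numerator (s - l)s exceeds the denominator (s + l)(s - 2l) by 2l².
    nlinarith [sq_nonneg l]
  have hlim : Tendsto q atTop (𝓝 (gammaConst l)) := by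
    have t1 := tendsto_rat (a := 1 - l) (by linarith) (by linarith)
    have t2 := tendsto_rat (a := 1 + l) (by linarith) (by linarith)
    have t3 := tendsto_rat (a := 1 - 2 * l) (by linarith) (by linarith)
    have g1 := (Real.Gamma_pos_of_pos (by linarith : 0 < 1 - l)).ne'
    have g2 := (Real.Gamma_pos_of_pos (by linarith : 0 < 1 + l)).ne'
    have g3 := (Real.Gamma_pos_of_pos (by linarith : 0 < 1 - 2 * l)).ne'
    have t := t1.div (t2.mul t3) (mul_ne_zero (inv_ne_zero g2) (inv_ne_zero g3))
    have e : (Real.Gamma (1 - l))⁻¹ / ((Real.Gamma (1 + l))⁻¹ * (Real.Gamma (1 - 2 * l))⁻¹) =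
        gammaConst l := by rw [gammaConst]; field_simp
    rw [e] at t
    refine t.congr' ?_
    filter_upwards [eventually_ge_atTop 1] with n hn
    have hn0 : (0 : ℝ) < n := by exact_mod_cast hn
    have e2 : (n : ℝ) ^ (1 - (1 - l)) = (n : ℝ) ^ (1 - (1 + l)) * (n : ℝ) ^ (1 - (1 - 2 * l)) := by
      rw [← Real.rpow_add hn0]; congr 1; ring
    have z1 := (Real.rpow_pos_of_pos hn0 (1 - (1 + l))).ne'
    have z2 := (Real.rpow_pos_of_pos hn0 (1 - (1 - 2 * l))).ne'
    have a2 := (p2 n).ne'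
    have a3 := (p3 n).ne'
    simp only [hq, Pi.div_apply, rat]
    rw [e2]
    field_simp
  have h1 : q j ≤ gammaConst l := hmono.ge_of_tendsto hlim j
  calc rr l k j * al (1 - l) j ≤ rr l 0 j * al (1 - l) j :=
        mul_le_mul_of_nonneg_right (rr_antitone hl' h0 j (Nat.zero_le k)) (p1 j).le
    _ = q j * al (1 - 2 * l) j := by
        have a2 := (p2 j).ne'
        have a3 := (p3 j).ne'
        rw [hrr]; simp only [hq]
        generalize al (1 - 2 * l) j = A at a2 ⊢
        field_simp
    _ ≤ _ := mul_le_mul_of_nonneg_right h1 (p2 j).le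

/-- A summable majorant of the coefficients `(k + 1)_j (1 - l)_j / ((k + l + 1)_j j!)`, uniform
in `k`. -/
def maj (l : ℝ) (j : ℕ) : ℝ := if l < 0 then gammaConst l * al (1 - 2 * l) j else |al (1 - l) j|

theorem maj_nonneg {l : ℝ} (hl : -1 / 2 < l) (j : ℕ) : 0 ≤ maj l j := by
  rw [maj]
  split_ifs with h
  · exact mul_nonneg (gammaConst_pos (by linarith) h).le (al_pos (by linarith) j).le
  · positivity

theorem abs_rr_mul_al_le {l : ℝ} (hl : -1 / 2 < l) (h0 : l ≠ 0) (k j : ℕ) :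
    |rr l k j * al (1 - l) j| ≤ maj l j := by
  rw [maj]
  split_ifs with h
  · rw [abs_of_pos (mul_pos (rr_pos (by linarith) k j) (al_pos (by linarith) j))]
    exact rr_mul_al_le hl h k j
  · have hl0 : 0 < l := lt_of_le_of_ne (not_lt.mp h) h0.symm
    rw [abs_mul, abs_of_pos (rr_pos (by linarith) k j)]
    exact mul_le_of_le_one_left (abs_nonneg _) (rr_le_one hl0 k j)

theorem summable_maj (l : ℝ) {w : ℝ} (h0 : 0 ≤ w) (hw : w < 1) :
    Summable fun j => maj l j * w ^ j := by
  simp only [maj]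
  split_ifs with h
  · simp only [mul_assoc]
    exact (hasSum_al_real _ (by rwa [abs_of_nonneg h0])).summable.mul_left _
  · exact summable_abs_al _ h0 hw

/-! ### The hypergeometric factor -/

/-- The function `₂F₁(k + 1, 1 - l; k + l + 1; w)`. -/
def hyp (l : ℝ) (k : ℕ) (w : ℂ) : ℂ := ∑' j, ((rr l k j * al (1 - l) j : ℝ) : ℂ) * w ^ j

theorem hasSum_hyp {l : ℝ} (hl : -1 / 2 < l) (h0 : l ≠ 0) (k : ℕ) {w : ℂ} (hw : ‖w‖ < 1) :
    HasSum (fun j => ((rr l k j * al (1 - l) j : ℝ) : ℂ) * w ^ j) (hyp l k w) := by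
  refine Summable.hasSum (Summable.of_norm_bounded (summable_maj l (norm_nonneg w) hw) fun j => ?_)
  rw [norm_mul, norm_pow, Complex.norm_real, Real.norm_eq_abs]
  exact mul_le_mul_of_nonneg_right (abs_rr_mul_al_le hl h0 k j) (by positivity)

theorem norm_hyp_le {l : ℝ} (hl : -1 / 2 < l) (h0 : l ≠ 0) (k : ℕ) {w : ℂ} {r : ℝ} (hr : r < 1)
    (hw : ‖w‖ ≤ r) : ‖hyp l k w‖ ≤ ∑' j, maj l j * r ^ j := by
  have hr0 := (norm_nonneg w).trans hw
  refine tsum_of_norm_bounded (summable_maj l hr0 hr).hasSum fun j => ?_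
  rw [norm_mul, norm_pow, Complex.norm_real, Real.norm_eq_abs]
  exact mul_le_mul (abs_rr_mul_al_le hl h0 k j) (pow_le_pow_left₀ (norm_nonneg w) hw j)
    (by positivity) (maj_nonneg hl j)

theorem tsum_maj_of_neg {l : ℝ} (h : l < 0) {r : ℝ} (hr0 : 0 ≤ r) (hr : r < 1) :
    ∑' j, maj l j * r ^ j = gammaConst l * (1 - r) ^ (2 * l - 1) := by
  have := (hasSum_al_real (1 - 2 * l) (w := r) (by rwa [abs_of_nonneg hr0])).mul_left (gammaConst l)
  simp only [maj, if_pos h, mul_assoc]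
  rw [this.tsum_eq, neg_sub]

/-- For l ≤ 1 the coefficients of (1 - w)^(l-1) are nonnegative, so the absolute values in the
majorant cost nothing. -/
theorem tsum_maj_of_le_one {l : ℝ} (h : 0 < l) (h1 : l ≤ 1) {r : ℝ} (hr0 : 0 ≤ r) (hr : r < 1) :
    ∑' j, maj l j * r ^ j = (1 - r) ^ (l - 1) := by
  have := hasSum_al_real (1 - l) (w := r) (by rwa [abs_of_nonneg hr0])
  have hnn : ∀ j, 0 ≤ al (1 - l) j := fun j => by
    rcases h1.eq_or_lt with rfl | h1
    · cases j with
      | zero => simp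
      | succ j => simp [al, rising_succ_left]
    · exact (al_pos (by linarith) j).le
  simp only [maj, if_neg (not_lt.mpr h.le), abs_of_nonneg (hnn _)]
  rw [this.tsum_eq, neg_sub]

end Gegenbauer

namespace Gegenbauer

/-! ### Euler's integral for the hypergeometric factor -/

open MeasureTheory ProbabilityTheory in
theorem beta_add {a b : ℝ} (ha : 0 < a) (hb : 0 < b) (j : ℕ) :
    beta (a + j) b = beta a b * (rising a j / rising (a + b) j) := by
  have hG : ∀ {c : ℝ}, 0 < c → Real.Gamma (c + j) = Real.Gamma c * rising c j := by
    intro c hc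
    induction j with
    | zero => simp
    | succ j ih =>
      push_cast
      rw [← add_assoc, Real.Gamma_add_one (by positivity), ih, rising_succ]; ring
  rw [beta, beta, hG ha, show a + j + b = a + b + j by ring, hG (by positivity : 0 < a + b)]
  have h1 := (Real.Gamma_pos_of_pos (by positivity : 0 < a + b)).ne'
  have h2 := (rising_pos (by positivity : 0 < a + b) j).ne'
  field_simp

open MeasureTheory ProbabilityTheory in
/-- The ratios of rising factorials are the moments of a probability measure on `(0, 1)`. -/
theorem exists_measure_moments {a b : ℝ} (ha : 0 < a) (hb : 0 < b) :
    ∃ μ : Measure ℝ, IsProbabilityMeasure μ ∧ (∀ᵐ t ∂μ, t ∈ Ioo (0 : ℝ) 1) ∧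
      ∀ j : ℕ, ∫ t, t ^ j ∂μ = rising a j / rising (a + b) j := by
  have hmeas : Measurable (betaPDF a b) := (measurable_betaPDFReal a b).ennreal_ofReal
  have hmeas' : ∀ c, Measurable (betaPDF c b) := fun c =>
    (measurable_betaPDFReal c b).ennreal_ofReal
  have hsupp : ∀ᵐ t ∂betaMeasure a b, t ∈ Ioo (0 : ℝ) 1 := by
    rw [betaMeasure, ae_withDensity_iff hmeas]
    refine .of_forall fun t ht => ?_
    by_contra hcon
    rw [mem_Ioo, not_and_or, not_lt, not_lt] at hcon
    rcases hcon with h | h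
    · exact ht (betaPDF_eq_zero_of_nonpos h)
    · exact ht (betaPDF_eq_zero_of_one_le h)
  refine ⟨betaMeasure a b, isProbabilityMeasureBeta ha hb, hsupp, fun j => ?_⟩
  have hr : 0 ≤ rising a j / rising (a + b) j :=
    div_nonneg (rising_pos ha j).le (rising_pos (by positivity) j).le
  rw [integral_eq_lintegral_of_nonneg_ae (hsupp.mono fun t ht => pow_nonneg ht.1.le j)
    (by fun_prop), betaMeasure, lintegral_withDensity_eq_lintegral_mul _ hmeas (by fun_prop)]
  have e : ∀ t, (betaPDF a b * fun t => ENNReal.ofReal (t ^ j)) t =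
      ENNReal.ofReal (rising a j / rising (a + b) j) * betaPDF (a + j) b t := by
    intro t
    simp only [Pi.mul_apply]
    rcases le_or_gt t 0 with h | h
    · simp [betaPDF_eq_zero_of_nonpos h]
    rcases le_or_gt 1 t with h' | h'
    · simp [betaPDF_eq_zero_of_one_le h']
    rw [betaPDF_of_pos_lt_one h h', betaPDF_of_pos_lt_one h h', ← ENNReal.ofReal_mul hr,
      mul_comm, ← ENNReal.ofReal_mul (by positivity), beta_add ha hb]
    congr 1
    have h3 : t ^ (a + j - 1) = t ^ j * t ^ (a - 1) := by
      rw [← Real.rpow_natCast, ← Real.rpow_add h]; congr 1; ring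
    have h1 := (beta_pos ha hb).ne'
    have h4 := (rising_pos ha j).ne'
    have h5 := (rising_pos (by positivity : 0 < a + b) j).ne'
    rw [h3]
    field_simp
  rw [lintegral_congr e, lintegral_const_mul _ (hmeas' _),
    lintegral_betaPDF_eq_one (by positivity) hb, mul_one, ENNReal.toReal_ofReal hr]

open MeasureTheory in
-- The ratios (k+1)_j/(k+1+l)_j are the moments of the Beta(k+1, l) law. Summing the binomial series
-- of (1 - tw)^(l-1) under the integral gives Euler's formula.
theorem exists_hyp_eq_integral {l : ℝ} (hl : 0 < l) (k : ℕ) :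
    ∃ μ : Measure ℝ, IsProbabilityMeasure μ ∧ (∀ᵐ t ∂μ, t ∈ Ioo (0 : ℝ) 1) ∧
      ∀ w : ℂ, ‖w‖ < 1 → hyp l k w = ∫ t, (1 - (t : ℂ) * w) ^ ((l - 1 : ℝ) : ℂ) ∂μ := by
  obtain ⟨μ, hμ, hs, hm⟩ := exists_measure_moments (a := k + 1) (b := l) (by positivity) hl
  refine ⟨μ, hμ, hs, fun w hw => ?_⟩
  have hrr : ∀ j, rr l k j = ∫ t, t ^ j ∂μ := by
    intro j; rw [hm, rr]; congr 2; ring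
  have hint : ∀ j : ℕ, Integrable (fun t : ℝ => t ^ j) μ := fun j =>
    Integrable.of_bound (by fun_prop) 1 (hs.mono fun t ht => by
      rw [norm_pow, Real.norm_of_nonneg ht.1.le]; exact pow_le_one₀ ht.1.le ht.2.le)
  have hsum := hasSum_integral_of_summable_integral_norm (μ := μ)
    (F := fun (j : ℕ) (t : ℝ) => (al (1 - l) j : ℂ) * ((t : ℂ) * w) ^ j) (fun j => ?_) ?_
  · have e1 : ∀ j, ∫ t : ℝ, (al (1 - l) j : ℂ) * ((t : ℂ) * w) ^ j ∂μ =
        ((rr l k j * al (1 - l) j : ℝ) : ℂ) * w ^ j := by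
      intro j
      simp only [mul_pow]
      rw [integral_const_mul, integral_mul_const, hrr]
      have : ∫ t : ℝ, ((t : ℂ)) ^ j ∂μ = ((∫ t, t ^ j ∂μ : ℝ) : ℂ) := by
        rw [← integral_complex_ofReal]; simp
      rw [this]
      push_cast
      ring
    simp only [e1] at hsum
    rw [hyp, hsum.tsum_eq]
    refine integral_congr_ae (hs.mono fun t ht => ?_)
    have hnorm : ‖(t : ℂ) * w‖ < 1 := by
      rw [norm_mul, Complex.norm_real, Real.norm_of_nonneg ht.1.le]
      nlinarith [ht.1, ht.2, norm_nonneg w]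
    have := hasSum_al (1 - l) hnorm
    simp only
    rw [this.tsum_eq]
    congr 1
    push_cast; ring
  · have : (fun t : ℝ => (al (1 - l) j : ℂ) * ((t : ℂ) * w) ^ j) =
        fun t : ℝ => ((al (1 - l) j : ℂ) * w ^ j) * ((t ^ j : ℝ) : ℂ) := by
      ext t; push_cast; ring
    rw [this]
    exact (hint j).ofReal.const_mul _
  · refine Summable.of_nonneg_of_le (fun j => integral_nonneg fun t => norm_nonneg _) (fun j => ?_)
      (summable_abs_al (1 - l) (norm_nonneg w) hw)
    have e : (fun t : ℝ => ‖(al (1 - l) j : ℂ) * ((t : ℂ) * w) ^ j‖) =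
        fun t : ℝ => |al (1 - l) j| * ‖w‖ ^ j * |t| ^ j := by
      ext t; simp [mul_pow]; ring
    rw [e, integral_const_mul]
    refine mul_le_of_le_one_right (by positivity) ?_
    have h1 : ∫ t : ℝ, |t| ^ j ∂μ = ∫ t : ℝ, t ^ j ∂μ :=
      integral_congr_ae (hs.mono fun t ht => by simp only [abs_of_pos ht.1])
    rw [h1, ← hrr]
    exact rr_le_one hl k j

open MeasureTheory in
-- For l > 1 the series in absolute values would lose too much. In Euler's integral the exponent l -
-- 1 is positive and |1 - tw| ≤ 1 + r.
theorem norm_hyp_le_of_one_lt {l : ℝ} (hl : 1 < l) (k : ℕ) {w : ℂ} {r : ℝ} (hr : r < 1)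
    (hw : ‖w‖ ≤ r) : ‖hyp l k w‖ ≤ (1 + r) ^ (l - 1) := by
  obtain ⟨μ, hμ, hs, h⟩ := exists_hyp_eq_integral (by linarith : 0 < l) k
  rw [h w (hw.trans_lt hr)]
  refine (norm_integral_le_of_norm_le_const (C := (1 + r) ^ (l - 1)) (hs.mono fun t ht => ?_)).trans
    (by simp)
  rw [Complex.norm_cpow_real]
  refine Real.rpow_le_rpow (norm_nonneg _) ?_ (by linarith)
  refine (norm_sub_le _ _).trans ?_
  rw [norm_one, norm_mul, Complex.norm_real, Real.norm_of_nonneg ht.1.le]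
  nlinarith [ht.1, ht.2, norm_nonneg w]

open MeasureTheory in
/-- For real argument in `[0, 1)` and positive parameter the hypergeometric factor is real and
bounded below, uniformly in the degree. -/
theorem exists_hyp_ofReal {l : ℝ} (hl : 0 < l) {w : ℝ} (hw0 : 0 ≤ w) (hw : w < 1) :
    ∃ c : ℝ, 0 < c ∧ ∀ k, ∃ y : ℝ, c ≤ y ∧ hyp l k w = y := by
  refine ⟨min 1 ((1 - w) ^ (l - 1)), lt_min one_pos (Real.rpow_pos_of_pos (by linarith) _),
    fun k => ?_⟩
  obtain ⟨μ, hμ, hs, h⟩ := exists_hyp_eq_integral hl k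
  have hb : ∀ t ∈ Ioo (0 : ℝ) 1, min 1 ((1 - w) ^ (l - 1)) ≤ (1 - t * w) ^ (l - 1) ∧
      (1 - t * w) ^ (l - 1) ≤ max 1 ((1 - w) ^ (l - 1)) := by
    intro t ht
    have h1 : 1 - w ≤ 1 - t * w := by nlinarith [ht.2]
    have h2 : 1 - t * w ≤ 1 := by nlinarith [ht.1]
    rcases le_total 1 l with h' | h'
    · refine ⟨(min_le_right _ _).trans (Real.rpow_le_rpow (by linarith) h1 (by linarith)),
        le_max_of_le_left (Real.rpow_le_one (by linarith) h2 (by linarith))⟩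
    · refine ⟨(min_le_left _ _).trans (Real.one_le_rpow_of_pos_of_le_one_of_nonpos (by linarith) h2
        (by linarith)), le_max_of_le_right
          (Real.rpow_le_rpow_of_nonpos (by linarith) h1 (by linarith))⟩
  have hm : Measurable fun t : ℝ => (1 - t * w) ^ (l - 1) := by fun_prop
  refine ⟨∫ t, (1 - t * w) ^ (l - 1) ∂μ, ?_, ?_⟩
  · have hint : Integrable (fun t : ℝ => (1 - t * w) ^ (l - 1)) μ :=
      Integrable.of_bound hm.aestronglyMeasurable (max 1 ((1 - w) ^ (l - 1)))
        (hs.mono fun t ht => by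
          rw [Real.norm_of_nonneg (Real.rpow_nonneg (by nlinarith [ht.1, ht.2]) _)]
          exact (hb t ht).2)
    have := integral_mono_ae (integrable_const (μ := μ) (min 1 ((1 - w) ^ (l - 1)))) hint
      (hs.mono fun t ht => (hb t ht).1)
    simpa using this
  · rw [h w (by simpa [abs_of_nonneg hw0] using hw), ← integral_complex_ofReal]
    refine integral_congr_ae (hs.mono fun t ht => ?_)
    have : 0 ≤ 1 - t * w := by nlinarith [ht.1, ht.2]
    simp only
    rw [Complex.ofReal_cpow this]
    simp

/-- All terms are positive and the term j = 0 is 1; the terms decrease in k with `rr`. The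
monotonicity serves the alternating series in `exists_le_norm_err_zero`. -/
theorem hyp_ofReal_of_neg {l : ℝ} (hl : -1 / 2 < l) (h0 : l < 0) {w : ℝ} (hw0 : 0 ≤ w)
    (hw : w < 1) : ∃ y : ℕ → ℝ, Antitone y ∧ (∀ k, 1 ≤ y k) ∧ ∀ k, hyp l k w = y k := by
  have hpos : ∀ k j, 0 < rr l k j * al (1 - l) j := fun k j =>
    mul_pos (rr_pos (by linarith) k j) (al_pos (by linarith) j)
  have hw' : ‖(w : ℂ)‖ < 1 := by simpa [abs_of_nonneg hw0] using hw
  have hsum : ∀ k, Summable fun j => rr l k j * al (1 - l) j * w ^ j := by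
    intro k
    have := (hasSum_hyp hl h0.ne k hw').summable
    exact_mod_cast this
  refine ⟨fun k => ∑' j, rr l k j * al (1 - l) j * w ^ j, fun k k' hk => ?_, fun k => ?_,
    fun k => ?_⟩
  · refine (hsum k').tsum_le_tsum (fun j => ?_) (hsum k)
    have := rr_antitone (by linarith) h0 j hk
    have h1 := (al_pos (by linarith : 0 < 1 - l) j).le
    have h2 := pow_nonneg hw0 j
    simp only at this
    gcongr
  · have := (hsum k).le_tsum 0 (fun j _ => mul_nonneg (hpos k j).le (pow_nonneg hw0 j))
    simpa using this
  · rw [hyp]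
    push_cast
    rfl

end Gegenbauer

namespace Gegenbauer

/-! ### From Chebyshev series to Gegenbauer series -/

/-- Polynomial growth of 1/|(l)_k/k!|, phrased through another binomial coefficient so that
summability follows from the binomial series. -/
theorem exists_inv_abs_al_le {l : ℝ} (hl : -1 / 2 < l) (h0 : l ≠ 0) :
    ∃ A : ℝ, 0 < A ∧ ∀ k, |al l k|⁻¹ ≤ A * al (|l| + 2) k := by
  obtain ⟨m, _, hm, _, h1⟩ := exists_abs_al_bounds hl h0
  have ha : 0 < |l| + 2 := by positivity
  obtain ⟨m', _, hm', _, h2⟩ := exists_abs_al_bounds (a := |l| + 2) (by linarith) ha.ne'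
  refine ⟨max 1 ((m * m')⁻¹), by positivity, fun k => ?_⟩
  rcases Nat.eq_zero_or_pos k with rfl | hk
  · simp
  have hk1 : (1 : ℝ) ≤ k := by exact_mod_cast hk
  have hk0 : (0 : ℝ) < k := by linarith
  have p1 := Real.rpow_pos_of_pos hk0 (l - 1)
  have e1 := (h1 k hk).1
  have e2 := (h2 k hk).1
  rw [abs_of_pos (al_pos ha k)] at e2
  have e3 : ((k : ℝ) ^ (l - 1))⁻¹ ≤ (k : ℝ) ^ (|l| + 2 - 1) := by
    rw [← Real.rpow_neg hk0.le]
    exact Real.rpow_le_rpow_of_exponent_le hk1 (by linarith [neg_abs_le l])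
  calc |al l k|⁻¹ ≤ (m * (k : ℝ) ^ (l - 1))⁻¹ := by gcongr
    _ = m⁻¹ * ((k : ℝ) ^ (l - 1))⁻¹ := by rw [mul_inv]
    _ ≤ m⁻¹ * (m'⁻¹ * al (|l| + 2) k) := by
        gcongr
        refine e3.trans ?_
        rw [← div_eq_inv_mul, le_div_iff₀ hm']
        linarith
    _ = (m * m')⁻¹ * al (|l| + 2) k := by rw [mul_inv]; ring
    _ ≤ _ := mul_le_mul_of_nonneg_right (le_max_right _ _) (al_pos ha k).le

theorem summable_inv_al_mul_absSum {l : ℝ} (hl : -1 / 2 < l) (h0 : l ≠ 0) {q : ℝ} (hq0 : 0 ≤ q)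
    (hq : q < 1) : Summable fun k => q ^ k * |al l k|⁻¹ * absSum l k := by
  obtain ⟨A, hA, h⟩ := exists_inv_abs_al_le hl h0
  have hs0 := Real.sqrt_nonneg q
  have hs1 : √q < 1 := by rw [Real.sqrt_lt' one_pos]; simpa using hq
  have h1 : Summable fun k => A * (al (|l| + 2) k * √q ^ k) :=
    ((hasSum_al_real (|l| + 2) (w := √q) (by rwa [abs_of_nonneg hs0])).summable).mul_left A
  have h2 := summable_absSum l hs0 hs1
  have hn1 : ∀ k, 0 ≤ A * (al (|l| + 2) k * √q ^ k) := fun k =>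
    mul_nonneg hA.le (mul_nonneg (al_pos (by positivity) k).le (by positivity))
  have hn2 : ∀ k, 0 ≤ absSum l k * √q ^ k := fun k => mul_nonneg (absSum_nonneg l k) (by positivity)
  refine Summable.of_nonneg_of_le (fun k => mul_nonneg (by positivity) (absSum_nonneg l k))
    (fun k => ?_) (h1.mul_right (∑' k, absSum l k * √q ^ k))
  -- One factor √q^k makes 1/|al| summable, the other makes `absSum` summable.
  have e : q ^ k = √q ^ k * √q ^ k := by rw [← mul_pow, Real.mul_self_sqrt hq0]
  calc q ^ k * |al l k|⁻¹ * absSum l k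
      = (|al l k|⁻¹ * √q ^ k) * (absSum l k * √q ^ k) := by rw [e]; ring
    _ ≤ (A * (al (|l| + 2) k * √q ^ k)) * (absSum l k * √q ^ k) := by
        refine mul_le_mul_of_nonneg_right ?_ (hn2 k)
        rw [← mul_assoc]
        exact mul_le_mul_of_nonneg_right (h k) (by positivity)
    _ ≤ _ := mul_le_mul_of_nonneg_left (h2.le_tsum k fun j _ => hn2 j) (hn1 k)

/-- The `k`-th Gegenbauer coefficient of `∑ β_m U_m`. -/
def acoef (l : ℝ) (β : ℕ → ℂ) (k : ℕ) : ℂ := ∑' j, β (k + 2 * j) * (conn l k j : ℂ)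

theorem coeff_const_mul (l : ℝ) (k : ℕ) (c : ℂ) (g : ℝ → ℂ) :
    coeff l (fun x => c * g x) k = c * coeff l g k := by
  unfold coeff
  rw [← mul_div_assoc, ← intervalIntegral.integral_const_mul]
  congr 2
  ext x; ring

section

variable {l : ℝ} {β : ℕ → ℂ} {B q : ℝ}

theorem norm_conn_le (hl : -1 / 2 < l) (h0 : l ≠ 0) (k j : ℕ) :
    ‖(conn l k j : ℂ)‖ ≤ |al l k|⁻¹ * maj l j := by
  rw [Complex.norm_real, Real.norm_eq_abs, conn_eq (by linarith) h0, abs_mul, abs_inv]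
  exact mul_le_mul_of_nonneg_left (abs_rr_mul_al_le hl h0 k j) (by positivity)

theorem norm_term_le (hl : -1 / 2 < l) (h0 : l ≠ 0)
    (hβ : ∀ m, ‖β m‖ ≤ B * q ^ m) (k j : ℕ) :
    ‖β (k + 2 * j) * (conn l k j : ℂ)‖ ≤ B * (q ^ k * |al l k|⁻¹) * (maj l j * (q ^ 2) ^ j) := by
  rw [norm_mul]
  calc _ ≤ (B * q ^ (k + 2 * j)) * (|al l k|⁻¹ * maj l j) :=
        mul_le_mul (hβ _) (norm_conn_le hl h0 k j) (norm_nonneg _) ((norm_nonneg _).trans (hβ _))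
    _ = _ := by rw [pow_add, pow_mul]; ring

theorem hasSum_acoef (hl : -1 / 2 < l) (h0 : l ≠ 0) (hq0 : 0 ≤ q) (hq : q < 1)
    (hβ : ∀ m, ‖β m‖ ≤ B * q ^ m) (k : ℕ) :
    HasSum (fun j => β (k + 2 * j) * (conn l k j : ℂ)) (acoef l β k) :=
  (Summable.of_norm_bounded ((summable_maj l (by positivity) (by nlinarith : q ^ 2 < 1)).mul_left _)
    (norm_term_le hl h0 hβ k)).hasSum

open Polynomial.Chebyshev in
-- The rearrangement from Chebyshev to Gegenbauer series: geometric decay of β makes the family over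
-- (k, j) absolutely summable uniformly on [-1, 1], and its sum over the fibre k + 2j = m is β_m
-- U_m. The majorant b is what permits termwise integration later.
theorem hasSum_pairs (hl : -1 / 2 < l) (h0 : l ≠ 0) (hq0 : 0 ≤ q) (hq : q < 1)
    (hβ : ∀ m, ‖β m‖ ≤ B * q ^ m) :
    ∃ b : ℕ × ℕ → ℝ, Summable b ∧
      (∀ p : ℕ × ℕ, ∀ x ∈ Icc (-1 : ℝ) 1,
        ‖β (p.1 + 2 * p.2) * (conn l p.1 p.2 : ℂ) * (poly l p.1 x : ℂ)‖ ≤ b p) ∧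
      ∀ x ∈ Icc (-1 : ℝ) 1, ∀ y : ℂ, HasSum (fun m : ℕ => β m * ((U ℝ m).eval x : ℝ)) y →
        HasSum (fun p : ℕ × ℕ => β (p.1 + 2 * p.2) * (conn l p.1 p.2 : ℂ) * (poly l p.1 x : ℂ)) y := by
  have hB : 0 ≤ B := by simpa using (norm_nonneg _).trans (hβ 0)
  have hs1 := (summable_inv_al_mul_absSum hl h0 hq0 hq).mul_left B
  have hs2 := summable_maj l (w := q ^ 2) (by positivity) (by nlinarith : q ^ 2 < 1)
  have hb := hs1.mul_of_nonneg hs2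
    (fun k => mul_nonneg hB (mul_nonneg (by positivity) (absSum_nonneg l k)))
    (fun j => mul_nonneg (maj_nonneg hl j) (by positivity))
  refine ⟨_, hb, fun p x hx => ?_, fun x hx y hy => ?_⟩
  · rw [norm_mul, Complex.norm_real, Real.norm_eq_abs]
    calc _ ≤ (B * (q ^ p.1 * |al l p.1|⁻¹) * (maj l p.2 * (q ^ 2) ^ p.2)) * absSum l p.1 :=
          mul_le_mul (norm_term_le hl h0 hβ _ _) (abs_poly_le_absSum hl _ hx) (abs_nonneg _)
            ((norm_nonneg _).trans (norm_term_le hl h0 hβ _ _))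
      _ = _ := by ring
  · have hsum : Summable fun p : ℕ × ℕ =>
        β (p.1 + 2 * p.2) * (conn l p.1 p.2 : ℂ) * (poly l p.1 x : ℂ) := by
      refine Summable.of_norm_bounded hb fun p => ?_
      rw [norm_mul, Complex.norm_real, Real.norm_eq_abs]
      calc _ ≤ (B * (q ^ p.1 * |al l p.1|⁻¹) * (maj l p.2 * (q ^ 2) ^ p.2)) * absSum l p.1 :=
            mul_le_mul (norm_term_le hl h0 hβ _ _) (abs_poly_le_absSum hl _ hx) (abs_nonneg _)
              ((norm_nonneg _).trans (norm_term_le hl h0 hβ _ _))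
        _ = _ := by ring
    -- The same family indexed by (m, j) with m = k + 2j, extended by zero, so that the fibres over
    -- m are rows.
    set g : ℕ × ℕ → ℂ := fun p => if 2 * p.2 ≤ p.1 then
      β p.1 * (conn l (p.1 - 2 * p.2) p.2 : ℂ) * (poly l (p.1 - 2 * p.2) x : ℂ) else 0 with hg
    set i : ℕ × ℕ → ℕ × ℕ := fun p => (p.1 + 2 * p.2, p.2) with hi
    have hinj : Function.Injective i := by
      rintro ⟨a, b⟩ ⟨c, d⟩ h
      simp only [hi, Prod.mk.injEq] at h ⊢
      omega
    have hoff : ∀ p ∉ range i, g p = 0 := by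
      rintro ⟨m, j⟩ hp
      simp only [hg]
      rw [if_neg]
      intro hle
      exact hp ⟨(m - 2 * j, j), Prod.ext (Nat.sub_add_cancel hle) rfl⟩
    have hcomp : g ∘ i = fun p : ℕ × ℕ =>
        β (p.1 + 2 * p.2) * (conn l p.1 p.2 : ℂ) * (poly l p.1 x : ℂ) := by
      ext p; simp [hg, hi]
    obtain ⟨s, hs⟩ := hsum
    have hgs : HasSum g s := by
      rw [← hinj.hasSum_iff hoff, hcomp]; exact hs
    have hfib : ∀ m, HasSum (fun j => g (m, j)) (β m * ((U ℝ m).eval x : ℝ)) := by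
      intro m
      have e : β m * (((U ℝ m).eval x : ℝ) : ℂ) = ∑ j ∈ Finset.range (m + 1), g (m, j) := by
        rw [U_eq_sum_econn hl h0, Complex.ofReal_sum, Finset.mul_sum]
        refine Finset.sum_congr rfl fun j _ => ?_
        simp only [hg]
        split_ifs with hj
        · obtain ⟨k, rfl⟩ := Nat.exists_eq_add_of_le' hj
          have hz : zpoly l (((k + 2 * j : ℕ) : ℤ) - 2 * j) x = poly l k x := by
            rw [← zpoly_natCast]; congr 1; push_cast; ring
          rw [hz, Nat.add_sub_cancel, ← econn_eq_conn]
          push_cast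
          ring
        · rw [zpoly_of_neg l (by omega)]; simp
      rw [e]
      refine hasSum_sum_of_ne_finset_zero fun j hj => ?_
      simp only [hg]
      rw [if_neg]
      simp at hj
      omega
    have := (hgs.prod_fiberwise hfib).unique hy
    exact this ▸ hs

open Polynomial.Chebyshev in
-- Applying the coefficient functional to the double series termwise, orthogonality leaves only the
-- pairs (k, j) with the given k.
theorem coeff_eq_acoef (hl : -1 / 2 < l) (h0 : l ≠ 0) (hq0 : 0 ≤ q) (hq : q < 1)
    (hβ : ∀ m, ‖β m‖ ≤ B * q ^ m) {g : ℝ → ℂ}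
    (hg : ∀ x ∈ Icc (-1 : ℝ) 1, HasSum (fun m : ℕ => β m * ((U ℝ m).eval x : ℝ)) (g x)) (k : ℕ) :
    coeff l g k = acoef l β k := by
  obtain ⟨b, hb, hle, hs⟩ := hasSum_pairs hl h0 hq0 hq hβ
  have h := coeff_hasSum hl k (F := fun (p : ℕ × ℕ) x =>
    β (p.1 + 2 * p.2) * (conn l p.1 p.2 : ℂ) * (poly l p.1 x : ℂ))
    (fun p => continuous_const.mul (Complex.continuous_ofReal.comp (continuous_poly l p.1)))
    hb hle fun x hx => hs x hx _ (hg x hx)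
  simp only [coeff_const_mul, coeff_poly hl h0] at h
  have hinj : Function.Injective fun j : ℕ => (k, j) := fun a b h => (Prod.mk.inj h).2
  have h2 := (hinj.hasSum_iff (fun p hp => ?_)).mpr h
  · have e : ((fun p : ℕ × ℕ => β (p.1 + 2 * p.2) * (conn l p.1 p.2 : ℂ) *
        (if p.1 = k then 1 else 0)) ∘ fun j => (k, j)) =
        fun j => β (k + 2 * j) * (conn l k j : ℂ) := by
      ext j; simp
    rw [e] at h2
    exact h2.unique (hasSum_acoef hl h0 hq0 hq hβ k)
  · rw [if_neg, mul_zero]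
    rintro rfl
    exact hp ⟨p.2, rfl⟩

open Polynomial.Chebyshev in
/-- The error of the Gegenbauer projection is the tail of the Gegenbauer series. -/
theorem hasSum_err (hl : -1 / 2 < l) (h0 : l ≠ 0) (hq0 : 0 ≤ q) (hq : q < 1)
    (hβ : ∀ m, ‖β m‖ ≤ B * q ^ m) {g : ℝ → ℂ}
    (hg : ∀ x ∈ Icc (-1 : ℝ) 1, HasSum (fun m : ℕ => β m * ((U ℝ m).eval x : ℝ)) (g x)) (n : ℕ)
    {x : ℝ} (hx : x ∈ Icc (-1 : ℝ) 1) :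
    HasSum (fun i => acoef l β (i + (n + 1)) * (poly l (i + (n + 1)) x : ℂ))
      (g x - proj l n g x) := by
  obtain ⟨b, hb, hle, hs⟩ := hasSum_pairs hl h0 hq0 hq hβ
  have h := (hs x hx _ (hg x hx)).prod_fiberwise
    (g := fun k => acoef l β k * (poly l k x : ℂ))
    fun k => (hasSum_acoef hl h0 hq0 hq hβ k).mul_right _
  have e : proj l n g x = ∑ k ∈ Finset.range (n + 1), acoef l β k * (poly l k x : ℂ) :=
    Finset.sum_congr rfl fun k _ => by rw [coeff_eq_acoef hl h0 hq0 hq hβ hg]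
  rw [e]
  exact (hasSum_nat_add_iff' (n + 1)).mpr h

end

end Gegenbauer

namespace Gegenbauer

/-! ### The Joukowski map on an annulus -/

/-- Both differences are squares, (u ∓ 1)²/(2u), so the sum of their moduli is given by the
parallelogram law. -/
theorem norm_joukowski_sub_add {u : ℂ} (hu : u ≠ 0) :
    ‖joukowski u - 1‖ + ‖joukowski u + 1‖ = ‖u‖ + ‖u‖⁻¹ := by
  have hn : ‖u‖ ≠ 0 := norm_ne_zero_iff.mpr hu
  have e1 : joukowski u - 1 = (u - 1) ^ 2 / (2 * u) := by
    unfold joukowski; field_simp; ring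
  have e2 : joukowski u + 1 = (u + 1) ^ 2 / (2 * u) := by
    unfold joukowski; field_simp; ring
  have h := parallelogram_law_with_norm ℝ u 1
  simp only [norm_one] at h
  rw [e1, e2]
  simp only [norm_div, norm_pow, norm_mul, Complex.norm_ofNat]
  field_simp
  nlinarith [h]

theorem add_inv_strictMono {a b : ℝ} (ha : 1 ≤ a) (hab : a < b) : a + a⁻¹ < b + b⁻¹ := by
  have h1 : 0 < a := by linarith
  have h2 : 0 < b := by linarith
  have h3 : 1 < a * b := by nlinarith
  have e : b + b⁻¹ - (a + a⁻¹) = (b - a) * (a * b - 1) / (a * b) := by field_simp; ring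
  have : 0 < (b - a) * (a * b - 1) / (a * b) :=
    div_pos (mul_pos (by linarith) (by linarith)) (by positivity)
  linarith

variable {f : ℂ → ℂ} {ρ : ℝ}

theorem ne_zero_of_one_le_norm {u : ℂ} (h : 1 ≤ ‖u‖) : u ≠ 0 :=
  norm_pos_iff.mp (by linarith)

theorem joukowski_mem_region {u : ℂ} (h1 : 1 ≤ ‖u‖) (h2 : ‖u‖ < ρ) :
    joukowski u ∈ region ρ := by
  rw [region, mem_ofPred_eq, norm_joukowski_sub_add (ne_zero_of_one_le_norm h1)]
  exact add_inv_strictMono h1 h2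

theorem continuousAt_joukowski {u : ℂ} (hu : u ≠ 0) : ContinuousAt joukowski u := by
  unfold joukowski
  exact (continuousAt_id.add (continuousAt_inv₀ hu)).div_const 2

theorem joukowski_mem_closure (hρ : 1 < ρ) {u : ℂ} (h1 : 1 ≤ ‖u‖) (h2 : ‖u‖ ≤ ρ) :
    joukowski u ∈ closure (region ρ) := by
  rcases h2.lt_or_eq with h2 | h2
  · exact subset_closure (joukowski_mem_region h1 h2)
  have hu := ne_zero_of_one_le_norm h1
  -- Radial approach from inside; the restriction t > 1/ρ keeps t u outside the unit disc.
  have ht : Tendsto (fun t : ℝ => (t : ℂ) * u) (𝓝[<] 1) (𝓝 u) := by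
    have : Continuous fun t : ℝ => (t : ℂ) * u := by fun_prop
    simpa using (this.tendsto 1).mono_left nhdsWithin_le_nhds
  refine mem_closure_of_tendsto ((continuousAt_joukowski hu).tendsto.comp ht) ?_
  have h3 : ∀ᶠ t : ℝ in 𝓝[<] 1, ρ⁻¹ < t :=
    (eventually_gt_nhds (inv_lt_one_of_one_lt₀ hρ)).filter_mono nhdsWithin_le_nhds
  filter_upwards [h3, self_mem_nhdsWithin] with t ht1 ht2
  have hρ0 : 0 < ρ := by linarith
  have ht0 : 0 < t := (inv_pos.mpr hρ0).trans ht1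
  have e : ‖(t : ℂ) * u‖ = t * ρ := by
    rw [norm_mul, Complex.norm_real, Real.norm_of_nonneg ht0.le, h2]
  refine joukowski_mem_region ?_ ?_
  · rw [e]
    have := (inv_mul_lt_iff₀ hρ0).mp (by simpa using ht1 : ρ⁻¹ * 1 < t)
    linarith
  · rw [e]
    have : t < 1 := ht2
    nlinarith

theorem isOpen_region (ρ : ℝ) : IsOpen (region ρ) := by
  have : Continuous fun z : ℂ => ‖z - 1‖ + ‖z + 1‖ := by fun_prop
  exact this.isOpen_preimage _ isOpen_Iio

theorem continuousOn_comp_joukowski (hf : DiffContOnCl ℂ f (region ρ)) (hρ : 1 < ρ) :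
    ContinuousOn (fun u => f (joukowski u)) (Metric.closedBall 0 ρ \ Metric.ball 0 1) := by
  refine hf.continuousOn.comp (fun u hu => ?_) fun u hu => ?_
  · simp only [Set.mem_sdiff, mem_closedBall_zero_iff, mem_ball_zero_iff, not_lt] at hu
    exact (continuousAt_joukowski (ne_zero_of_one_le_norm hu.2)).continuousWithinAt
  · simp only [Set.mem_sdiff, mem_closedBall_zero_iff, mem_ball_zero_iff, not_lt] at hu
    exact joukowski_mem_closure hρ hu.2 hu.1

theorem differentiableAt_comp_joukowski (hf : DiffContOnCl ℂ f (region ρ)) {u : ℂ}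
    (hu : u ∈ Metric.ball (0 : ℂ) ρ \ Metric.closedBall 0 1) :
    DifferentiableAt ℂ (fun u => f (joukowski u)) u := by
  simp only [Set.mem_sdiff, mem_closedBall_zero_iff, mem_ball_zero_iff, not_le] at hu
  have h0 := ne_zero_of_one_le_norm hu.2.le
  have h1 : DifferentiableAt ℂ f (joukowski u) :=
    hf.differentiableAt (isOpen_region ρ) (joukowski_mem_region hu.2.le hu.1)
  have h2 : DifferentiableAt ℂ joukowski u := by
    unfold joukowski
    exact (differentiableAt_id.add (differentiableAt_inv h0)).div_const 2
  exact h1.comp u h2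

theorem integral_circleMap_eq (hρ : 1 < ρ) {F : ℂ → ℂ}
    (hc : ContinuousOn F (Metric.closedBall 0 ρ \ Metric.ball 0 1))
    (hd : ∀ u ∈ Metric.ball (0 : ℂ) ρ \ Metric.closedBall 0 1, DifferentiableAt ℂ F u) :
    ∫ θ in (0 : ℝ)..2 * Real.pi, F (circleMap 0 ρ θ) =
      ∫ θ in (0 : ℝ)..2 * Real.pi, F (circleMap 0 1 θ) := by
  have h := Complex.circleIntegral_sub_center_inv_smul_eq_of_differentiable_on_annulus_off_countable
    (c := 0) one_pos hρ.le (f := F) (s := ∅) countable_empty hc (fun z hz => hd z hz.1)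
  have key : ∀ R : ℝ, R ≠ 0 → circleIntegral (fun z => (z - 0)⁻¹ • F z) 0 R =
      Complex.I * ∫ θ in (0 : ℝ)..2 * Real.pi, F (circleMap 0 R θ) := by
    intro R hR
    rw [circleIntegral, ← intervalIntegral.integral_const_mul]
    refine intervalIntegral.integral_congr fun θ _ => ?_
    have : circleMap 0 R θ ≠ 0 := circleMap_ne_center hR
    simp only [deriv_circleMap, smul_eq_mul, sub_zero]
    field_simp
  rw [key ρ (by linarith), key 1 one_ne_zero] at h
  exact mul_left_cancel₀ Complex.I_ne_zero h

/-! ### Laurent coefficients -/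

/-- The Laurent coefficient of `f ∘ joukowski`. -/
def lcoef (f : ℂ → ℂ) (ρ : ℝ) (m : ℕ) : ℂ :=
  (2 * Real.pi : ℂ)⁻¹ * ∫ θ in (0 : ℝ)..2 * Real.pi,
    f (joukowski (circleMap 0 ρ θ)) * (circleMap 0 ρ θ)⁻¹ ^ m

/-- Shift of contour: on |u| = ρ the coefficient visibly decays like ρ⁻ᵐ, on |u| = 1 it is a Fourier
coefficient of f(cos θ). -/
theorem lcoef_eq (hf : DiffContOnCl ℂ f (region ρ)) (hρ : 1 < ρ) (m : ℕ) :
    lcoef f ρ m = lcoef f 1 m := by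
  unfold lcoef
  congr 1
  refine integral_circleMap_eq hρ (F := fun u => f (joukowski u) * u⁻¹ ^ m) ?_ ?_
  · refine (continuousOn_comp_joukowski hf hρ).mul ?_
    refine ContinuousOn.pow (continuousOn_inv₀.mono fun u hu => ?_) m
    simp only [Set.mem_sdiff, mem_closedBall_zero_iff, mem_ball_zero_iff, not_lt] at hu
    exact ne_zero_of_one_le_norm hu.2
  · intro u hu
    refine (differentiableAt_comp_joukowski hf hu).mul ?_
    simp only [Set.mem_sdiff, mem_closedBall_zero_iff, mem_ball_zero_iff, not_le] at hu
    exact (differentiableAt_inv (ne_zero_of_one_le_norm hu.2.le)).pow m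

theorem ellipse_eq_image (ρ : ℝ) : ellipse ρ = joukowski '' Metric.sphere 0 ρ := by
  ext z
  simp only [ellipse, mem_ofPred_eq, mem_image, mem_sphere_zero_iff_norm]
  exact ⟨fun ⟨u, h1, h2⟩ => ⟨u, h1, h2.symm⟩, fun ⟨u, h1, h2⟩ => ⟨u, h1, h2.symm⟩⟩

theorem norm_le_maxOn (hf : DiffContOnCl ℂ f (region ρ)) (hρ : 1 < ρ) {u : ℂ} (hu : ‖u‖ = ρ) :
    ‖f (joukowski u)‖ ≤ maxOn f ρ := by
  refine le_csSup ?_ ⟨_, ⟨u, hu, rfl⟩, rfl⟩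
  have hsub : Metric.sphere (0 : ℂ) ρ ⊆ Metric.closedBall 0 ρ \ Metric.ball 0 1 := by
    intro v hv
    rw [mem_sphere_zero_iff_norm] at hv
    simp only [Set.mem_sdiff, mem_closedBall_zero_iff, mem_ball_zero_iff, not_lt]
    exact ⟨hv.le, by linarith⟩
  have := (isCompact_sphere (0 : ℂ) ρ).bddAbove_image
    ((continuousOn_comp_joukowski hf hρ).mono hsub).norm
  rw [ellipse_eq_image, image_image]
  exact this

theorem maxOn_nonneg (f : ℂ → ℂ) (ρ : ℝ) : 0 ≤ maxOn f ρ := by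
  refine Real.sSup_nonneg ?_
  rintro _ ⟨z, -, rfl⟩
  exact norm_nonneg _

theorem norm_circleMap (hρ : 1 < ρ) (θ : ℝ) : ‖circleMap 0 ρ θ‖ = ρ := by
  rw [norm_circleMap_zero, abs_of_pos (by linarith)]

theorem continuous_comp_circleMap (hf : DiffContOnCl ℂ f (region ρ)) (hρ : 1 < ρ) :
    Continuous fun θ => f (joukowski (circleMap 0 ρ θ)) := by
  refine (continuousOn_comp_joukowski hf hρ).comp_continuous (continuous_circleMap 0 ρ) fun θ => ?_
  simp only [Set.mem_sdiff, mem_closedBall_zero_iff, mem_ball_zero_iff, not_lt, norm_circleMap hρ]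
  exact ⟨le_rfl, hρ.le⟩

theorem continuous_circleMap_inv (hρ : 1 < ρ) : Continuous fun θ => (circleMap 0 ρ θ)⁻¹ :=
  (continuous_circleMap 0 ρ).inv₀ fun θ => circleMap_ne_center (by linarith)

theorem norm_lcoef_le (hf : DiffContOnCl ℂ f (region ρ)) (hρ : 1 < ρ) (m : ℕ) :
    ‖lcoef f ρ m‖ ≤ maxOn f ρ * ρ⁻¹ ^ m := by
  rw [lcoef, norm_mul]
  have h := intervalIntegral.norm_integral_le_of_norm_le_const (a := 0) (b := 2 * Real.pi)
    (f := fun θ => f (joukowski (circleMap 0 ρ θ)) * (circleMap 0 ρ θ)⁻¹ ^ m)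
    (C := maxOn f ρ * ρ⁻¹ ^ m) fun θ _ => by
      rw [norm_mul, norm_pow, norm_inv, norm_circleMap hρ]
      have : 0 ≤ ρ⁻¹ := inv_nonneg.mpr (by linarith)
      exact mul_le_mul_of_nonneg_right (norm_le_maxOn hf hρ (norm_circleMap hρ θ)) (by positivity)
  have hp : 0 < 2 * Real.pi := Real.two_pi_pos
  rw [sub_zero, abs_of_pos hp] at h
  have e : ‖(2 * Real.pi : ℂ)⁻¹‖ = (2 * Real.pi)⁻¹ := by
    rw [norm_inv, norm_mul, Complex.norm_real, Real.norm_of_nonneg Real.pi_pos.le]; simp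
  rw [e, inv_mul_le_iff₀ hp]
  linarith


end Gegenbauer

namespace Gegenbauer

variable {f : ℂ → ℂ} {ρ : ℝ}

/-! ### The Chebyshev expansion -/

theorem joukowski_circleMap_one (θ : ℝ) : joukowski (circleMap 0 1 θ) = (Real.cos θ : ℂ) := by
  rw [circleMap_zero, joukowski, Complex.ofReal_one, one_mul, ← Complex.exp_neg,
    Complex.ofReal_cos, Complex.cos, neg_mul]

theorem lcoef_one (f : ℂ → ℂ) (m : ℕ) : lcoef f 1 m = (2 * Real.pi : ℂ)⁻¹ *
    ∫ θ in (0 : ℝ)..2 * Real.pi, f (Real.cos θ) * Complex.exp (-(m * (θ * Complex.I))) := by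
  unfold lcoef
  congr 2
  ext θ
  rw [joukowski_circleMap_one, circleMap_zero, Complex.ofReal_one, one_mul, ← Complex.exp_neg,
    ← Complex.exp_nat_mul, mul_neg]

theorem continuous_comp_cos (hf : DiffContOnCl ℂ f (region ρ)) (hρ : 1 < ρ) :
    Continuous fun θ : Real.Angle => f (Real.Angle.cos θ : ℝ) := by
  refine hf.continuousOn.comp_continuous
    (Complex.continuous_ofReal.comp Real.Angle.continuous_cos) fun θ => ?_
  induction θ using Real.Angle.induction_on with
  | _ θ =>
    rw [Real.Angle.cos_coe, ← joukowski_circleMap_one]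
    have : ‖circleMap 0 1 θ‖ = 1 := by simp
    exact subset_closure (joukowski_mem_region this.ge (by rw [this]; exact hρ))

open Polynomial.Chebyshev in
-- The Fourier series of the even function f(cos θ), with the terms of index m and -m paired. The
-- pairing counts the term of index 0 twice, hence the extra `lcoef f ρ 0` in the sum.
theorem hasSum_lcoef_T (hf : DiffContOnCl ℂ f (region ρ)) (hρ : 1 < ρ) {x : ℝ}
    (hx : x ∈ Icc (-1 : ℝ) 1) :
    HasSum (fun m : ℕ => 2 * lcoef f ρ m * ((T ℝ m).eval x : ℝ)) (f x + lcoef f ρ 0) := by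
  have : Fact (0 < 2 * Real.pi) := ⟨Real.two_pi_pos⟩
  set F : C(AddCircle (2 * Real.pi), ℂ) := ⟨_, continuous_comp_cos hf hρ⟩ with hF
  have hFc : ∀ θ : ℝ, F (θ : AddCircle (2 * Real.pi)) = f (Real.cos θ) := fun θ => by
    change f ((Real.Angle.cos (θ : Real.Angle) : ℝ) : ℂ) = _
    rw [Real.Angle.cos_coe]
  have hpi : (Real.pi : ℂ) ≠ 0 := Complex.ofReal_ne_zero.mpr Real.pi_ne_zero
  have hfou : ∀ (n : ℤ) (θ : ℝ), fourier n (θ : AddCircle (2 * Real.pi)) =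
      Complex.exp (n * (θ * Complex.I)) := by
    intro n θ
    rw [fourier_coe_apply]
    congr 1
    push_cast
    field_simp
  have hco : ∀ n : ℤ, fourierCoeff F n = (2 * Real.pi : ℂ)⁻¹ *
      ∫ θ in (0 : ℝ)..2 * Real.pi, f (Real.cos θ) * Complex.exp (-(n * (θ * Complex.I))) := by
    intro n
    rw [fourierCoeff_eq_intervalIntegral F n 0, zero_add, Complex.real_smul]
    congr 1
    · push_cast; rw [one_div]
    · refine intervalIntegral.integral_congr fun θ _ => ?_
      simp only [hfou, hFc, smul_eq_mul]
      rw [mul_comm]; congr 2; push_cast; ring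
  have hpos : ∀ m : ℕ, fourierCoeff F (m : ℤ) = lcoef f ρ m := by
    intro m
    rw [hco, lcoef_eq hf hρ, lcoef_one]
    push_cast; rfl
  have hneg : ∀ m : ℕ, fourierCoeff F (-(m : ℤ)) = lcoef f ρ m := by
    intro m
    rw [hco, lcoef_eq hf hρ, lcoef_one]
    congr 1
    have hper : Function.Periodic (fun θ : ℝ => f (Real.cos θ) *
        Complex.exp (-(m * (θ * Complex.I)))) (2 * Real.pi) := by
      intro θ
      simp only [Real.cos_add_two_pi]
      congr 1
      refine Complex.exp_eq_exp_iff_exists_int.mpr ⟨-m, ?_⟩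
      push_cast; ring
    have h1 := intervalIntegral.integral_comp_sub_left (a := 0) (b := 2 * Real.pi) (fun θ : ℝ =>
      f (Real.cos θ) * Complex.exp (-(m * (θ * Complex.I)))) (2 * Real.pi)
    rw [sub_self, sub_zero] at h1
    rw [← h1]
    refine intervalIntegral.integral_congr fun θ _ => ?_
    have h2 := hper (-θ)
    simp only [Real.cos_neg] at h2
    rw [show -θ + 2 * Real.pi = 2 * Real.pi - θ by ring] at h2
    rw [h2]
    congr 2
    push_cast; ring
  have hρ1 : ρ⁻¹ < 1 := inv_lt_one_of_one_lt₀ hρ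
  have hρ0 : 0 ≤ ρ⁻¹ := inv_nonneg.mpr (by linarith)
  have hsum : Summable fun m => lcoef f ρ m :=
    Summable.of_norm_bounded ((summable_geometric_of_lt_one hρ0 hρ1).mul_left _)
      (norm_lcoef_le hf hρ)
  have hS : Summable (fourierCoeff F) := by
    rw [summable_int_iff_summable_nat_and_neg]
    simp only [hpos, hneg]
    exact ⟨hsum, hsum⟩
  have hx' := Real.cos_arccos hx.1 hx.2
  have h := (has_pointwise_sum_fourier_series_of_summable hS
    (Real.arccos x : AddCircle (2 * Real.pi))).nat_add_neg
  have h0 := hpos 0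
  simp only [Nat.cast_zero] at h0
  simp only [hpos, hneg, hFc, hfou, h0, smul_eq_mul, hx'] at h
  convert! h using 2 with m
  swap
  · simp
  have hT : (T ℝ m).eval x = Real.cos (m * Real.arccos x) := by
    conv_lhs => rw [← hx']
    rw [T_real_cos]; push_cast; rfl
  rw [hT, Complex.ofReal_cos, Complex.cos]
  push_cast
  rw [show (m : ℂ) * (Real.arccos x : ℂ) * Complex.I = m * (Real.arccos x * Complex.I) by ring,
    show -((m : ℂ) * (Real.arccos x : ℂ)) * Complex.I = -m * (Real.arccos x * Complex.I) by ring]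
  ring

open Polynomial.Chebyshev in
theorem abs_eval_U_le (m : ℕ) {x : ℝ} (hx : x ∈ Icc (-1 : ℝ) 1) : |(U ℝ m).eval x| ≤ m + 1 := by
  induction m using Nat.twoStepInduction with
  | zero => simp
  | one =>
    have := abs_le.mpr hx
    simp [abs_mul]; linarith
  | more m ih _ =>
    have h := congrArg (Polynomial.eval x) (U_eq_two_mul_T_add_U ℝ (m : ℤ))
    simp only [Polynomial.eval_add, Polynomial.eval_mul, Polynomial.eval_ofNat] at h
    have hT := abs_eval_T_real_le_one ((m : ℤ) + 2) (abs_le.mpr hx)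
    push_cast
    rw [h]
    refine (abs_add_le _ _).trans ?_
    rw [abs_mul, abs_two]
    linarith

/-- The coefficients of the expansion of `f` in Chebyshev polynomials of the second kind. -/
def ucoef (f : ℂ → ℂ) (ρ : ℝ) (m : ℕ) : ℂ := lcoef f ρ m - lcoef f ρ (m + 2)

theorem norm_ucoef_le (hf : DiffContOnCl ℂ f (region ρ)) (hρ : 1 < ρ) (m : ℕ) :
    ‖ucoef f ρ m‖ ≤ 2 * maxOn f ρ * ρ⁻¹ ^ m := by
  have hρ1 : ρ⁻¹ ≤ 1 := (inv_lt_one_of_one_lt₀ hρ).le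
  have hρ0 : 0 ≤ ρ⁻¹ := inv_nonneg.mpr (by linarith)
  have h1 := norm_lcoef_le hf hρ m
  have h2 := norm_lcoef_le hf hρ (m + 2)
  have h3 : maxOn f ρ * ρ⁻¹ ^ (m + 2) ≤ maxOn f ρ * ρ⁻¹ ^ m :=
    mul_le_mul_of_nonneg_left (pow_le_pow_of_le_one hρ0 hρ1 (by omega)) (maxOn_nonneg f ρ)
  refine (norm_sub_le _ _).trans ?_
  linarith

open Polynomial.Chebyshev in
-- Summation by parts in the series of first kind, using 2 T_{m+2} = U_{m+2} - U_m.
theorem hasSum_ucoef_U (hf : DiffContOnCl ℂ f (region ρ)) (hρ : 1 < ρ) {x : ℝ}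
    (hx : x ∈ Icc (-1 : ℝ) 1) :
    HasSum (fun m : ℕ => ucoef f ρ m * ((U ℝ m).eval x : ℝ)) (f x) := by
  set b := lcoef f ρ
  have hρ1 : ρ⁻¹ < 1 := inv_lt_one_of_one_lt₀ hρ
  have hρ0 : 0 ≤ ρ⁻¹ := inv_nonneg.mpr (by linarith)
  have hsum : Summable fun m : ℕ => b m * ((U ℝ m).eval x : ℝ) := by
    have h1 : Summable fun m : ℕ => maxOn f ρ * (((m : ℝ) + 1) * ρ⁻¹ ^ m) := by
      have a1 := summable_pow_mul_geometric_of_norm_lt_one 1 (r := ρ⁻¹)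
        (by rwa [Real.norm_of_nonneg hρ0])
      have a2 := summable_geometric_of_lt_one hρ0 hρ1
      refine ((a1.add a2).mul_left (maxOn f ρ)).congr fun m => ?_
      ring
    refine Summable.of_norm_bounded h1 fun m => ?_
    rw [norm_mul, Complex.norm_real, Real.norm_eq_abs]
    calc _ ≤ (maxOn f ρ * ρ⁻¹ ^ m) * (m + 1) :=
          mul_le_mul (norm_lcoef_le hf hρ m) (abs_eval_U_le m hx) (abs_nonneg _)
            (mul_nonneg (maxOn_nonneg f ρ) (by positivity))
      _ = _ := by ring
  obtain ⟨s, hs⟩ := hsum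
  have h1 := (hasSum_nat_add_iff' 2).mpr hs
  have h2 := (hasSum_nat_add_iff' 2).mpr (hasSum_lcoef_T hf hρ hx)
  have h3 := hs.sub (h1.sub h2)
  simp only [Finset.sum_range_succ, Finset.sum_range_zero] at h3
  have e1 : (fun m : ℕ => ucoef f ρ m * (((U ℝ m).eval x : ℝ) : ℂ)) = fun m : ℕ =>
      b m * (((U ℝ m).eval x : ℝ) : ℂ) - (b (m + 2) * (((U ℝ (m + 2 : ℕ)).eval x : ℝ) : ℂ) -
        2 * lcoef f ρ (m + 2) * (((T ℝ (m + 2 : ℕ)).eval x : ℝ) : ℂ)) := by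
    ext m
    have h := congrArg (Polynomial.eval x) (U_eq_two_mul_T_add_U ℝ (m : ℤ))
    simp only [Polynomial.eval_add, Polynomial.eval_mul, Polynomial.eval_ofNat] at h
    rw [show ((m + 2 : ℕ) : ℤ) = m + 2 by push_cast; rfl, h, ucoef]
    simp only [Complex.ofReal_add, Complex.ofReal_mul, Complex.ofReal_ofNat, b]
    ring
  rw [e1]
  convert! h3 using 1
  simp only [b, Nat.cast_zero, Nat.cast_one, U_zero, U_one, T_zero, T_one, Polynomial.eval_one,
    Polynomial.eval_X, Polynomial.eval_mul, Polynomial.eval_ofNat, Complex.ofReal_one,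
    Complex.ofReal_mul, Complex.ofReal_ofNat]
  ring

theorem ucoef_eq (hf : DiffContOnCl ℂ f (region ρ)) (hρ : 1 < ρ) (m : ℕ) :
    ucoef f ρ m = (2 * Real.pi : ℂ)⁻¹ * ∫ θ in (0 : ℝ)..2 * Real.pi,
      f (joukowski (circleMap 0 ρ θ)) * (1 - (circleMap 0 ρ θ)⁻¹ ^ 2) *
        (circleMap 0 ρ θ)⁻¹ ^ m := by
  have c1 := continuous_comp_circleMap hf hρ
  have c2 := continuous_circleMap_inv hρ
  rw [ucoef, lcoef, lcoef, ← mul_sub, ← intervalIntegral.integral_sub]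
  · congr 2
    ext θ; ring
  · exact (c1.mul (c2.pow m)).intervalIntegrable _ _
  · exact (c1.mul (c2.pow (m + 2))).intervalIntegrable _ _

theorem ellipseLength_eq (hρ : 1 < ρ) : ellipseLength ρ =
    ρ / 2 * ∫ θ in (0 : ℝ)..2 * Real.pi, ‖1 - (circleMap 0 ρ θ)⁻¹ ^ 2‖ := by
  rw [ellipseLength, ← intervalIntegral.integral_const_mul]
  refine intervalIntegral.integral_congr fun θ _ => ?_
  have h0 : circleMap 0 ρ θ ≠ 0 := circleMap_ne_center (by linarith)
  have h1 : HasDerivAt joukowski ((1 - (circleMap 0 ρ θ)⁻¹ ^ 2) / 2) (circleMap 0 ρ θ) := by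
    have := ((hasDerivAt_id (circleMap 0 ρ θ)).add (hasDerivAt_inv h0)).div_const 2
    refine this.congr_deriv ?_
    rw [inv_pow]; ring
  have h2 := h1.comp θ (hasDerivAt_circleMap 0 ρ θ)
  have h3 : deriv (fun t => joukowski (circleMap 0 ρ t)) θ = _ := h2.deriv
  rw [h3, norm_mul, norm_mul, norm_circleMap hρ, norm_div]
  simp
  ring

/-- Under the contour integral the sum over j is u⁻ᵏ/`al l k` times the hypergeometric factor at
u⁻². Bounding |f| by its maximum but keeping |1 - u⁻²| inside the integral produces the length of
the ellipse: (2π)⁻¹ · 2L/ρ = L/(πρ). -/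
theorem norm_acoef_le (hf : DiffContOnCl ℂ f (region ρ)) (hρ : 1 < ρ) {l : ℝ} (hl : -1 / 2 < l)
    (hl0 : l ≠ 0) (k : ℕ) {H : ℝ} (hH : ∀ w : ℂ, ‖w‖ ≤ 1 / ρ ^ 2 → ‖hyp l k w‖ ≤ H) :
    ‖acoef l (ucoef f ρ) k‖ ≤
      maxOn f ρ * ellipseLength ρ / (Real.pi * ρ) * (|al l k|⁻¹ * H) / ρ ^ k := by
  have hρ0 : 0 < ρ := by linarith
  have hr : 1 / ρ ^ 2 < 1 := by
    rw [div_lt_one (by positivity)]; nlinarith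
  have c1 := continuous_comp_circleMap hf hρ
  have c2 := continuous_circleMap_inv hρ
  obtain ⟨G, hG⟩ : ∃ G : ℝ → ℂ, G = fun θ =>
      f (joukowski (circleMap 0 ρ θ)) * (1 - (circleMap 0 ρ θ)⁻¹ ^ 2) := ⟨_, rfl⟩
  have cG : Continuous G := hG ▸ c1.mul (continuous_const.sub (c2.pow 2))
  have hw : ∀ θ, ‖(circleMap 0 ρ θ)⁻¹ ^ 2‖ = 1 / ρ ^ 2 := fun θ => by
    rw [norm_pow, norm_inv, norm_circleMap hρ]; simp
  have hGle : ∀ θ, ‖G θ‖ ≤ maxOn f ρ * ‖1 - (circleMap 0 ρ θ)⁻¹ ^ 2‖ := fun θ => by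
    rw [hG, norm_mul]
    exact mul_le_mul_of_nonneg_right (norm_le_maxOn hf hρ (norm_circleMap hρ θ)) (norm_nonneg _)
  have hGle2 : ∀ θ, ‖G θ‖ ≤ maxOn f ρ * 2 := fun θ => by
    refine (hGle θ).trans (mul_le_mul_of_nonneg_left ?_ (maxOn_nonneg f ρ))
    refine (norm_sub_le _ _).trans ?_
    rw [hw, norm_one]; linarith
  have hS : HasSum (fun j => ∫ θ in (0 : ℝ)..2 * Real.pi,
      G θ * (circleMap 0 ρ θ)⁻¹ ^ (k + 2 * j) * (conn l k j : ℂ))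
      (∫ θ in (0 : ℝ)..2 * Real.pi, G θ * (circleMap 0 ρ θ)⁻¹ ^ k * ((al l k : ℂ)⁻¹ *
        hyp l k ((circleMap 0 ρ θ)⁻¹ ^ 2))) := by
    refine intervalIntegral.hasSum_integral_of_dominated_convergence
      (fun j _ => maxOn f ρ * 2 * (ρ⁻¹ ^ k * |al l k|⁻¹) * (maj l j * (1 / ρ ^ 2) ^ j))
      (fun j => ((cG.mul (c2.pow _)).mul continuous_const).aestronglyMeasurable)
      (fun j => .of_forall fun θ _ => ?_) (.of_forall fun θ _ => ?_) ?_ (.of_forall fun θ _ => ?_)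
    · rw [norm_mul, norm_mul, pow_add, pow_mul, norm_mul, norm_pow _ j, hw, norm_pow, norm_inv,
        norm_circleMap hρ]
      calc _ ≤ (maxOn f ρ * 2) * (ρ⁻¹ ^ k * (1 / ρ ^ 2) ^ j) * (|al l k|⁻¹ * maj l j) :=
            mul_le_mul (mul_le_mul_of_nonneg_right (hGle2 θ) (by positivity))
              (norm_conn_le hl hl0 k j) (norm_nonneg _)
              (mul_nonneg (mul_nonneg (maxOn_nonneg f ρ) (by norm_num)) (by positivity))
        _ = _ := by ring
    · exact (summable_maj l (by positivity) hr).mul_left _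
    · exact intervalIntegrable_const
    · have h := (hasSum_hyp hl hl0 k (w := (circleMap 0 ρ θ)⁻¹ ^ 2)
        (by rw [hw]; exact hr)).mul_left (G θ * (circleMap 0 ρ θ)⁻¹ ^ k * (al l k : ℂ)⁻¹)
      rw [← mul_assoc]
      convert! h using 2 with j
      rw [conn_eq (by linarith) hl0, pow_add, pow_mul]
      push_cast
      ring
  have e : acoef l (ucoef f ρ) k = (2 * Real.pi : ℂ)⁻¹ * ∫ θ in (0 : ℝ)..2 * Real.pi,
      G θ * (circleMap 0 ρ θ)⁻¹ ^ k * ((al l k : ℂ)⁻¹ * hyp l k ((circleMap 0 ρ θ)⁻¹ ^ 2)) := by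
    rw [acoef, ← (hS.mul_left _).tsum_eq]
    congr 1
    ext j
    rw [ucoef_eq hf hρ, intervalIntegral.integral_mul_const, hG]
    ring
  have hp : 0 < 2 * Real.pi := Real.two_pi_pos
  have e2 : ‖(2 * Real.pi : ℂ)⁻¹‖ = (2 * Real.pi)⁻¹ := by
    rw [norm_inv, norm_mul, Complex.norm_real, Real.norm_of_nonneg Real.pi_pos.le]; simp
  have hI := intervalIntegral.norm_integral_le_of_norm_le (μ := MeasureTheory.volume) (a := 0)
    (b := 2 * Real.pi)
    (f := fun θ => G θ * (circleMap 0 ρ θ)⁻¹ ^ k * ((al l k : ℂ)⁻¹ *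
      hyp l k ((circleMap 0 ρ θ)⁻¹ ^ 2)))
    (g := fun θ => (maxOn f ρ * ρ⁻¹ ^ k * (|al l k|⁻¹ * H)) * ‖1 - (circleMap 0 ρ θ)⁻¹ ^ 2‖) hp.le
    (.of_forall fun θ _ => by
      rw [norm_mul, norm_mul, norm_mul, norm_pow, norm_inv, norm_inv, norm_circleMap hρ,
        Complex.norm_real, Real.norm_eq_abs]
      calc _ ≤ (maxOn f ρ * ‖1 - (circleMap 0 ρ θ)⁻¹ ^ 2‖) * ρ⁻¹ ^ k * (|al l k|⁻¹ * H) :=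
            mul_le_mul (mul_le_mul_of_nonneg_right (hGle θ) (by positivity))
              (mul_le_mul_of_nonneg_left (hH _ (hw θ).le) (by positivity)) (by positivity)
              (mul_nonneg (mul_nonneg (maxOn_nonneg f ρ) (norm_nonneg _)) (by positivity))
        _ = _ := by ring)
    (((continuous_const.sub (c2.pow 2)).norm.const_mul _).intervalIntegrable _ _)
  rw [e, norm_mul, e2, inv_mul_le_iff₀ hp]
  refine hI.trans_eq ?_
  rw [intervalIntegral.integral_const_mul, ellipseLength_eq hρ]
  have := Real.pi_pos.ne'
  rw [inv_pow]
  field_simp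

end Gegenbauer

namespace Gegenbauer

variable {f : ℂ → ℂ} {ρ l : ℝ}

/-! ### Upper bounds -/

theorem supNorm_le {g : ℝ → ℂ} {c : ℝ} (h : ∀ x ∈ Icc (-1 : ℝ) 1, ‖g x‖ ≤ c) : supNorm g ≤ c := by
  refine csSup_le ⟨_, mem_image_of_mem _ (left_mem_Icc.mpr (by norm_num))⟩ ?_
  rintro _ ⟨x, hx, rfl⟩
  exact h x hx

theorem inv_abs_al_eq (a : ℝ) {k : ℕ} (hk : 1 ≤ k) :
    |al a k|⁻¹ = |rat a k|⁻¹ * (k : ℝ) ^ (1 - a) := by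
  rw [abs_al_eq a hk, mul_inv, ← Real.rpow_neg (Nat.cast_nonneg k), neg_sub]

theorem ellipseLength_nonneg (hρ : 1 < ρ) : 0 ≤ ellipseLength ρ := by
  rw [ellipseLength_eq hρ]
  refine mul_nonneg (by linarith) (intervalIntegral.integral_nonneg Real.two_pi_pos.le
    fun _ _ => norm_nonneg _)

theorem norm_acoef_le_D (hf : DiffContOnCl ℂ f (region ρ)) (hρ : 1 < ρ) (hl : -1 / 2 < l)
    (hl0 : l ≠ 0) {k : ℕ} (hk : 1 ≤ k) :
    ‖acoef l (ucoef f ρ) k‖ ≤ D l ρ f * ((k : ℝ) ^ (1 - l) / ρ ^ k) := by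
  have hρ0 : 0 < ρ := by linarith
  have hr : 1 / ρ ^ 2 < 1 := by
    rw [div_lt_one (by positivity)]; nlinarith
  have hr0 : 0 ≤ 1 / ρ ^ 2 := by positivity
  have hkp : 0 ≤ (k : ℝ) ^ (1 - l) := Real.rpow_nonneg (Nat.cast_nonneg k) _
  have hA : 0 ≤ maxOn f ρ * ellipseLength ρ / (Real.pi * ρ) :=
    div_nonneg (mul_nonneg (maxOn_nonneg f ρ) (ellipseLength_nonneg hρ))
      (mul_nonneg Real.pi_pos.le hρ0.le)
  -- In each range of l the factor in D splits as c · H, with H bounding the hypergeometric factor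
  -- and c bounding k^{l-1} k!/|(l)_k|.
  suffices H : ∃ H c : ℝ, 0 ≤ H ∧ (∀ w : ℂ, ‖w‖ ≤ 1 / ρ ^ 2 → ‖hyp l k w‖ ≤ H) ∧
      |rat l k|⁻¹ ≤ c ∧ c * H = (if l < 0 then
        |Real.Gamma l| * Real.Gamma (1 + l) * Real.Gamma (1 - 2 * l) / Real.Gamma (1 - l) *
        (1 - 1 / ρ ^ 2) ^ (2 * l - 1)
      else if l ≤ 1 then 1 / l * (1 - 1 / ρ ^ 2) ^ (l - 1)
      else Real.Gamma l * (1 + 1 / ρ ^ 2) ^ (l - 1)) by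
    obtain ⟨H, c, hH0, hH, hc, he⟩ := H
    refine (norm_acoef_le hf hρ hl hl0 k hH).trans ?_
    rw [D, ← he, inv_abs_al_eq l hk]
    calc _ ≤ maxOn f ρ * ellipseLength ρ / (Real.pi * ρ) * (c * (k : ℝ) ^ (1 - l) * H) / ρ ^ k := by
          gcongr
      _ = _ := by ring
  rcases lt_or_ge l 0 with h | h
  · refine ⟨_, |Real.Gamma l|, ?_, fun w hw => norm_hyp_le hl hl0 k hr hw, ?_, ?_⟩
    · exact tsum_nonneg fun j => mul_nonneg (maj_nonneg hl j) (by positivity)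
    · have h1 := inv_Gamma_le_abs_rat hl h hk
      have h2 : 0 < |Real.Gamma l| := by
        refine abs_pos.mpr (Real.Gamma_ne_zero fun m hm => ?_)
        rcases m with _ | m
        · simp at hm; exact hl0 hm
        · push_cast at hm
          have : (0 : ℝ) ≤ m := m.cast_nonneg
          linarith
      rw [inv_le_comm₀ (lt_of_lt_of_le (by positivity) h1) h2]
      exact h1
    · rw [if_pos h, tsum_maj_of_neg h hr0 hr, gammaConst]; ring
  · have hlp : 0 < l := lt_of_le_of_ne h hl0.symm
    have hG := Real.Gamma_pos_of_pos hlp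
    have hrat := rat_pos hlp hk
    rw [if_neg (not_lt.mpr h), abs_of_pos hrat]
    split_ifs with h1
    · refine ⟨_, 1 / l, ?_, fun w hw => norm_hyp_le hl hl0 k hr hw, ?_, ?_⟩
      · exact tsum_nonneg fun j => mul_nonneg (maj_nonneg hl j) (by positivity)
      · rw [one_div]
        exact inv_anti₀ hlp (le_rat hlp h1 hk)
      · rw [tsum_maj_of_le_one hlp h1 hr0 hr]
    · push Not at h1
      refine ⟨_, Real.Gamma l, ?_, fun w hw => norm_hyp_le_of_one_lt h1 k hr hw, ?_, rfl⟩
      · positivity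
      · rw [inv_le_comm₀ hrat hG]
        exact inv_Gamma_le_rat h1.le hk

theorem D_nonneg (hρ : 1 < ρ) (hl : -1 / 2 < l) (hl0 : l ≠ 0) : 0 ≤ D l ρ f := by
  have hρ0 : 0 < ρ := by linarith
  have hr : 1 / ρ ^ 2 < 1 := by
    rw [div_lt_one (by positivity)]; nlinarith
  have hA : 0 ≤ maxOn f ρ * ellipseLength ρ / (Real.pi * ρ) :=
    div_nonneg (mul_nonneg (maxOn_nonneg f ρ) (ellipseLength_nonneg hρ))
      (mul_nonneg Real.pi_pos.le hρ0.le)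
  refine mul_nonneg hA ?_
  have h1 : 0 ≤ 1 - 1 / ρ ^ 2 := by linarith
  split_ifs with h h'
  · have g1 := Real.Gamma_pos_of_pos (by linarith : 0 < 1 + l)
    have g2 := Real.Gamma_pos_of_pos (by linarith : 0 < 1 - 2 * l)
    have g3 := Real.Gamma_pos_of_pos (by linarith : 0 < 1 - l)
    have := Real.rpow_nonneg h1 (2 * l - 1)
    positivity
  · have := Real.rpow_nonneg h1 (l - 1)
    have : 0 < l := lt_of_le_of_ne (not_lt.mp h) hl0.symm
    positivity
  · have : 0 < l := lt_of_le_of_ne (not_lt.mp h) hl0.symm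
    have := Real.Gamma_pos_of_pos this
    positivity

theorem hasSum_err_of_diffContOnCl (hf : DiffContOnCl ℂ f (region ρ)) (hρ : 1 < ρ)
    (hl : -1 / 2 < l) (hl0 : l ≠ 0) (n : ℕ) {x : ℝ} (hx : x ∈ Icc (-1 : ℝ) 1) :
    HasSum (fun i => acoef l (ucoef f ρ) (i + (n + 1)) * (poly l (i + (n + 1)) x : ℂ))
      (err l n f x) :=
  hasSum_err hl hl0 (inv_nonneg.mpr (by linarith)) (inv_lt_one_of_one_lt₀ hρ)
    (norm_ucoef_le hf hρ) (g := fun t : ℝ => f t) (fun _ hx => hasSum_ucoef_U hf hρ hx) n hx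

/-- The factors k^{1-l} and k^{l-1} cancel, leaving the geometric tail ∑_{k>n} ρ⁻ᵏ. -/
theorem supNorm_err_le_of_neg (hf : DiffContOnCl ℂ f (region ρ)) (hρ : 1 < ρ)
    (hl : -1 / 2 < l) (hl0 : l < 0) {C : ℝ} {N n : ℕ} (hC : UniformBound l C N) (hN : N ≤ n + 1) :
    supNorm (err l n f) ≤ D l ρ f * C / ((ρ - 1) * ρ ^ n) := by
  have hρ0 : 0 < ρ := by linarith
  refine supNorm_le fun x hx => ?_
  have hgeo := (hasSum_geometric_of_lt_one (inv_nonneg.mpr hρ0.le)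
    (inv_lt_one_of_one_lt₀ hρ)).mul_left (D l ρ f * C / ρ ^ (n + 1))
  have e : D l ρ f * C / ρ ^ (n + 1) * (1 - ρ⁻¹)⁻¹ = D l ρ f * C / ((ρ - 1) * ρ ^ n) := by
    have : ρ - 1 ≠ 0 := by linarith
    have : (1 - ρ⁻¹) = (ρ - 1) / ρ := by field_simp
    rw [this, pow_succ]
    field_simp
  rw [e] at hgeo
  rw [← (hasSum_err_of_diffContOnCl hf hρ hl hl0.ne n hx).tsum_eq]
  refine tsum_of_norm_bounded hgeo fun i => ?_
  set k := i + (n + 1) with hk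
  have hk1 : 1 ≤ k := by omega
  have hk0 : (0 : ℝ) < k := by exact_mod_cast hk1
  rw [norm_mul, Complex.norm_real, Real.norm_eq_abs]
  calc _ ≤ (D l ρ f * ((k : ℝ) ^ (1 - l) / ρ ^ k)) * (C * (k : ℝ) ^ (l - 1)) :=
        mul_le_mul (norm_acoef_le_D hf hρ hl hl0.ne hk1) (hC k hk1 (by omega) x hx) (abs_nonneg _)
          ((norm_nonneg _).trans (norm_acoef_le_D hf hρ hl hl0.ne hk1))
    _ = D l ρ f * C * ((k : ℝ) ^ (1 - l) * (k : ℝ) ^ (l - 1)) / ρ ^ k := by ring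
    _ = _ := by
        rw [← Real.rpow_add hk0, hk, pow_add, inv_pow]
        simp
        field_simp

/-- For l < 0 the coefficients (l)_i/i! are absolutely summable. In each product of the
trigonometric formula one of the two indices is at least k/2 and contributes k^{l-1}, while the
other factor is summed. -/
theorem exists_uniformBound (hl : -1 / 2 < l) (hl0 : l < 0) :
    ∃ C : ℝ, 0 < C ∧ UniformBound l C 1 := by
  obtain ⟨_, M, _, hM, hb⟩ := exists_abs_al_bounds hl hl0.ne
  have hs : Summable fun i => |al l i| := by
    refine Summable.of_norm_bounded_eventually_nat
      ((Real.summable_nat_rpow.mpr (by linarith : l - 1 < -1)).mul_left M) ?_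
    filter_upwards [eventually_ge_atTop 1] with i hi
    rw [Real.norm_eq_abs, abs_abs]
    exact (hb i hi).2
  set Z := ∑' i, |al l i|
  have hZ : 0 ≤ Z := tsum_nonneg fun _ => abs_nonneg _
  refine ⟨M * 2 ^ (1 - l) * (2 * Z + 1), by positivity, fun k hk _ x hx => ?_⟩
  have hk0 : (0 : ℝ) < k := by exact_mod_cast hk
  have hmax : ∀ i : ℕ, k ≤ 2 * i → |al l i| ≤ M * 2 ^ (1 - l) * (k : ℝ) ^ (l - 1) := by
    intro i hi
    refine (hb i (by omega)).2.trans ?_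
    have e : (2 : ℝ) ^ (1 - l) * (k : ℝ) ^ (l - 1) = ((k : ℝ) / 2) ^ (l - 1) := by
      rw [Real.div_rpow hk0.le (by norm_num), ← neg_sub l 1, Real.rpow_neg (by norm_num)]
      field_simp
    rw [mul_assoc, e]
    refine mul_le_mul_of_nonneg_left ?_ hM.le
    refine Real.rpow_le_rpow_of_nonpos (by positivity) ?_ (by linarith)
    have : (k : ℝ) ≤ 2 * i := by exact_mod_cast hi
    linarith
  have hA : 0 ≤ M * 2 ^ (1 - l) * (k : ℝ) ^ (l - 1) := by positivity
  have hsum : ∑ i ∈ Finset.range (k + 1), |al l i| ≤ Z :=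
    hs.sum_le_tsum _ fun _ _ => abs_nonneg _
  calc |poly l k x| ≤ absSum l k := abs_poly_le_absSum hl k hx
    _ ≤ ∑ p ∈ Finset.HasAntidiagonal.antidiagonal k,
        M * 2 ^ (1 - l) * (k : ℝ) ^ (l - 1) * (|al l p.1| + |al l p.2|) := by
        refine Finset.sum_le_sum fun p hp => ?_
        have hp' := Finset.HasAntidiagonal.mem_antidiagonal.mp hp
        rcases le_total p.1 p.2 with h | h
        · have := hmax p.2 (by omega)
          nlinarith [abs_nonneg (al l p.1), abs_nonneg (al l p.2),
            mul_le_mul_of_nonneg_left this (abs_nonneg (al l p.1)),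
            mul_nonneg hA (abs_nonneg (al l p.2))]
        · have := hmax p.1 (by omega)
          nlinarith [abs_nonneg (al l p.1), abs_nonneg (al l p.2),
            mul_le_mul_of_nonneg_right this (abs_nonneg (al l p.2)),
            mul_nonneg hA (abs_nonneg (al l p.1))]
    _ = M * 2 ^ (1 - l) * (k : ℝ) ^ (l - 1) * (2 * ∑ i ∈ Finset.range (k + 1), |al l i|) := by
        rw [← Finset.mul_sum, Finset.sum_add_distrib,
          Finset.Nat.sum_antidiagonal_eq_sum_range_succ (fun i _ => |al l i|),
          Finset.Nat.sum_antidiagonal_eq_sum_range_succ (fun _ j => |al l j|)]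
        congr 1
        rw [two_mul]
        congr 1
        exact Finset.sum_flip (fun i => |al l i|)
    _ ≤ M * 2 ^ (1 - l) * (k : ℝ) ^ (l - 1) * (2 * Z + 1) :=
        mul_le_mul_of_nonneg_left (by linarith) hA
    _ = _ := by ring

/-- Common frame of the two estimates below: the powers combine to k^{1-l} k^{2l-1} = k^l, and only
the bound E and the majorant b of k^l ρ⁻ᵏ remain to be chosen. -/
theorem supNorm_err_le_of_pos (hf : DiffContOnCl ℂ f (region ρ)) (hρ : 1 < ρ) (hl : 0 < l)
    {n : ℕ} {E T : ℝ} (hE : ∀ k, n + 1 ≤ k → rat (2 * l) k ≤ E) {b : ℕ → ℝ} (hT : HasSum b T)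
    (hb : ∀ i : ℕ, ((i + (n + 1) : ℕ) : ℝ) ^ l / ρ ^ (i + (n + 1)) ≤ b i) :
    supNorm (err l n f) ≤ D l ρ f * E * T := by
  have hD : 0 ≤ D l ρ f := D_nonneg hρ (by linarith) hl.ne'
  have hE0 : 0 ≤ E := (rat_pos (by linarith) (by omega)).le.trans (hE (n + 1) le_rfl)
  refine supNorm_le fun x hx => ?_
  rw [← (hasSum_err_of_diffContOnCl hf hρ (by linarith) hl.ne' n hx).tsum_eq]
  refine tsum_of_norm_bounded (hT.mul_left _) fun i => ?_
  refine le_trans ?_ (mul_le_mul_of_nonneg_left (hb i) (mul_nonneg hD hE0))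
  set k := i + (n + 1) with hk
  have hk1 : 1 ≤ k := by omega
  have hk0 : (0 : ℝ) < k := by exact_mod_cast hk1
  have hp : 0 ≤ (k : ℝ) ^ (2 * l - 1) := Real.rpow_nonneg hk0.le _
  rw [norm_mul, Complex.norm_real, Real.norm_eq_abs]
  have h1 : |poly l k x| ≤ E * (k : ℝ) ^ (2 * l - 1) := by
    refine (abs_poly_le hl k hx).trans ?_
    rw [al_eq_rat _ hk1]
    exact mul_le_mul_of_nonneg_right (hE k (by omega)) hp
  have h2 := norm_acoef_le_D hf hρ (by linarith) hl.ne' hk1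
  calc _ ≤ (D l ρ f * ((k : ℝ) ^ (1 - l) / ρ ^ k)) * (E * (k : ℝ) ^ (2 * l - 1)) :=
        mul_le_mul h2 h1 (abs_nonneg _) ((norm_nonneg _).trans h2)
    _ = D l ρ f * E * (((k : ℝ) ^ (1 - l) * (k : ℝ) ^ (2 * l - 1)) / ρ ^ k) := by ring
    _ = _ := by
        rw [← Real.rpow_add hk0]
        congr 4; ring

theorem pow_eq_exp_log (hρ : 1 < ρ) (k : ℕ) : ρ ^ k = Real.exp (k * Real.log ρ) := by
  rw [Real.exp_nat_mul, Real.exp_log (by linarith)]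

theorem supNorm_err_le_asymptotic (hf : DiffContOnCl ℂ f (region ρ)) (hρ : 1 < ρ) (hl : 0 < l)
    {n : ℕ} (hn : 1 ≤ n) {ε : ℝ} (hε : 0 < ε) (hX : l * (1 + ε) / ε ≤ n * Real.log ρ) {E : ℝ}
    (hE : ∀ k, n + 1 ≤ k → rat (2 * l) k ≤ E) :
    supNorm (err l n f) ≤ (1 + ε) * (D l ρ f / Real.log ρ) * E * ((n : ℝ) ^ l / ρ ^ n) := by
  set s := Real.log ρ with hs
  have hs0 : 0 < s := Real.log_pos hρ
  have hn0 : (0 : ℝ) < n := by exact_mod_cast hn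
  have hD : 0 ≤ D l ρ f := D_nonneg hρ (by linarith) hl.ne'
  have hE0 : 0 ≤ E := (rat_pos (by linarith) (by omega)).le.trans (hE (n + 1) le_rfl)
  -- Of the decay rate s = ln ρ, the part s - v pays for the growth (1 + (i+1)/n)^l ≤ e^{(i+1)l/n};
  -- the hypothesis on n says exactly l/n ≤ s - v. The remaining geometric sum 1/(e^v - 1) is at
  -- most 1/v = (1+ε)/s.
  set v := s / (1 + ε) with hv
  have hv0 : 0 < v := by positivity
  have hln : l / n ≤ s - v := by
    have e : s - v = s * ε / (1 + ε) := by rw [hv]; field_simp; ring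
    rw [e, div_le_div_iff₀ hn0 (by positivity)]
    rw [div_le_iff₀ hε] at hX
    linarith
  have hq1 : Real.exp (-v) < 1 := Real.exp_lt_one_iff.mpr (by linarith)
  have hgeo := (hasSum_geometric_of_lt_one (Real.exp_pos (-v)).le hq1).mul_left
    ((n : ℝ) ^ l / ρ ^ n * Real.exp (-v))
  have hb : ∀ i : ℕ, ((i + (n + 1) : ℕ) : ℝ) ^ l / ρ ^ (i + (n + 1)) ≤
      (n : ℝ) ^ l / ρ ^ n * Real.exp (-v) * Real.exp (-v) ^ i := by
    intro i
    have e1 : ((i + (n + 1) : ℕ) : ℝ) = n * (1 + (i + 1) / n) := by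
      push_cast; field_simp; ring
    have e2 : (1 + ((i : ℝ) + 1) / n) ^ l ≤ Real.exp ((i + 1) * (s - v)) := by
      calc _ ≤ Real.exp (((i : ℝ) + 1) / n) ^ l := by
            refine Real.rpow_le_rpow (by positivity) ?_ hl.le
            linarith [Real.add_one_le_exp (((i : ℝ) + 1) / n)]
        _ = Real.exp ((i + 1) * (l / n)) := by rw [← Real.exp_mul]; congr 1; ring
        _ ≤ _ := Real.exp_le_exp.mpr (mul_le_mul_of_nonneg_left hln (by positivity))
    have e3 : ρ ^ (i + (n + 1)) = ρ ^ n * Real.exp ((i + 1) * s) := by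
      rw [pow_eq_exp_log hρ, pow_eq_exp_log hρ, ← Real.exp_add]; congr 1; push_cast; ring
    have e4 : Real.exp (-v) * Real.exp (-v) ^ i =
        Real.exp ((i + 1) * (s - v)) / Real.exp ((i + 1) * s) := by
      rw [← Real.exp_nat_mul, ← Real.exp_add, ← Real.exp_sub]; congr 1; ring
    rw [e1, Real.mul_rpow hn0.le (by positivity), e3, mul_assoc _ (Real.exp (-v)), e4,
      mul_div_mul_comm]
    gcongr
  refine (supNorm_err_le_of_pos hf hρ hl hE hgeo hb).trans ?_
  have hfin : Real.exp (-v) * (1 - Real.exp (-v))⁻¹ ≤ (1 + ε) / s := by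
    have e : (1 + ε) / s = v⁻¹ := by rw [hv]; field_simp
    rw [e, ← div_eq_mul_inv, div_le_iff₀ (by linarith), ← div_eq_inv_mul, le_div_iff₀ hv0]
    have h1 := Real.add_one_le_exp v
    have h2 : Real.exp (-v) * Real.exp v = 1 := by rw [← Real.exp_add]; simp
    nlinarith [Real.exp_pos (-v)]
  calc _ = D l ρ f * E * ((n : ℝ) ^ l / ρ ^ n) * (Real.exp (-v) * (1 - Real.exp (-v))⁻¹) := by ring
    _ ≤ D l ρ f * E * ((n : ℝ) ^ l / ρ ^ n) * ((1 + ε) / s) :=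
        mul_le_mul_of_nonneg_left hfin (by positivity)
    _ = _ := by ring

/-- The condition on n gives l ≤ (n+1) ln ρ, so half of the exponential decay absorbs the growth of
k^l beyond (n+1)^l. The factor 5/2 is 2, from (n+1)^l ≤ 2^l n^l, times 5/4. -/
theorem supNorm_err_le_absolute (hf : DiffContOnCl ℂ f (region ρ)) (hρ : 1 < ρ) (hl : 0 < l)
    {n : ℕ} (hn : 1 ≤ n) (hX : ⌊l / Real.log ρ⌋₊ ≤ n) {E : ℝ}
    (hE : ∀ k, n + 1 ≤ k → rat (2 * l) k ≤ E) :
    supNorm (err l n f) ≤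
      2 * (5 / 2) ^ l * (D l ρ f / Real.log ρ) * E * ((n : ℝ) ^ l / ρ ^ n) := by
  set s := Real.log ρ with hs
  have hs0 : 0 < s := Real.log_pos hρ
  have hn1 : (1 : ℝ) ≤ n := by exact_mod_cast hn
  have hn0 : (0 : ℝ) < n := by linarith
  have hD : 0 ≤ D l ρ f := D_nonneg hρ (by linarith) hl.ne'
  have hE0 : 0 ≤ E := (rat_pos (by linarith) (by omega)).le.trans (hE (n + 1) le_rfl)
  have hm : l ≤ (n + 1) * s := by
    have : l / s < n + 1 := (Nat.lt_floor_add_one _).trans_le (by exact_mod_cast Nat.succ_le_succ hX)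
    rw [div_lt_iff₀ hs0] at this
    exact this.le
  have hq1 : Real.exp (-(s / 2)) < 1 := Real.exp_lt_one_iff.mpr (by linarith)
  have hgeo := (hasSum_geometric_of_lt_one (Real.exp_pos (-(s / 2))).le hq1).mul_left
    ((5 / 2) ^ l * ((n : ℝ) ^ l / ρ ^ n) * Real.exp (-s))
  -- The maximum of (1 + x) e^{-x/2} is 2/√e < 5/4, attained at x = 1, so the tangent is taken
  -- there.
  have hexp : ∀ x : ℝ, 1 + x ≤ 5 / 4 * Real.exp (x / 2) := by
    intro x
    have h1 := Real.add_one_le_exp ((x - 1) / 2)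
    have h2 : Real.exp (x / 2) = Real.exp (1 / 2) * Real.exp ((x - 1) / 2) := by
      rw [← Real.exp_add]; congr 1; ring
    have h3 : (8 / 5 : ℝ) ≤ Real.exp (1 / 2) := by
      have h4 : Real.exp (1 / 2) * Real.exp (1 / 2) = Real.exp 1 := by
        rw [← Real.exp_add]; congr 1; norm_num
      have := Real.exp_one_gt_d9
      nlinarith [Real.exp_pos (1 / 2)]
    rw [h2]
    rcases le_or_gt (1 + x) 0 with h | h
    · exact h.trans (by positivity)
    · nlinarith [Real.exp_pos (1 / 2)]
  have hb : ∀ i : ℕ, ((i + (n + 1) : ℕ) : ℝ) ^ l / ρ ^ (i + (n + 1)) ≤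
      (5 / 2) ^ l * ((n : ℝ) ^ l / ρ ^ n) * Real.exp (-s) * Real.exp (-(s / 2)) ^ i := by
    intro i
    have e1 : ((i + (n + 1) : ℕ) : ℝ) = (n + 1) * (1 + i / (n + 1)) := by
      push_cast; field_simp; ring
    have e2 : (1 + (i : ℝ) / (n + 1)) ^ l ≤ (5 / 4) ^ l * Real.exp (i * s / 2) := by
      calc _ ≤ (1 + i * s / l) ^ l := by
            refine Real.rpow_le_rpow (by positivity) ?_ hl.le
            gcongr 1 + ?_
            rw [div_le_div_iff₀ (by positivity) hl]
            nlinarith [Nat.cast_nonneg (α := ℝ) i]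
        _ ≤ (5 / 4 * Real.exp (i * s / l / 2)) ^ l :=
            Real.rpow_le_rpow (by positivity) (hexp _) hl.le
        _ = _ := by
            rw [Real.mul_rpow (by norm_num) (Real.exp_pos _).le, ← Real.exp_mul]
            congr 2; field_simp
    have e3 : ρ ^ (i + (n + 1)) = ρ ^ n * Real.exp ((i + 1) * s) := by
      rw [pow_eq_exp_log hρ, pow_eq_exp_log hρ, ← Real.exp_add]; congr 1; push_cast; ring
    have e4 : Real.exp (-s) * Real.exp (-(s / 2)) ^ i =
        Real.exp (i * s / 2) / Real.exp ((i + 1) * s) := by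
      rw [← Real.exp_nat_mul, ← Real.exp_add, ← Real.exp_sub]; congr 1; ring
    have e5 : ((n : ℝ) + 1) ^ l ≤ 2 ^ l * (n : ℝ) ^ l := by
      rw [← Real.mul_rpow (by norm_num) hn0.le]
      exact Real.rpow_le_rpow (by positivity) (by linarith) hl.le
    have e6 : (5 / 2 : ℝ) ^ l = 2 ^ l * (5 / 4) ^ l := by
      rw [← Real.mul_rpow (by norm_num) (by norm_num)]; norm_num
    rw [e1, Real.mul_rpow (by positivity) (by positivity), e3, mul_assoc _ (Real.exp (-s)), e4, e6]
    calc _ ≤ (2 ^ l * (n : ℝ) ^ l) * ((5 / 4) ^ l * Real.exp (i * s / 2)) /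
          (ρ ^ n * Real.exp ((i + 1) * s)) := by gcongr
      _ = _ := by ring
  refine (supNorm_err_le_of_pos hf hρ hl hE hgeo hb).trans ?_
  have hfin : Real.exp (-s) * (1 - Real.exp (-(s / 2)))⁻¹ ≤ 2 / s := by
    rw [← div_eq_mul_inv, div_le_div_iff₀ (by linarith) hs0]
    have h1 := Real.add_one_le_exp (s / 2)
    have h2 : Real.exp (-(s / 2)) * Real.exp (s / 2) = 1 := by rw [← Real.exp_add]; simp
    have h3 : Real.exp (-s) = Real.exp (-(s / 2)) * Real.exp (-(s / 2)) := by
      rw [← Real.exp_add]; congr 1; ring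
    have h4 : Real.exp (-(s / 2)) * (s / 2) ≤ 1 - Real.exp (-(s / 2)) := by
      nlinarith [Real.exp_pos (-(s / 2))]
    rw [h3]
    nlinarith [Real.exp_pos (-(s / 2)), mul_pos (Real.exp_pos (-(s / 2))) hs0]
  calc _ = D l ρ f * E * ((5 / 2) ^ l * ((n : ℝ) ^ l / ρ ^ n)) *
        (Real.exp (-s) * (1 - Real.exp (-(s / 2)))⁻¹) := by ring
    _ ≤ D l ρ f * E * ((5 / 2) ^ l * ((n : ℝ) ^ l / ρ ^ n)) * (2 / s) :=
        mul_le_mul_of_nonneg_left hfin (by positivity)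
    _ = _ := by ring

theorem rat_le_K_factor (hl : 0 < l) {k : ℕ} (hk : 1 ≤ k) :
    rat (2 * l) k ≤ if l ≤ 1 / 2 then 1 / Real.Gamma (2 * l) else 2 * l := by
  split_ifs with h
  · rw [one_div]
    exact rat_le_inv_Gamma (by linarith) (by linarith) hk
  · exact (rat_le_of_le (by linarith) le_rfl hk).trans_eq (rat_one _)

/-- The factor (5/2)^l must be removed to get an absolute constant. For l ≤ 1/2 it is at most 5/2.
For l > 1/2 the tail starts at k ≥ 2, so `rat (2 * l) 2` = 2l (2l+1) 4^{-l} may replace 2l, and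
(2l+1)(5/8)^l ≤ 6. -/
theorem supNorm_err_le_K (hf : DiffContOnCl ℂ f (region ρ)) (hρ : 1 < ρ) (hl : 0 < l)
    {n : ℕ} (hn : 1 ≤ n) (hX : ⌊l / Real.log ρ⌋₊ ≤ n) :
    supNorm (err l n f) ≤ K 12 l ρ f * ((n : ℝ) ^ l / ρ ^ n) := by
  have hs0 : 0 < Real.log ρ := Real.log_pos hρ
  have hD : 0 ≤ D l ρ f / Real.log ρ := div_nonneg (D_nonneg hρ (by linarith) hl.ne') hs0.le
  have hρ0 : 0 < ρ := by linarith
  have hR : 0 ≤ (n : ℝ) ^ l / ρ ^ n := by positivity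
  suffices H : ∃ E, (∀ k, n + 1 ≤ k → rat (2 * l) k ≤ E) ∧ 2 * (5 / 2) ^ l * E ≤
      12 * if l ≤ 1 / 2 then 1 / Real.Gamma (2 * l) else 2 * l by
    obtain ⟨E, hE, hle⟩ := H
    refine (supNorm_err_le_absolute hf hρ hl hn hX hE).trans ?_
    rw [K]
    refine mul_le_mul_of_nonneg_right ?_ hR
    calc _ = (D l ρ f / Real.log ρ) * (2 * (5 / 2) ^ l * E) := by ring
      _ ≤ _ := mul_le_mul_of_nonneg_left hle hD
      _ = _ := by ring
  rcases le_or_gt l (1 / 2) with h | h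
  · refine ⟨_, fun k hk => rat_le_K_factor hl (by omega), ?_⟩
    rw [if_pos h]
    have hG := Real.Gamma_pos_of_pos (by linarith : 0 < 2 * l)
    refine mul_le_mul_of_nonneg_right ?_ (by positivity)
    have : (5 / 2 : ℝ) ^ l ≤ (5 / 2) ^ (1 : ℝ) :=
      Real.rpow_le_rpow_of_exponent_le (by norm_num) (by linarith)
    rw [Real.rpow_one] at this
    linarith
  · refine ⟨rat (2 * l) 2, fun k hk => rat_le_of_le (by linarith) (by norm_num) (by omega), ?_⟩
    rw [if_neg (not_le.mpr h)]
    have e1 : rat (2 * l) 2 = 2 * l * (2 * l + 1) * (4 : ℝ)⁻¹ ^ l := by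
      have e : ((2 : ℕ) : ℝ) ^ (1 - 2 * l) = 2 * (4 : ℝ)⁻¹ ^ l := by
        push_cast
        rw [Real.rpow_sub (by norm_num), Real.rpow_one, Real.rpow_mul (by norm_num),
          Real.inv_rpow (by norm_num), div_eq_mul_inv]
        norm_num
      rw [rat, e, al_succ', al_succ']
      norm_num
      ring
    have e2 : (5 / 2 : ℝ) ^ l * (4 : ℝ)⁻¹ ^ l = (5 / 8) ^ l := by
      rw [← Real.mul_rpow (by norm_num) (by norm_num)]; norm_num
    have e3 : (5 / 8 : ℝ) ^ l ≤ Real.exp (-(3 / 8 * l)) := by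
      rw [show -(3 / 8 * l) = -(3 / 8) * l by ring, Real.exp_mul]
      refine Real.rpow_le_rpow (by norm_num) ?_ hl.le
      have := Real.add_one_le_exp (-(3 / 8 : ℝ)); linarith
    have e4 : (2 * l + 1) * Real.exp (-(3 / 8 * l)) ≤ 6 := by
      have h1 := Real.add_one_le_exp (3 / 8 * l)
      have h2 : Real.exp (-(3 / 8 * l)) * Real.exp (3 / 8 * l) = 1 := by
        rw [← Real.exp_add]; simp
      nlinarith [Real.exp_pos (-(3 / 8 * l))]
    calc _ = 2 * (2 * l) * ((2 * l + 1) * ((5 / 2 : ℝ) ^ l * (4 : ℝ)⁻¹ ^ l)) := by rw [e1]; ring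
      _ = 2 * (2 * l) * ((2 * l + 1) * (5 / 8) ^ l) := by rw [e2]
      _ ≤ 2 * (2 * l) * 6 := by
          refine mul_le_mul_of_nonneg_left (le_trans ?_ e4) (by linarith)
          exact mul_le_mul_of_nonneg_left e3 (by linarith)
      _ = _ := by ring

end Gegenbauer

namespace Gegenbauer

open Polynomial.Chebyshev

variable {f : ℂ → ℂ} {l t : ℝ}

/-! ### Lower bounds for the function `1 / (x - ω)` -/

theorem le_supNorm_err (hf : ContinuousOn (fun x : ℝ => f x) (Icc (-1) 1)) (l : ℝ) (n : ℕ) {x : ℝ}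
    (hx : x ∈ Icc (-1 : ℝ) 1) : ‖err l n f x‖ ≤ supNorm (err l n f) := by
  have hp : Continuous (proj l n fun t : ℝ => f t) :=
    continuous_finsetSum _ fun k _ => continuous_const.mul
      (Complex.continuous_ofReal.comp (continuous_poly l k))
  have hc : ContinuousOn (fun x => ‖err l n f x‖) (Icc (-1) 1) := (hf.sub hp.continuousOn).norm
  exact le_csSup (isCompact_Icc.bddAbove_image hc) (mem_image_of_mem _ hx)

theorem summable_eval_U_mul_pow (ht0 : 0 ≤ t) (ht : t < 1) {x : ℝ} (hx : x ∈ Icc (-1 : ℝ) 1) :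
    Summable fun m : ℕ => (U ℝ m).eval x * t ^ m := by
  have h1 : Summable fun m : ℕ => ((m : ℝ) + 1) * t ^ m := by
    have h := summable_pow_mul_geometric_of_norm_lt_one (R := ℝ) 1
      (by rwa [Real.norm_of_nonneg ht0] : ‖t‖ < 1)
    refine (h.add (summable_geometric_of_lt_one ht0 ht)).congr fun m => by ring
  refine Summable.of_norm_bounded h1 fun m => ?_
  rw [norm_mul, Real.norm_eq_abs, norm_pow, Real.norm_of_nonneg ht0]
  exact mul_le_mul_of_nonneg_right (abs_eval_U_le m hx) (by positivity)

/-- The generating function of the U_m, obtained by summing their recurrence against powers of t. -/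
theorem tsum_eval_U_mul_pow (ht0 : 0 ≤ t) (ht : t < 1) {x : ℝ} (hx : x ∈ Icc (-1 : ℝ) 1) :
    (∑' m : ℕ, (U ℝ m).eval x * t ^ m) * (1 - 2 * x * t + t ^ 2) = 1 := by
  have h0 := summable_eval_U_mul_pow ht0 ht hx
  have h1 : Summable fun m : ℕ => (U ℝ ((m + 1 : ℕ) : ℤ)).eval x * t ^ (m + 1) :=
    (summable_nat_add_iff 1).mpr h0
  have e0 := h0.tsum_eq_zero_add
  have e1 := h1.tsum_eq_zero_add
  have e2 : ∀ m : ℕ, (U ℝ ((m + 1 + 1 : ℕ) : ℤ)).eval x * t ^ (m + 1 + 1) =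
      2 * x * t * ((U ℝ ((m + 1 : ℕ) : ℤ)).eval x * t ^ (m + 1)) -
        t ^ 2 * ((U ℝ (m : ℤ)).eval x * t ^ m) := by
    intro m
    have : ((m + 1 + 1 : ℕ) : ℤ) = (m : ℤ) + 2 := by push_cast; ring
    rw [this, U_add_two]
    simp
    ring
  rw [tsum_congr e2, (h1.mul_left _).tsum_sub (h0.mul_left _), tsum_mul_left, tsum_mul_left] at e1
  simp at e0 e1
  rw [e1] at e0
  generalize (∑' m : ℕ, (U ℝ m).eval x * t ^ m) = S at *
  generalize (∑' m : ℕ, (U ℝ ((m : ℤ) + 1)).eval x * t ^ (m + 1)) = S' at *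
  have : S' = S - 1 := by linarith
  subst this
  linarith

theorem hasSum_cauchyKernel (ht0 : 0 < t) (ht : t < 1) {x : ℝ} (hx : x ∈ Icc (-1 : ℝ) 1) :
    HasSum (fun m : ℕ => ((-2 * t ^ (m + 1) : ℝ) : ℂ) * ((U ℝ m).eval x : ℝ))
      (1 / ((x : ℂ) - ((t + t⁻¹) / 2 : ℝ))) := by
  have h := ((summable_eval_U_mul_pow ht0.le ht hx).hasSum.mul_left (-2 * t))
  have e := tsum_eval_U_mul_pow ht0.le ht hx
  generalize (∑' m : ℕ, (U ℝ m).eval x * t ^ m) = S at *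
  have hd : 1 - 2 * x * t + t ^ 2 ≠ 0 := right_ne_zero_of_mul_eq_one e
  have hv : 1 / (x - (t + t⁻¹) / 2) = -2 * t * S := by
    have e1 : x - (t + t⁻¹) / 2 = -(1 - 2 * x * t + t ^ 2) / (2 * t) := by field_simp; ring
    rw [e1, eq_div_of_mul_eq hd e]
    field_simp
  have hc := Complex.hasSum_ofReal.mpr h
  rw [← hv] at hc
  push_cast at hc ⊢
  refine hc.congr_fun fun m => ?_
  ring

/-- Since the Chebyshev coefficients are exactly geometric, the sum over j is the hypergeometric
factor at the single point t². -/
theorem acoef_cauchyKernel (hl : -1 / 2 < l) (h0 : l ≠ 0) (t : ℝ) (k : ℕ) :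
    acoef l (fun m => ((-2 * t ^ (m + 1) : ℝ) : ℂ)) k =
      ((-2 * t ^ (k + 1) * (al l k)⁻¹ : ℝ) : ℂ) * hyp l k ((t ^ 2 : ℝ) : ℂ) := by
  rw [acoef, hyp, ← tsum_mul_left]
  refine tsum_congr fun j => ?_
  rw [conn_eq (by linarith) h0]
  push_cast
  ring

theorem hasSum_err_cauchyKernel (hl : -1 / 2 < l) (h0 : l ≠ 0) (ht0 : 0 < t) (ht : t < 1)
    (n : ℕ) {x : ℝ} (hx : x ∈ Icc (-1 : ℝ) 1) {y : ℕ → ℝ}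
    (hy : ∀ k, hyp l k ((t ^ 2 : ℝ) : ℂ) = y k) :
    ∃ S : ℝ, err l n (fun z => 1 / (z - ((t + t⁻¹) / 2 : ℝ))) x = (S : ℂ) ∧
      HasSum (fun i => -2 * t ^ (i + (n + 1) + 1) * (al l (i + (n + 1)))⁻¹ * y (i + (n + 1)) *
        poly l (i + (n + 1)) x) S := by
  have h := hasSum_err hl h0 ht0.le ht (β := fun m => ((-2 * t ^ (m + 1) : ℝ) : ℂ)) (B := 2)
    (fun m => by
      rw [Complex.norm_real, Real.norm_eq_abs, abs_mul, abs_pow, abs_of_pos ht0, pow_succ]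
      norm_num
      nlinarith [pow_pos ht0 m])
    (fun x hx => hasSum_cauchyKernel ht0 ht hx) n hx
  simp only [acoef_cauchyKernel hl h0, hy] at h
  have h' : HasSum (fun i => ((-2 * t ^ (i + (n + 1) + 1) * (al l (i + (n + 1)))⁻¹ *
      y (i + (n + 1)) * poly l (i + (n + 1)) x : ℝ) : ℂ))
      (err l n (fun z => 1 / (z - ((t + t⁻¹) / 2 : ℝ))) x) := by
    refine h.congr_fun fun i => ?_
    push_cast
    ring
  refine ⟨_, ?_, Complex.reCLM.hasSum h'⟩
  have him := Complex.imCLM.hasSum h'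
  have : (fun i => Complex.imCLM ((-2 * t ^ (i + (n + 1) + 1) * (al l (i + (n + 1)))⁻¹ *
      y (i + (n + 1)) * poly l (i + (n + 1)) x : ℝ) : ℂ)) = fun _ => 0 := by
    ext i
    rw [Complex.imCLM_apply, Complex.ofReal_im]
  rw [this] at him
  have h1 := him.unique hasSum_zero
  apply Complex.ext
  · simp
  · rw [Complex.ofReal_im]; exact h1

theorem exists_le_inv_al_mul_al (hl : 0 < l) :
    ∃ c : ℝ, 0 < c ∧ ∀ k : ℕ, 1 ≤ k → c * (k : ℝ) ^ l ≤ (al l k)⁻¹ * al (2 * l) k := by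
  obtain ⟨m, _, hm, _, hb⟩ := exists_abs_al_bounds (a := 2 * l) (by linarith) (by positivity)
  obtain ⟨_, M, _, hM, hb'⟩ := exists_abs_al_bounds (a := l) (by linarith) hl.ne'
  refine ⟨m / M, by positivity, fun k hk => ?_⟩
  have h1 := (hb k hk).1
  have h2 := (hb' k hk).2
  have hk0 : (0 : ℝ) < k := by exact_mod_cast hk
  rw [abs_of_pos (al_pos (by positivity) _)] at h1
  have hal := al_pos hl k
  rw [abs_of_pos hal] at h2
  rw [inv_mul_eq_div, le_div_iff₀ hal]
  refine le_trans ?_ h1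
  calc _ ≤ m / M * (k : ℝ) ^ l * (M * (k : ℝ) ^ (l - 1)) := by gcongr
    _ = m * ((k : ℝ) ^ l * (k : ℝ) ^ (l - 1)) := by field_simp
    _ = _ := by rw [← Real.rpow_add hk0]; congr 2; ring

/-- At x = 1 all terms of the tail are negative, so the modulus of the error is at least that of its
first term, k = n + 1. -/
theorem exists_le_norm_err_one (hl : 0 < l) (ht0 : 0 < t) (ht : t < 1) :
    ∃ c : ℝ, 0 < c ∧ ∀ n : ℕ, 1 ≤ n →
      c * ((n : ℝ) ^ l * t ^ n) ≤ ‖err l n (fun z => 1 / (z - ((t + t⁻¹) / 2 : ℝ))) 1‖ := by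
  obtain ⟨c, hc, hy⟩ := exists_hyp_ofReal hl (w := t ^ 2) (by positivity) (by nlinarith)
  choose y hcy hy using hy
  obtain ⟨κ, hκ, hb⟩ := exists_le_inv_al_mul_al hl
  refine ⟨2 * t ^ 2 * c * κ, by positivity, fun n hn => ?_⟩
  obtain ⟨S, hS, h⟩ := hasSum_err_cauchyKernel (by linarith) hl.ne' ht0 ht n
    (x := 1) (by norm_num) hy
  have hn0 : (0 : ℝ) < n := by exact_mod_cast hn
  have hk : 1 ≤ 0 + (n + 1) := by omega
  rw [hS, Complex.norm_real, Real.norm_eq_abs]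
  have hterm : ∀ i, 0 ≤ 2 * t ^ (i + (n + 1) + 1) * (al l (i + (n + 1)))⁻¹ * y (i + (n + 1)) *
      poly l (i + (n + 1)) 1 := fun i => by
    have := al_pos hl (i + (n + 1))
    have := al_pos (by positivity : 0 < 2 * l) (i + (n + 1))
    have := hc.trans_le (hcy (i + (n + 1)))
    rw [poly_at_one']
    positivity
  have hneg := h.neg
  have hle := (le_hasSum (hneg.congr_fun fun i => by ring) 0 fun i _ => hterm i).trans (neg_le_abs S)
  refine le_trans ?_ hle
  rw [poly_at_one']
  have hq := hb _ hk
  have hnk : (n : ℝ) ^ l ≤ ((0 + (n + 1) : ℕ) : ℝ) ^ l :=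
    Real.rpow_le_rpow hn0.le (by push_cast; linarith) hl.le
  have hcy' := hcy (0 + (n + 1))
  calc _ = 2 * t ^ (0 + (n + 1) + 1) * c * (κ * (n : ℝ) ^ l) := by ring
    _ ≤ 2 * t ^ (0 + (n + 1) + 1) * y (0 + (n + 1)) *
        ((al l (0 + (n + 1)))⁻¹ * al (2 * l) (0 + (n + 1))) := by
          have : 0 ≤ y (0 + (n + 1)) := hc.le.trans hcy'
          have h3 : κ * (n : ℝ) ^ l ≤ (al l (0 + (n + 1)))⁻¹ * al (2 * l) (0 + (n + 1)) :=
            le_trans (by gcongr) hq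
          exact mul_le_mul (by gcongr) h3 (by positivity) (by positivity)
    _ = _ := by ring

theorem poly_odd_at_zero (hl : -1 / 2 < l) (i : ℕ) : poly l (2 * i + 1) 0 = 0 := by
  induction i with
  | zero => simp [poly_one hl]
  | succ i ih =>
    have h := poly_recurrence hl (2 * i + 1) 0
    rw [ih] at h
    have h2 : ((2 * i + 1 : ℕ) : ℝ) + 2 ≠ 0 := by positivity
    have := (mul_eq_zero.mp (h.trans (by ring))).resolve_left h2
    rwa [show 2 * (i + 1) + 1 = 2 * i + 1 + 2 by ring]

theorem al_neg (hl : -1 < l) (h0 : l < 0) (i : ℕ) : al l (i + 1) < 0 := by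
  induction i with
  | zero => rw [al_succ']; simpa using h0
  | succ i ih =>
    rw [al_succ']
    refine mul_neg_of_neg_of_pos ih (div_pos ?_ (by positivity))
    push_cast
    linarith [Nat.cast_nonneg (α := ℝ) i]

/-- Monotonicity of |C_{2i}(0)| i-dependence after division by the leading size of the coefficient,
needed for the alternating series at x = 0. With s = i + 1 the claim reduces to l² - l ≥ 0. -/
theorem inv_al_two_mul_mul_al_step (hl : -1 / 2 < l) (h0 : l < 0) (i : ℕ) :
    (al l (2 * (i + 1 + 1)))⁻¹ * al l (i + 1 + 1) ≤ (al l (2 * (i + 1)))⁻¹ * al l (i + 1) := by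
  have h1 := al_neg (by linarith) h0 i
  have h2 := al_neg (by linarith) h0 (2 * i + 1)
  rw [show 2 * (i + 1 + 1) = 2 * (i + 1) + 1 + 1 by ring, al_succ' l (2 * (i + 1) + 1),
    al_succ' l (2 * (i + 1)), al_succ' l (i + 1)]
  rw [show 2 * i + 1 + 1 = 2 * (i + 1) by ring] at h2
  push_cast
  have hi : (0 : ℝ) ≤ i := i.cast_nonneg
  have hp : 0 < (al l (2 * (i + 1)))⁻¹ * al l (i + 1) :=
    mul_pos_of_neg_of_neg (inv_lt_zero.mpr h2) h1
  generalize al l (2 * (i + 1)) = a at *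
  generalize al l (i + 1) = b at *
  have d1 : 0 < l + 2 * ((i : ℝ) + 1) := by linarith
  have d2 : 0 < l + (2 * ((i : ℝ) + 1) + 1) := by linarith
  have e : (a * ((l + 2 * ((i : ℝ) + 1)) / (2 * (i + 1) + 1)) *
      ((l + (2 * (i + 1) + 1)) / (2 * (i + 1) + 1 + 1)))⁻¹ * (b * ((l + (i + 1)) / (i + 1 + 1))) =
      a⁻¹ * b * (((l + (i + 1)) * (2 * (2 * (i + 1) + 1))) /
        ((l + 2 * (i + 1)) * (l + (2 * (i + 1) + 1)))) := by
    have := h2.ne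
    field_simp
    ring
  rw [e]
  refine mul_le_of_le_one_right hp.le ?_
  rw [div_le_one (by positivity)]
  nlinarith

theorem exists_le_inv_al_two_mul_mul_al (hl : -1 / 2 < l) (h0 : l < 0) :
    ∃ c : ℝ, 0 < c ∧ ∀ i : ℕ, c ≤ (al l (2 * (i + 1)))⁻¹ * al l (i + 1) := by
  obtain ⟨m, M, hm, hM, hb⟩ := exists_abs_al_bounds hl h0.ne
  refine ⟨m / M, by positivity, fun i => ?_⟩
  have h1 := al_neg (by linarith) h0 i
  have h2 := al_neg (by linarith) h0 (2 * i + 1)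
  rw [show 2 * i + 1 + 1 = 2 * (i + 1) by ring] at h2
  have b1 := (hb (i + 1) (by omega)).1
  have b2 := (hb (2 * (i + 1)) (by omega)).2
  rw [← abs_of_pos (mul_pos_of_neg_of_neg (inv_lt_zero.mpr h2) h1), abs_mul, abs_inv,
    inv_mul_eq_div, div_le_div_iff₀ hM (abs_pos.mpr h2.ne)]
  have b3 : ((2 * (i + 1) : ℕ) : ℝ) ^ (l - 1) ≤ ((i + 1 : ℕ) : ℝ) ^ (l - 1) :=
    Real.rpow_le_rpow_of_nonpos (by positivity)
      (by push_cast; linarith [Nat.cast_nonneg (α := ℝ) i]) (by linarith)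
  calc _ ≤ m * (M * ((i + 1 : ℕ) : ℝ) ^ (l - 1)) := by
        refine mul_le_mul_of_nonneg_left (b2.trans ?_) hm.le
        exact mul_le_mul_of_nonneg_left b3 hM.le
    _ = m * ((i + 1 : ℕ) : ℝ) ^ (l - 1) * M := by ring
    _ ≤ _ := mul_le_mul_of_nonneg_right b1 hM.le

/-- At x = 0 the odd degrees vanish and the even ones alternate in sign. The moduli b satisfy
b_{j+1} ≤ t² b_j, so the sum is at least b_0 - b_1 ≥ (1 - t²) b_0. -/
theorem exists_le_norm_err_zero (hl : -1 / 2 < l) (h0 : l < 0) (ht0 : 0 < t) (ht : t < 1) :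
    ∃ c : ℝ, 0 < c ∧ ∀ n : ℕ,
      c * t ^ n ≤ ‖err l n (fun z => 1 / (z - ((t + t⁻¹) / 2 : ℝ))) 0‖ := by
  have ht2 : t ^ 2 < 1 := by nlinarith
  obtain ⟨y, hya, hy1, hy⟩ := hyp_ofReal_of_neg hl h0 (w := t ^ 2) (by positivity) ht2
  obtain ⟨c, hc, hcle⟩ := exists_le_inv_al_two_mul_mul_al hl h0
  refine ⟨2 * ((1 - t ^ 2) * (t ^ 3 * c)), mul_pos two_pos
    (mul_pos (sub_pos.mpr ht2) (mul_pos (pow_pos ht0 3) hc)), fun n => ?_⟩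
  obtain ⟨S, hS, h⟩ := hasSum_err_cauchyKernel hl h0.ne ht0 ht n (x := 0) (by norm_num) hy
  rw [hS, Complex.norm_real, Real.norm_eq_abs]
  -- The first even degree beyond n is 2(i + 1); the upper bound n + 2 accounts for the exponent n +
  -- 3 of t below.
  obtain ⟨i, hi1, hi2⟩ : ∃ i, n + 1 ≤ 2 * (i + 1) ∧ 2 * (i + 1) ≤ n + 2 :=
    ⟨n / 2, by omega, by omega⟩
  set R : ℕ → ℝ := fun i => (al l (2 * (i + 1)))⁻¹ * al l (i + 1) with hR
  set b : ℕ → ℝ := fun j => t ^ (2 * (i + j + 1) + 1) * (R (i + j) * y (2 * (i + j + 1))) with hb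
  have hR0 : ∀ j, 0 < R j := fun j => hc.trans_le (hcle j)
  have hRa : ∀ j, R (j + 1) ≤ R j := fun j => inv_al_two_mul_mul_al_step hl h0 j
  have hstep : ∀ j, b (j + 1) ≤ t ^ 2 * b j := by
    intro j
    have e : b (j + 1) = t ^ 2 * (t ^ (2 * (i + j + 1) + 1) *
        (R (i + j + 1) * y (2 * (i + j + 1 + 1)))) := by
      simp only [hb, ← add_assoc]; ring
    rw [e]
    have h1 := hRa (i + j)
    have h2 := hya (show 2 * (i + j + 1) ≤ 2 * (i + j + 1 + 1) by omega)
    have h3 := hy1 (2 * (i + j + 1 + 1))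
    have := hR0 (i + j)
    have := hR0 (i + j + 1)
    simp only [hb]
    gcongr
  have hb0 : ∀ j, 0 < b j := fun j => by
    have := hR0 (i + j)
    have := hy1 (2 * (i + j + 1))
    simp only [hb]
    positivity
  have hanti : Antitone b := antitone_nat_of_succ_le fun j => (hstep j).trans
    (mul_le_of_le_one_left (hb0 j).le ht2.le)
  have hinj : Function.Injective fun j => 2 * (i + j + 1) - (n + 1) := fun a b hab => by
    simp only at hab; omega
  have hsum : HasSum (fun j => (-1) ^ j * b j) ((-1) ^ i * (S / 2)) := by
    rw [← hinj.hasSum_iff] at h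
    · have h' := (h.mul_left (1 / 2)).mul_left ((-1) ^ i)
      rw [show (-1) ^ i * (S / 2) = (-1) ^ i * (1 / 2 * S) by ring]
      refine h'.congr_fun fun j => ?_
      have hj : 2 * (i + j + 1) - (n + 1) + (n + 1) = 2 * (i + j + 1) := by omega
      simp only [Function.comp_apply, hj, poly_even_at_zero hl, hb, hR]
      have e : (-1 : ℝ) ^ i * (-1) ^ i = 1 := by rw [← mul_pow]; simp
      rw [pow_add (-1 : ℝ) (i + j) 1, pow_add (-1 : ℝ) i j]
      linear_combination (-1) ^ j * (t ^ (2 * (i + j + 1) + 1) *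
        ((al l (2 * (i + j + 1)))⁻¹ * al l (i + j + 1) * y (2 * (i + j + 1)))) * (-e)
    · intro k hk
      rcases Nat.even_or_odd' (k + (n + 1)) with ⟨j, hj | hj⟩
      · exact absurd ⟨j - (i + 1), by simp only; omega⟩ hk
      · rw [hj, poly_odd_at_zero hl, mul_zero]
  have halt := hanti.alternating_series_le_tendsto hsum.tendsto_sum_nat 1
  simp [Finset.sum_range_succ] at halt
  have h1 := hstep 0
  have h2 : t ^ (n + 3) * c ≤ b 0 := by
    have := hy1 (2 * (i + 0 + 1))
    have := hcle (i + 0)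
    have : t ^ (n + 3) ≤ t ^ (2 * (i + 0 + 1) + 1) := pow_le_pow_of_le_one ht0.le ht.le (by omega)
    simp only [hb]
    refine mul_le_mul this ?_ hc.le (by positivity)
    nlinarith [hR0 (i + 0)]
  have h3 : (1 - t ^ 2) * (t ^ (n + 3) * c) ≤ (1 - t ^ 2) * b 0 :=
    mul_le_mul_of_nonneg_left h2 (by linarith)
  have h4 : (-1) ^ i * (S / 2) ≤ |S| / 2 := by
    refine (le_abs_self _).trans_eq ?_
    rw [abs_mul, abs_div]; simp
  calc _ = 2 * ((1 - t ^ 2) * (t ^ (n + 3) * c)) := by ring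
    _ ≤ _ := by simp only [zero_add] at *; linarith

end Gegenbauer

namespace Gegenbauer

open Polynomial.Chebyshev

variable {ρ l : ℝ}

/-! ### Lacunary Chebyshev series -/

theorem closure_region_subset (ρ : ℝ) :
    closure (region ρ) ⊆ {z | ‖z - 1‖ + ‖z + 1‖ ≤ ρ + ρ⁻¹} :=
  closure_minimal (fun z hz => (show ‖z - 1‖ + ‖z + 1‖ ≤ ρ + ρ⁻¹ from le_of_lt hz))
    (isClosed_le (by fun_prop) continuous_const)

/-- The two preimages z ± √(z² - 1) have product 1, so one of them has modulus at least 1. -/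
theorem exists_joukowski_eq (z : ℂ) : ∃ u : ℂ, 1 ≤ ‖u‖ ∧ joukowski u = z := by
  obtain ⟨s, hs⟩ := IsAlgClosed.exists_pow_nat_eq (z ^ 2 - 1) (n := 2) (by norm_num)
  have hmul : (z + s) * (z - s) = 1 := by linear_combination -hs
  have hJ : joukowski (z + s) = z := by
    rw [joukowski, inv_eq_of_mul_eq_one_right hmul]; ring
  have hJ' : joukowski (z - s) = z := by
    rw [joukowski, inv_eq_of_mul_eq_one_right ((mul_comm _ _).trans hmul)]; ring
  rcases le_or_gt 1 ‖z + s‖ with h | h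
  · exact ⟨_, h, hJ⟩
  · refine ⟨_, ?_, hJ'⟩
    have hn : ‖z + s‖ * ‖z - s‖ = 1 := by rw [← norm_mul, hmul, norm_one]
    nlinarith [norm_nonneg (z - s), norm_nonneg (z + s)]

theorem exists_joukowski_of_mem_closure (hρ : 1 < ρ) {z : ℂ} (hz : z ∈ closure (region ρ)) :
    ∃ u : ℂ, 1 ≤ ‖u‖ ∧ ‖u‖ ≤ ρ ∧ joukowski u = z := by
  obtain ⟨u, hu, rfl⟩ := exists_joukowski_eq z
  refine ⟨u, hu, ?_, rfl⟩
  have h : ‖joukowski u - 1‖ + ‖joukowski u + 1‖ ≤ ρ + ρ⁻¹ := closure_region_subset ρ hz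
  rw [norm_joukowski_sub_add (ne_zero_of_one_le_norm hu)] at h
  by_contra! h'
  exact absurd (add_inv_strictMono hρ.le h') (not_lt.mpr h)

theorem eval_U_succ_joukowski {u : ℂ} (hu : u ≠ 0) (m : ℕ) :
    (U ℂ ((m : ℤ) + 1)).eval (joukowski u) =
      u * (U ℂ m).eval (joukowski u) + u⁻¹ ^ (m + 1) := by
  induction m with
  | zero => simp [joukowski]; ring
  | succ m ih =>
    rw [show ((m + 1 : ℕ) : ℤ) + 1 = (m : ℤ) + 2 by push_cast; ring, U_add_two]
    push_cast
    simp only [Polynomial.eval_sub, Polynomial.eval_mul, Polynomial.eval_ofNat, Polynomial.eval_X]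
    have hc : u * u⁻¹ = 1 := mul_inv_cancel₀ hu
    have e : 2 * joukowski u = u + u⁻¹ := by rw [joukowski]; ring
    rw [e]
    linear_combination u⁻¹ * ih + (U ℂ m).eval (joukowski u) * hc

/-- In the Joukowski variable U_m is the sum of u^{m-2j}, and the recursion U_{m+1} = u U_m +
u^{-m-1} gives the bound (ρ^{m+1} - 1)/(ρ - 1). -/
theorem norm_eval_U_le (hρ : 1 < ρ) {z : ℂ} (hz : z ∈ closure (region ρ)) (m : ℕ) :
    ‖(U ℂ m).eval z‖ ≤ ρ / (ρ - 1) * ρ ^ m := by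
  obtain ⟨u, hu1, hu, rfl⟩ := exists_joukowski_of_mem_closure hρ hz
  have hu0 := ne_zero_of_one_le_norm hu1
  have h : ‖(U ℂ m).eval (joukowski u)‖ * (ρ - 1) ≤ ρ ^ (m + 1) - 1 := by
    induction m with
    | zero => simp
    | succ m ih =>
      push_cast
      rw [eval_U_succ_joukowski hu0]
      have h1 : ‖u⁻¹ ^ (m + 1)‖ ≤ 1 := by
        rw [norm_pow, norm_inv]
        exact pow_le_one₀ (by positivity) (inv_le_one_of_one_le₀ hu1)
      have h2 : ‖u * (U ℂ m).eval (joukowski u) + u⁻¹ ^ (m + 1)‖ ≤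
          ρ * ‖(U ℂ m).eval (joukowski u)‖ + 1 := by
        refine (norm_add_le _ _).trans (add_le_add ?_ h1)
        rw [norm_mul]
        exact mul_le_mul_of_nonneg_right hu (norm_nonneg _)
      calc _ ≤ (ρ * ‖(U ℂ m).eval (joukowski u)‖ + 1) * (ρ - 1) :=
            mul_le_mul_of_nonneg_right h2 (by linarith)
        _ = ρ * (‖(U ℂ m).eval (joukowski u)‖ * (ρ - 1)) + (ρ - 1) := by ring
        _ ≤ ρ * (ρ ^ (m + 1) - 1) + (ρ - 1) := by gcongr
        _ = _ := by ring
  rw [div_mul_eq_mul_div, le_div_iff₀ (by linarith)]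
  refine h.trans ?_
  rw [pow_succ']; linarith

/-- A rapidly growing sequence of even degrees. -/
def lacDeg (i : ℕ) : ℕ := 2 * 2 ^ i ^ 2

theorem lacDeg_strictMono : StrictMono lacDeg := fun i j h => by
  unfold lacDeg
  have : i ^ 2 < j ^ 2 := Nat.pow_lt_pow_left h (by norm_num)
  have := Nat.pow_lt_pow_right (a := 2) (by norm_num) this
  omega

theorem two_le_lacDeg (i : ℕ) : 2 ≤ lacDeg i := by
  have := Nat.one_le_two_pow (n := i ^ 2)
  unfold lacDeg; omega

/-- The coefficients, in Chebyshev polynomials of the second kind, of a lacunary series. -/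
def lacCoef (q ρ : ℝ) (m : ℕ) : ℝ := Function.extend lacDeg (fun i => q ^ i * ρ⁻¹ ^ lacDeg i) 0 m

theorem lacCoef_lacDeg (q ρ : ℝ) (i : ℕ) : lacCoef q ρ (lacDeg i) = q ^ i * ρ⁻¹ ^ lacDeg i :=
  lacDeg_strictMono.injective.extend_apply _ _ _

theorem lacCoef_eq_zero (q ρ : ℝ) {m : ℕ} (h : m ∉ range lacDeg) : lacCoef q ρ m = 0 :=
  Function.extend_apply' _ _ _ fun ⟨i, hi⟩ => h ⟨i, hi⟩

/-- The hypothesis says that at m only gap indices from i on can occur. It yields the gain q^{i+1}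
for degrees beyond `lacDeg i`. -/
theorem abs_lacCoef_le {q : ℝ} (hq0 : 0 ≤ q) (hq1 : q ≤ 1) (hρ : 1 < ρ) {i m : ℕ}
    (h : ∀ i', lacDeg i' = m → i ≤ i') : |lacCoef q ρ m| ≤ q ^ i * ρ⁻¹ ^ m := by
  have hρ0 : 0 < ρ := by linarith
  by_cases hm : m ∈ range lacDeg
  · obtain ⟨j, rfl⟩ := hm
    rw [lacCoef_lacDeg, abs_of_nonneg (by positivity)]
    exact mul_le_mul_of_nonneg_right (pow_le_pow_of_le_one hq0 hq1 (h j rfl)) (by positivity)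
  · rw [lacCoef_eq_zero q ρ hm, abs_zero]
    positivity

/-- A function on the closed region bounded by the Bernstein ellipse given by a lacunary series. -/
def lacFun (q ρ : ℝ) (z : ℂ) : ℂ :=
  ∑' i, ((q ^ i * ρ⁻¹ ^ lacDeg i : ℝ) : ℂ) * (U ℂ (lacDeg i)).eval z

theorem norm_lac_term_le {q : ℝ} (hq0 : 0 ≤ q) (hρ : 1 < ρ) (i : ℕ) {z : ℂ}
    (hz : z ∈ closure (region ρ)) :
    ‖((q ^ i * ρ⁻¹ ^ lacDeg i : ℝ) : ℂ) * (U ℂ (lacDeg i)).eval z‖ ≤ ρ / (ρ - 1) * q ^ i := by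
  have hρ0 : 0 < ρ := by linarith
  rw [norm_mul, Complex.norm_real, Real.norm_of_nonneg (by positivity)]
  calc _ ≤ q ^ i * ρ⁻¹ ^ lacDeg i * (ρ / (ρ - 1) * ρ ^ lacDeg i) :=
        mul_le_mul_of_nonneg_left (norm_eval_U_le hρ hz _) (by positivity)
    _ = ρ / (ρ - 1) * q ^ i * (ρ⁻¹ * ρ) ^ lacDeg i := by rw [mul_pow]; ring
    _ = _ := by rw [inv_mul_cancel₀ hρ0.ne', one_pow, mul_one]

theorem summable_lac_bound {q : ℝ} (hq0 : 0 ≤ q) (hq1 : q < 1) (ρ : ℝ) :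
    Summable fun i => ρ / (ρ - 1) * q ^ i :=
  (summable_geometric_of_lt_one hq0 hq1).mul_left _

theorem diffContOnCl_lacFun {q : ℝ} (hq0 : 0 ≤ q) (hq1 : q < 1) (hρ : 1 < ρ) :
    DiffContOnCl ℂ (lacFun q ρ) (region ρ) := by
  have hc : ∀ i, Differentiable ℂ fun z => ((q ^ i * ρ⁻¹ ^ lacDeg i : ℝ) : ℂ) *
      (U ℂ (lacDeg i)).eval z := fun i =>
    (differentiable_const _).mul (Polynomial.differentiable _)
  constructor
  · exact Complex.differentiableOn_tsum_of_summable_norm (summable_lac_bound hq0 hq1 ρ)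
      (fun i => (hc i).differentiableOn) (isOpen_region ρ)
      fun i w hw => norm_lac_term_le hq0 hρ i (subset_closure hw)
  · exact continuousOn_tsum (fun i => (hc i).continuous.continuousOn)
      (summable_lac_bound hq0 hq1 ρ) fun i w hw => norm_lac_term_le hq0 hρ i hw

theorem ofReal_mem_closure_region (hρ : 1 < ρ) {x : ℝ} (hx : x ∈ Icc (-1 : ℝ) 1) :
    (x : ℂ) ∈ closure (region ρ) := by
  refine subset_closure ?_
  have h1 : ‖(x : ℂ) - 1‖ = 1 - x := by
    rw [← Complex.ofReal_one, ← Complex.ofReal_sub, Complex.norm_real, Real.norm_eq_abs,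
      abs_sub_comm, abs_of_nonneg (by linarith [hx.2])]
  have h2 : ‖(x : ℂ) + 1‖ = x + 1 := by
    rw [← Complex.ofReal_one, ← Complex.ofReal_add, Complex.norm_real, Real.norm_eq_abs,
      abs_of_nonneg (by linarith [hx.1])]
  change ‖(x : ℂ) - 1‖ + ‖(x : ℂ) + 1‖ < ρ + ρ⁻¹
  rw [h1, h2]
  have := add_inv_strictMono le_rfl hρ
  norm_num at this
  linarith

theorem hasSum_lacFun {q : ℝ} (hq0 : 0 ≤ q) (hq1 : q < 1) (hρ : 1 < ρ) {x : ℝ}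
    (hx : x ∈ Icc (-1 : ℝ) 1) :
    HasSum (fun m : ℕ => (lacCoef q ρ m : ℂ) * ((U ℝ m).eval x : ℝ)) (lacFun q ρ x) := by
  rw [← lacDeg_strictMono.injective.hasSum_iff]
  · have h : Summable fun i => ((q ^ i * ρ⁻¹ ^ lacDeg i : ℝ) : ℂ) * (U ℂ (lacDeg i)).eval (x : ℂ) :=
      Summable.of_norm_bounded (summable_lac_bound hq0 hq1 ρ) fun i =>
        norm_lac_term_le hq0 hρ i (ofReal_mem_closure_region hρ hx)
    refine h.hasSum.congr_fun fun i => ?_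
    simp only [Function.comp_apply, lacCoef_lacDeg, complex_ofReal_eval_U]
  · intro m hm
    rw [lacCoef_eq_zero q ρ hm]
    simp

/-- In the sum for the coefficient of degree `lacDeg i`, the term j = 0 carries qⁱ and all others
carry at least one more factor q. For q small they cannot cancel more than half of the first term.
-/
theorem exists_le_norm_coeff_lacFun (hl : -1 / 2 < l) (h0 : l ≠ 0) (hρ : 1 < ρ) :
    ∃ q : ℝ, 0 < q ∧ q < 1 ∧ ∀ i, q ^ i / ρ ^ lacDeg i / 2 * |al l (lacDeg i)|⁻¹ ≤
      ‖coeff l (fun x : ℝ => lacFun q ρ x) (lacDeg i)‖ := by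
  have hρ0 : 0 < ρ := by linarith
  have hr0 : 0 ≤ ρ⁻¹ := by positivity
  have hr1 : ρ⁻¹ < 1 := inv_lt_one_of_one_lt₀ hρ
  have hS := summable_maj l (w := ρ⁻¹ ^ 2) (by positivity) (by nlinarith)
  set S := ∑' j, maj l j * (ρ⁻¹ ^ 2) ^ j with hSdef
  have hS0 : 0 ≤ S := tsum_nonneg fun j => mul_nonneg (maj_nonneg hl j) (by positivity)
  -- Chosen so that q S ≤ 1/2, where S majorises the connection coefficients uniformly in the
  -- degree; q is thus independent of i.
  set q : ℝ := 1 / (2 * (S + 1)) with hq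
  have hq0 : 0 < q := by positivity
  have hqS : q * S ≤ 1 / 2 := by
    rw [hq, div_mul_eq_mul_div, div_le_div_iff₀ (by positivity) (by norm_num)]
    linarith
  have hq1 : q < 1 := by rw [hq, div_lt_one (by positivity)]; linarith
  refine ⟨q, hq0, hq1, fun i => ?_⟩
  have hβ : ∀ m, ‖(lacCoef q ρ m : ℂ)‖ ≤ 1 * ρ⁻¹ ^ m := fun m => by
    rw [Complex.norm_real, Real.norm_eq_abs]
    simpa using abs_lacCoef_le hq0.le hq1.le hρ (i := 0) (m := m) fun _ _ => Nat.zero_le _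
  rw [coeff_eq_acoef hl h0 hr0 hr1 hβ (fun x hx => hasSum_lacFun hq0.le hq1 hρ hx)]
  have h := hasSum_acoef hl h0 hr0 hr1 hβ (lacDeg i)
  have hsplit := h.summable.tsum_eq_zero_add
  rw [h.tsum_eq] at hsplit
  set A := |al l (lacDeg i)|⁻¹ with hA
  have htail : ‖∑' j, (lacCoef q ρ (lacDeg i + 2 * (j + 1)) : ℂ) * (conn l (lacDeg i) (j + 1) : ℂ)‖ ≤
      q ^ (i + 1) * ρ⁻¹ ^ lacDeg i * A * S := by
    have h1 : Summable fun j => maj l (j + 1) * (ρ⁻¹ ^ 2) ^ (j + 1) :=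
      (summable_nat_add_iff 1).mpr hS
    have h2 : ∑' j, maj l (j + 1) * (ρ⁻¹ ^ 2) ^ (j + 1) ≤ S := by
      have e := hS.tsum_eq_zero_add
      have : 0 ≤ maj l 0 * (ρ⁻¹ ^ 2) ^ 0 := mul_nonneg (maj_nonneg hl 0) (by positivity)
      rw [hSdef, e]; linarith
    refine (tsum_of_norm_bounded (h1.hasSum.mul_left (q ^ (i + 1) * ρ⁻¹ ^ lacDeg i * A))
      fun j => ?_).trans (mul_le_mul_of_nonneg_left h2 (by positivity))
    rw [norm_mul, Complex.norm_real, Real.norm_eq_abs]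
    calc _ ≤ (q ^ (i + 1) * ρ⁻¹ ^ (lacDeg i + 2 * (j + 1))) * (A * maj l (j + 1)) := by
          refine mul_le_mul (abs_lacCoef_le hq0.le hq1.le hρ fun i' hi' => ?_)
            (norm_conn_le hl h0 _ _) (norm_nonneg _) (by positivity)
          exact lacDeg_strictMono.lt_iff_lt.mp (by omega)
      _ = _ := by rw [pow_add ρ⁻¹, pow_mul]; ring
  have hhead : ‖(lacCoef q ρ (lacDeg i + 2 * 0) : ℂ) * (conn l (lacDeg i) 0 : ℂ)‖ =
      q ^ i * ρ⁻¹ ^ lacDeg i * A := by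
    rw [mul_zero, add_zero, lacCoef_lacDeg, conn_eq (by linarith) h0, rr_zero, al_zero, norm_mul,
      Complex.norm_real, Complex.norm_real, Real.norm_of_nonneg (by positivity), Real.norm_eq_abs]
    simp [hA]
  rw [hsplit]
  have h3 := norm_sub_le_norm_add ((lacCoef q ρ (lacDeg i + 2 * 0) : ℂ) * (conn l (lacDeg i) 0 : ℂ))
    (∑' j, (lacCoef q ρ (lacDeg i + 2 * (j + 1)) : ℂ) * (conn l (lacDeg i) (j + 1) : ℂ))
  rw [hhead] at h3
  refine le_trans ?_ h3
  have h4 : q ^ (i + 1) * ρ⁻¹ ^ lacDeg i * A * S ≤ q ^ i * ρ⁻¹ ^ lacDeg i * A * (1 / 2) := by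
    calc _ = q ^ i * ρ⁻¹ ^ lacDeg i * A * (q * S) := by ring
      _ ≤ _ := mul_le_mul_of_nonneg_left hqS (by positivity)
  calc _ = q ^ i * ρ⁻¹ ^ lacDeg i * A * (1 / 2) := by rw [inv_pow]; ring
    _ ≤ _ := by linarith

/-- Two consecutive projections differ by a single term of the expansion. -/
theorem norm_coeff_mul_le {f : ℂ → ℂ} (hf : ContinuousOn (fun x : ℝ => f x) (Icc (-1) 1)) (l : ℝ)
    (n : ℕ) {x : ℝ} (hx : x ∈ Icc (-1 : ℝ) 1) :
    ‖coeff l (fun x : ℝ => f x) (n + 1)‖ * |poly l (n + 1) x| ≤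
      supNorm (err l n f) + supNorm (err l (n + 1) f) := by
  have e : coeff l (fun x : ℝ => f x) (n + 1) * ((poly l (n + 1) x : ℝ) : ℂ) =
      err l n f x - err l (n + 1) f x := by
    rw [err, err, proj, proj, Finset.sum_range_succ _ (n + 1)]; ring
  rw [← Real.norm_eq_abs, ← Complex.norm_real, ← norm_mul, e]
  exact (norm_sub_le _ _).trans (add_le_add (le_supNorm_err hf l n hx) (le_supNorm_err hf l _ hx))

/-- This is why the degrees contain 2^{i²}: with b = 2^γ the product is at least (q bⁱ)ⁱ, whose base
tends to infinity for every γ > 0. -/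
theorem tendsto_pow_mul_lacDeg_rpow {q γ : ℝ} (hq : 0 < q) (hγ : 0 < γ) :
    Tendsto (fun i => q ^ i * (lacDeg i : ℝ) ^ γ) atTop atTop := by
  set b : ℝ := 2 ^ γ with hb
  have hb1 : 1 < b := Real.one_lt_rpow (by norm_num) hγ
  have h1 : Tendsto (fun i => q * b ^ i) atTop atTop :=
    (tendsto_pow_atTop_atTop_of_one_lt hb1).const_mul_atTop hq
  refine tendsto_atTop_mono' _ ?_ (tendsto_pow_atTop_atTop_of_one_lt (one_lt_two (α := ℝ)))
  filter_upwards [h1.eventually_ge_atTop 2] with i hi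
  have h2 : b ^ i ^ 2 ≤ (lacDeg i : ℝ) ^ γ := by
    rw [hb, ← Real.rpow_natCast, ← Real.rpow_mul (by norm_num), mul_comm, Real.rpow_mul (by norm_num),
      Real.rpow_natCast]
    refine Real.rpow_le_rpow (by positivity) ?_ hγ.le
    rw [lacDeg]; push_cast
    linarith [pow_pos (two_pos (α := ℝ)) (i ^ 2)]
  calc (2 : ℝ) ^ i ≤ (q * b ^ i) ^ i := pow_le_pow_left₀ (by norm_num) hi i
    _ = q ^ i * b ^ i ^ 2 := by rw [mul_pow, ← pow_mul, sq]
    _ ≤ _ := mul_le_mul_of_nonneg_left h2 (by positivity)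

theorem frequently_lt_of_lacDeg_bound (hρ : 1 < ρ) {q κ p : ℝ} (hq : 0 < q) (hκ : 0 < κ)
    {E : ℕ → ℝ} (hE : ∀ i, κ * (q ^ i * (lacDeg i : ℝ) ^ p / ρ ^ lacDeg i) ≤
      E (lacDeg i - 1) + E (lacDeg i)) {γ : ℝ} (c : ℝ) (hγ : 0 < γ) :
    ∃ᶠ n : ℕ in atTop, c * ((n : ℝ) ^ (p - γ) / ρ ^ n) < E n := by
  have hρ0 : 0 < ρ := by linarith
  rw [Filter.frequently_atTop]
  intro N
  by_contra! H
  have H' : ∀ n, N ≤ n → E n ≤ |c| * ((n : ℝ) ^ (p - γ) / ρ ^ n) := fun n hn =>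
    (H n hn).trans (mul_le_mul_of_nonneg_right (le_abs_self c) (by positivity))
  have ht := ((tendsto_pow_mul_lacDeg_rpow hq hγ).const_mul_atTop hκ).eventually_gt_atTop
    (|c| * (2 ^ |p - γ| * ρ + 1))
  obtain ⟨i, hi, hiN⟩ := (ht.and (lacDeg_strictMono.tendsto_atTop.eventually_ge_atTop (N + 1))).exists
  have h2 := two_le_lacDeg i
  have hEi := hE i
  obtain ⟨n, hn⟩ : ∃ n, lacDeg i = n + 1 := ⟨lacDeg i - 1, by omega⟩
  rw [hn] at hi hiN h2 hEi
  rw [Nat.add_sub_cancel] at hEi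
  have hn0 : (0 : ℝ) < n := by exact_mod_cast (by omega : 0 < n)
  have hm0 : (0 : ℝ) < (n + 1 : ℕ) := by positivity
  have e1 := H' n (by omega)
  have e2 := H' (n + 1) (by omega)
  -- The exponent p - γ may have either sign; for a negative one the comparison uses n + 1 ≤ 2n.
  have e3 : (n : ℝ) ^ (p - γ) ≤ 2 ^ |p - γ| * ((n + 1 : ℕ) : ℝ) ^ (p - γ) := by
    have h1n : (1 : ℝ) ≤ n := by exact_mod_cast (by omega : 1 ≤ n)
    rcases le_or_gt 0 (p - γ) with h | h
    · have h1 : (1 : ℝ) ≤ 2 ^ |p - γ| := Real.one_le_rpow (by norm_num) (abs_nonneg _)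
      have h3 : (n : ℝ) ^ (p - γ) ≤ ((n + 1 : ℕ) : ℝ) ^ (p - γ) :=
        Real.rpow_le_rpow hn0.le (by push_cast; linarith) h
      exact h3.trans (le_mul_of_one_le_left (by positivity) h1)
    · rw [abs_of_neg h, Real.rpow_neg (by norm_num), ← Real.inv_rpow (by norm_num),
        ← Real.mul_rpow (by norm_num) hm0.le]
      exact Real.rpow_le_rpow_of_nonpos (by positivity) (by push_cast; linarith) h.le
  have e4 : ((n + 1 : ℕ) : ℝ) ^ p = ((n + 1 : ℕ) : ℝ) ^ (p - γ) * ((n + 1 : ℕ) : ℝ) ^ γ := by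
    rw [← Real.rpow_add hm0]; congr 1; ring
  have hP : 0 < ((n + 1 : ℕ) : ℝ) ^ (p - γ) := by positivity
  have e5 : κ * (q ^ i * ((n + 1 : ℕ) : ℝ) ^ p / ρ ^ (n + 1)) ≤
      |c| * (2 ^ |p - γ| * ρ + 1) * (((n + 1 : ℕ) : ℝ) ^ (p - γ) / ρ ^ (n + 1)) := by
    refine (hEi.trans (add_le_add e1 e2)).trans ?_
    have : (n : ℝ) ^ (p - γ) / ρ ^ n ≤
        2 ^ |p - γ| * ((n + 1 : ℕ) : ℝ) ^ (p - γ) * ρ / ρ ^ (n + 1) := by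
      rw [pow_succ, mul_div_mul_right _ _ hρ0.ne']
      gcongr
    calc _ ≤ |c| * (2 ^ |p - γ| * ((n + 1 : ℕ) : ℝ) ^ (p - γ) * ρ / ρ ^ (n + 1)) +
          |c| * (((n + 1 : ℕ) : ℝ) ^ (p - γ) / ρ ^ (n + 1)) := by gcongr
      _ = _ := by ring
  rw [e4] at e5
  have e6 : κ * (q ^ i * ((n + 1 : ℕ) : ℝ) ^ γ) * (((n + 1 : ℕ) : ℝ) ^ (p - γ) / ρ ^ (n + 1)) ≤
      |c| * (2 ^ |p - γ| * ρ + 1) * (((n + 1 : ℕ) : ℝ) ^ (p - γ) / ρ ^ (n + 1)) := by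
    refine le_trans (le_of_eq ?_) e5
    ring
  exact absurd (le_of_mul_le_mul_right e6 (by positivity)) (not_le.mpr hi)

theorem continuousOn_ofReal {f : ℂ → ℂ} (hf : DiffContOnCl ℂ f (region ρ)) (hρ : 1 < ρ) :
    ContinuousOn (fun x : ℝ => f x) (Icc (-1) 1) :=
  hf.continuousOn.comp Complex.continuous_ofReal.continuousOn
    fun _ hx => ofReal_mem_closure_region hρ hx

/-- It suffices to have a point x at which |C_d(x)| k-th coefficient normalisation included is of
order d^p along the lacunary degrees d: x = 1, p = l for l > 0, and x = 0, p = 0 for l < 0, where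
the degrees must be even. -/
theorem exists_frequently_lt_supNorm_err (hl : -1 / 2 < l) (h0 : l ≠ 0) (hρ : 1 < ρ) {κ p x : ℝ}
    (hκ : 0 < κ) (hx : x ∈ Icc (-1 : ℝ) 1)
    (h : ∀ i, κ * (lacDeg i : ℝ) ^ p ≤ |al l (lacDeg i)|⁻¹ * |poly l (lacDeg i) x|) :
    ∃ f : ℂ → ℂ, DiffContOnCl ℂ f (region ρ) ∧ ∀ γ c : ℝ, 0 < γ → ∃ᶠ n : ℕ in atTop,
      c * ((n : ℝ) ^ (p - γ) / ρ ^ n) < supNorm (err l n f) := by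
  have hρ0 : 0 < ρ := by linarith
  obtain ⟨q, hq0, hq1, hq⟩ := exists_le_norm_coeff_lacFun hl h0 hρ
  have hf := diffContOnCl_lacFun hq0.le hq1 hρ
  refine ⟨_, hf, fun γ c hγ => frequently_lt_of_lacDeg_bound hρ hq0 (half_pos hκ) (fun i => ?_) c hγ⟩
  have h2 := two_le_lacDeg i
  have h1 := norm_coeff_mul_le (continuousOn_ofReal hf hρ) l (lacDeg i - 1) hx
  rw [Nat.sub_add_cancel (by omega)] at h1
  refine le_trans ?_ h1
  calc _ = q ^ i / ρ ^ lacDeg i / 2 * (κ * (lacDeg i : ℝ) ^ p) := by ring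
    _ ≤ q ^ i / ρ ^ lacDeg i / 2 * (|al l (lacDeg i)|⁻¹ * |poly l (lacDeg i) x|) :=
        mul_le_mul_of_nonneg_left (h i) (by positivity)
    _ = q ^ i / ρ ^ lacDeg i / 2 * |al l (lacDeg i)|⁻¹ * |poly l (lacDeg i) x| := by ring
    _ ≤ _ := mul_le_mul_of_nonneg_right (hq i) (abs_nonneg _)

theorem exists_frequently_lt_supNorm_err_of_pos (hl : 0 < l) (hρ : 1 < ρ) :
    ∃ f : ℂ → ℂ, DiffContOnCl ℂ f (region ρ) ∧ ∀ γ c : ℝ, 0 < γ → ∃ᶠ n : ℕ in atTop,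
      c * ((n : ℝ) ^ (l - γ) / ρ ^ n) < supNorm (err l n f) := by
  obtain ⟨κ, hκ, h⟩ := exists_le_inv_al_mul_al hl
  refine exists_frequently_lt_supNorm_err (by linarith) hl.ne' hρ (x := 1) hκ (by norm_num)
    fun i => ?_
  rw [poly_at_one', abs_of_pos (al_pos hl _), abs_of_pos (al_pos (by positivity) _)]
  exact h _ (by linarith [two_le_lacDeg i])

theorem exists_frequently_lt_supNorm_err_of_neg (hl : -1 / 2 < l) (h0 : l < 0) (hρ : 1 < ρ) :
    ∃ f : ℂ → ℂ, DiffContOnCl ℂ f (region ρ) ∧ ∀ γ c : ℝ, 0 < γ → ∃ᶠ n : ℕ in atTop,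
      c * ((n : ℝ) ^ (-γ) / ρ ^ n) < supNorm (err l n f) := by
  obtain ⟨κ, hκ, h⟩ := exists_le_inv_al_two_mul_mul_al hl h0
  have := exists_frequently_lt_supNorm_err hl h0.ne hρ (x := 0) (p := 0) hκ (by norm_num)
    fun i => ?_
  · simpa only [zero_sub] using this
  · rw [lacDeg, poly_even_at_zero hl, Real.rpow_zero, mul_one, abs_mul, abs_neg_one_pow, one_mul,
      ← abs_inv, ← abs_mul]
    have h1 := h (2 ^ i ^ 2 - 1)
    rw [Nat.sub_add_cancel Nat.one_le_two_pow] at h1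
    exact h1.trans (le_abs_self _)

end Gegenbauer

/-! ### Locating the pole, and assembly of the theorem -/

namespace Gegenbauer

/-- The preimage of a real number `ω > 1` under the Joukowski map on the unit interval. -/
theorem exists_inv_joukowski {ω : ℝ} (hω : 1 < ω) :
    ∃ t : ℝ, 0 < t ∧ t < 1 ∧ (t + t⁻¹) / 2 = ω ∧ ω + √(ω ^ 2 - 1) = t⁻¹ := by
  have h := Real.sq_sqrt (show 0 ≤ ω ^ 2 - 1 by nlinarith)
  have h0 := Real.sqrt_nonneg (ω ^ 2 - 1)
  have hmul : (ω + √(ω ^ 2 - 1)) * (ω - √(ω ^ 2 - 1)) = 1 := by linear_combination -h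
  have hinv := inv_eq_of_mul_eq_one_right hmul
  refine ⟨(ω + √(ω ^ 2 - 1))⁻¹, inv_pos.mpr (by linarith), inv_lt_one_of_one_lt₀ (by linarith),
    ?_, (inv_inv _).symm⟩
  rw [inv_inv, hinv]
  ring

end Gegenbauer

end

theorem theorem4p2 :
    -- (i), with an absolute constant `c`
    (∃ c : ℝ, 0 < c ∧ ∀ (l ρ : ℝ) (f : ℂ → ℂ) (n : ℕ), 0 < l → 1 < ρ →
      DiffContOnCl ℂ f (Gegenbauer.region ρ) → 1 ≤ n → ⌊l / Real.log ρ⌋₊ ≤ n →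
      Gegenbauer.supNorm (Gegenbauer.err l n f) ≤
        Gegenbauer.K c l ρ f * ((n : ℝ) ^ l / ρ ^ n)) ∧
    -- (i), the constant `c` is asymptotically `1`
    (∀ l ε : ℝ, 0 < l → 0 < ε → ∃ X : ℝ, ∀ (ρ : ℝ) (f : ℂ → ℂ) (n : ℕ), 1 < ρ →
      DiffContOnCl ℂ f (Gegenbauer.region ρ) → 1 ≤ n → ⌊l / Real.log ρ⌋₊ ≤ n →
      X ≤ n * Real.log ρ →
      Gegenbauer.supNorm (Gegenbauer.err l n f) ≤
        Gegenbauer.K (1 + ε) l ρ f * ((n : ℝ) ^ l / ρ ^ n)) ∧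
    -- (ii)
    (∀ l : ℝ, -1 / 2 < l → l < 0 →
      (∃ C : ℝ, 0 < C ∧ Gegenbauer.UniformBound l C 1) ∧
      ∀ (C : ℝ) (N : ℕ), Gegenbauer.UniformBound l C N →
        ∀ (ρ : ℝ) (f : ℂ → ℂ) (n : ℕ), 1 < ρ →
          DiffContOnCl ℂ f (Gegenbauer.region ρ) → N ≤ n + 1 →
          Gegenbauer.supNorm (Gegenbauer.err l n f) ≤
            Gegenbauer.D l ρ f * C / ((ρ - 1) * ρ ^ n)) ∧
    -- optimality of (i)
    (∀ l ρ : ℝ, 0 < l → 1 < ρ →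
      (∃ f : ℂ → ℂ, DiffContOnCl ℂ f (Gegenbauer.region ρ) ∧
        ∀ γ c : ℝ, 0 < γ → ∃ᶠ n : ℕ in atTop,
          c * ((n : ℝ) ^ (l - γ) / ρ ^ n) < Gegenbauer.supNorm (Gegenbauer.err l n f))) ∧
    (∀ l ω : ℝ, 0 < l → 1 < ω → ∃ c : ℝ, 0 < c ∧ ∀ n : ℕ, 1 ≤ n →
      c * ((n : ℝ) ^ l / (ω + √(ω ^ 2 - 1)) ^ n) ≤
        ‖Gegenbauer.err l n (fun z => 1 / (z - (ω : ℂ))) 1‖) ∧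
    -- optimality of (ii)
    (∀ l ρ : ℝ, -1 / 2 < l → l < 0 → 1 < ρ →
      (∃ f : ℂ → ℂ, DiffContOnCl ℂ f (Gegenbauer.region ρ) ∧
        ∀ γ c : ℝ, 0 < γ → ∃ᶠ n : ℕ in atTop,
          c * ((n : ℝ) ^ (-γ) / ρ ^ n) < Gegenbauer.supNorm (Gegenbauer.err l n f))) ∧
    (∀ l ω : ℝ, -1 / 2 < l → l < 0 → 1 < ω → ∃ c : ℝ, 0 < c ∧ ∀ n : ℕ,
      c / (ω + √(ω ^ 2 - 1)) ^ n ≤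
        Gegenbauer.supNorm (Gegenbauer.err l n (fun z => 1 / (z - (ω : ℂ))))) := by
  -- The threshold X = l(1+ε)/ε is where l/n fits into the share ε/(1+ε) of the decay rate ln ρ.
  refine ⟨⟨12, by norm_num, fun l ρ f n hl hρ hf hn hX => Gegenbauer.supNorm_err_le_K hf hρ hl hn hX⟩,
    fun l ε hl hε => ⟨l * (1 + ε) / ε, fun ρ f n hρ hf hn _ hX => ?_⟩,
    fun l hl h0 => ⟨Gegenbauer.exists_uniformBound hl h0, fun C N hC ρ f n hρ hf hN => ?_⟩,
    fun l ρ hl hρ => Gegenbauer.exists_frequently_lt_supNorm_err_of_pos hl hρ,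
    fun l ω hl hω => ?_,
    fun l ρ hl h0 hρ => Gegenbauer.exists_frequently_lt_supNorm_err_of_neg hl h0 hρ,
    fun l ω hl h0 hω => ?_⟩
  · exact Gegenbauer.supNorm_err_le_asymptotic hf hρ hl hn hε hX
      fun k hk => Gegenbauer.rat_le_K_factor hl (by omega)
  · exact Gegenbauer.supNorm_err_le_of_neg hf hρ hl h0 hC hN
  · obtain ⟨t, ht0, ht1, hω', hρ⟩ := Gegenbauer.exists_inv_joukowski hω
    obtain ⟨c, hc, h⟩ := Gegenbauer.exists_le_norm_err_one hl ht0 ht1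
    refine ⟨c, hc, fun n hn => ?_⟩
    rw [hρ, inv_pow, div_inv_eq_mul]
    simpa only [hω'] using h n hn
  · obtain ⟨t, ht0, ht1, hω', hρ⟩ := Gegenbauer.exists_inv_joukowski hω
    obtain ⟨c, hc, h⟩ := Gegenbauer.exists_le_norm_err_zero hl h0 ht0 ht1
    refine ⟨c, hc, fun n => ?_⟩
    rw [hρ, inv_pow, div_inv_eq_mul]
    have h1 := h n
    simp only [hω'] at h1
    have hcont : ContinuousOn (fun x : ℝ => 1 / ((x : ℂ) - (ω : ℂ))) (Icc (-1) 1) := by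
      refine continuousOn_const.div (by fun_prop) fun x hx h => ?_
      rw [← Complex.ofReal_sub, Complex.ofReal_eq_zero] at h
      linarith [hx.2]
    exact h1.trans (Gegenbauer.le_supNorm_err (f := fun z => 1 / (z - (ω : ℂ))) hcont l n (by norm_num))
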